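/- **Conventions.** A polytope is a full-dimensional convex polytope in $\mathbb{R}^3$. A point is *beyond* a facet $F$ of a polytope $P$ if it strictly violates the facet inequality of $F$ and strictly satisfies the inequalities of all other facets of $P$. A line *pierces* a polygon if it meets the relative interior of the polygon and is not contained in its plane. Indices $1,2,3$ are read cyclically. Six points $A_1,A_2,A_3,B_1,B_2,B_3$ are in *Schönhardt position* if they are the vertices of a (non-convex) polytope with facets $A_1A_2A_3$, $B_1B_2B_3$, $A_iA_{i+1}B_i$ and $B_iA_{i+1}B_{i+1}$ ($i=1,2,3$) whose interior angle is greater than $\pi$ exactly at the edges $B_iA_{i+1}$. Their *visibility cone* is the region bounded by the three planes $B_iB_{i+1}A_{i+1}$ on the side of the triangle $B_1B_2B_3$. An *$m$-cupola* is a convex polytope $C$ with exactly the $3m+6$ distinct vertices $q^i_k$ ($i=1,2,3$; $0\le k\le m+1$), where $A_i:=q^i_0$ and $B_{i+1}:=q^i_{m+1}$, such that the points $A_1,\dots,B_3$ are in Schönhardt position; the facets of $C$ are exactly the *bottom* $A_1A_2A_3$, the *skylight* $B_1B_2B_3$, and the triangles $B_iq^i_kq^i_{k+1}$ and $A_{i+1}q^i_kq^i_{k+1}$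 ($0\le k\le m$); and $q^i_1,\dots,q^i_m$ lie strictly on the side of the plane $B_iA_{i+1}B_{i+2}$ opposite to $B_{i+1}$. The visibility cone of $C$ is that of its six points $A_1,\dots,B_3$. **Theorem (Full-Strength Cupola Construction).** Let $P$ be a polytope, $F_1,\dots,F_n$ facets of $P$ and $H_1,\dots,H_n$ planes such that $H_i$ meets the relative interior of $F_i$ and $F_i\cap H_j=\emptyset$ for all $i\ne j$. Let $S_i=(\operatorname{vert}(P)\cap H_i)\setminus F_i$, and let $L_i$ be a finite set of lines in $H_i$, each of which pierces $F_i$ and passes through some point of $S_i$. Let $m_1,\dots,m_n$ be positive integers. Then there are $m_i$-cupolas $C_i$ ($i=1,\dots,n$) such that, with $Q=\operatorname{conv}(P\cup C_1\cup\dots\cup C_n)$, the following hold for every $i$. 1. All points of $C_i$ are beyond the facet $F_i$ of $P$. 2. (Sequential construction.) Put $P_{i-1}=\operatorname{conv}(P\cup C_1\cup\dots\cup C_{i-1})$. Then $F_i$ is a facet of $P_{i-1}$, all points of $C_i$ are beyond the facet $F_i$ of $P_{i-1}$, and all points of $P_{i-1}$ are beyond the bottom of $C_i$. 3. All points of $\operatorname{conv}(P\cup\bigcup_{j\neq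 i}C_j)$ are beyond the bottom of $C_i$. 4. The visibility cone of $C_i$ is a triangular cone that contains $S_i$ in its interior and contains no other vertices of $Q$, except for the three vertices of the skylight of $C_i$, which lie on its boundary. 5. Every line of $L_i$ pierces the skylight of $C_i$. -/

import Mathlib

/-- Euclidean three-space. -/
abbrev E3 : Type := EuclideanSpace ℝ (Fin 3)

/-! ### Convex polytopes, facets, and points beyond a face -/

/-- A convex 3-polytope: the convex hull of a finite set, with nonempty interior. -/
def IsPolytope3 (P : Set E3) : Prop :=
  (∃ s : Set E3, s.Finite ∧ P = convexHull ℝ s) ∧ (interior P).Nonempty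

/-- `f x ≤ c` is a facet-defining inequality of `P` and `G` is the facet it defines. -/
def IsFacetIneq (P G : Set E3) (f : E3 →L[ℝ] ℝ) (c : ℝ) : Prop :=
  (∀ x ∈ P, f x ≤ c) ∧ G = {x ∈ P | f x = c} ∧ Module.finrank ℝ (vectorSpan ℝ G) = 2

/-- `G` is a facet (two-dimensional face) of `P`. -/
def IsFacet (P G : Set E3) : Prop := ∃ f c, IsFacetIneq P G f c

/-- The point `p` is beyond the face `F` of `P`: it strictly violates the inequalities of all
facets containing `F` and strictly satisfies the inequalities of all other facets. -/
def IsBeyond (P F : Set E3) (p : E3) : Prop :=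
  ∀ G f c, IsFacetIneq P G f c → (F ⊆ G → c < f p) ∧ (¬ F ⊆ G → f p < c)

/-- The set of points beyond the face `F` of `P`. -/
def beyond (P F : Set E3) : Set E3 := {p | IsBeyond P F p}

/-- An affine plane. -/
def IsPlane (H : AffineSubspace ℝ E3) : Prop :=
  (H : Set E3).Nonempty ∧ Module.finrank ℝ H.direction = 2

/-- An affine line. -/
def IsLine (g : AffineSubspace ℝ E3) : Prop :=
  (g : Set E3).Nonempty ∧ Module.finrank ℝ g.direction = 1

/-- The line `g` pierces the (relative interior of the) flat convex set `T`: it meets the relative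
interior of `T` and is not contained in the affine hull of `T`. -/
def Pierces (g : AffineSubspace ℝ E3) (T : Set E3) : Prop :=
  ((g : Set E3) ∩ intrinsicInterior ℝ T).Nonempty ∧ ¬ g ≤ affineSpan ℝ T

/-- The vertices of `P` that lie in the plane `H` but not in `F`. -/
def verticesOff (P F : Set E3) (H : AffineSubspace ℝ E3) : Set E3 :=
  (P.extremePoints ℝ ∩ (H : Set E3)) \ F

/-- A triangular cone with some apex `r`, spanned by three independent directions. -/
def IsTriangularCone (V : Set E3) : Prop :=
  ∃ (r : E3) (e : Fin 3 → E3), LinearIndependent ℝ e ∧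
    V = {x | ∃ t : Fin 3 → ℝ, (∀ k, 0 ≤ t k) ∧ x = r + ∑ k, t k • e k}

/-! ### Schönhardt polytopes

Indices live in `Fin 3`, so that `i + 1` and `i + 2` are cyclic successors. -/

/-- The oriented volume (times six) of the simplex `(p, q, r, s)`. -/
noncomputable def orient (p q r s : E3) : ℝ :=
  Matrix.det (Matrix.of fun a b : Fin 3 => (![q - p, r - p, s - p] a) b)

/-- The vertex sets of the eight triangular facets of a Schönhardt polytope. -/
def schonhardtTriangles (A B : Fin 3 → E3) : Set (Set E3) :=
  {Set.range A, Set.range B} ∪ {T | ∃ i, T = {A i, A (i + 1), B i}} ∪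
    {T | ∃ i, T = {B i, A (i + 1), B (i + 1)}}

/-- The six points are the vertices of a Schönhardt polytope: the eight triangles form an embedded
closed surface, whose dihedral angle is convex (less than `π`) at the edges `A i A (i+1)`,
`B i B (i+1)`, `A i B i`, and reflex (greater than `π`) at the diagonals `B i A (i+1)`.

The surface is coherently oriented by the triangles `B 0 B 1 B 2`, `A 2 A 1 A 0`,
`A i A (i+1) B i` and `B i A (i+1) B (i+1)`; `σ` records whether this is the outward orientation
or the inward one (mirror image).  For an edge with adjacent outward triangles `p q r` and
`q p s`, the angle is convex iff `s` is strictly on the inner side of the plane `p q r`, that is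
`orient p q r s < 0`, and reflex iff `s` is strictly on the outer side. -/
def SchonhardtPosition (A B : Fin 3 → E3) : Prop :=
  Function.Injective (Sum.elim A B) ∧
  (∀ T ∈ schonhardtTriangles A B, ∀ T' ∈ schonhardtTriangles A B,
    convexHull ℝ T ∩ convexHull ℝ T' ⊆ convexHull ℝ (T ∩ T')) ∧
  ∃ σ : ℝ, (σ = 1 ∨ σ = -1) ∧ ∀ i : Fin 3,
    σ * orient (A i) (A (i + 1)) (B i) (A (i + 2)) < 0 ∧
    σ * orient (B i) (B (i + 1)) (B (i + 2)) (A (i + 1)) < 0 ∧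
    σ * orient (A i) (A (i + 1)) (B i) (B (i + 2)) < 0 ∧
    0 < σ * orient (A i) (A (i + 1)) (B i) (B (i + 1))

/-- The visibility cone: the region bounded by the three planes `B i, B (i+1), A (i+1)`, on the
side of the skylight `B 0 B 1 B 2`. -/
def visibilityCone (A B : Fin 3 → E3) : Set E3 :=
  {x | ∀ i : Fin 3, 0 ≤ orient (B i) (B (i + 1)) (A (i + 1)) x *
    orient (B i) (B (i + 1)) (A (i + 1)) (B (i + 2))}

/-! ### Cupolas -/

/-- An `m`-cupola.  The chain `q i` runs from `A i` to `B (i + 1)` and has `m` inner vertices; the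
`3 * (m + 2)` points `q i k` are all the vertices. -/
structure Cupola (m : ℕ) where
  /-- vertices of the bottom -/
  A : Fin 3 → E3
  /-- vertices of the skylight -/
  B : Fin 3 → E3
  /-- the vertex-edge chains -/
  q : Fin 3 → Fin (m + 2) → E3
  q_zero : ∀ i, q i 0 = A i
  q_last : ∀ i, q i (Fin.last (m + 1)) = B (i + 1)
  q_injective : Function.Injective (fun p : Fin 3 × Fin (m + 2) => q p.1 p.2)
  vertices_eq :
    (convexHull ℝ (Set.range fun p : Fin 3 × Fin (m + 2) => q p.1 p.2)).extremePoints ℝ =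
      Set.range fun p : Fin 3 × Fin (m + 2) => q p.1 p.2
  schonhardt : SchonhardtPosition A B
  facet_iff : ∀ G : Set E3,
    IsFacet (convexHull ℝ (Set.range fun p : Fin 3 × Fin (m + 2) => q p.1 p.2)) G ↔
      G = convexHull ℝ (Set.range A) ∨ G = convexHull ℝ (Set.range B) ∨
      ∃ (i : Fin 3) (k : Fin (m + 1)),
        G = convexHull ℝ {B i, q i k.castSucc, q i k.succ} ∨
        G = convexHull ℝ {A (i + 1), q i k.castSucc, q i k.succ}
  /-- the inner chain vertices are separated from `B (i+1)` by the plane `B i, A (i+1), B (i+2)` -/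
  chain_side : ∀ (i : Fin 3) (k : Fin (m + 2)), k ≠ 0 → k ≠ Fin.last (m + 1) →
    orient (B i) (A (i + 1)) (B (i + 2)) (q i k) *
      orient (B i) (A (i + 1)) (B (i + 2)) (B (i + 1)) < 0

namespace Cupola

variable {m : ℕ}

/-- The cupola as a convex polytope. -/
def body (C : Cupola m) : Set E3 :=
  convexHull ℝ (Set.range fun p : Fin 3 × Fin (m + 2) => C.q p.1 p.2)

/-- The bottom facet. -/
def bottom (C : Cupola m) : Set E3 := convexHull ℝ (Set.range C.A)

/-- The skylight. -/
def skylight (C : Cupola m) : Set E3 := convexHull ℝ (Set.range C.B)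

/-- The visibility cone of the cupola. -/
def cone (C : Cupola m) : Set E3 := visibilityCone C.A C.B

end Cupola

/-- The polytope obtained from `P` by attaching the bodies `K j` with `j ∈ J`. -/
def attach (P : Set E3) {n : ℕ} (K : Fin n → Set E3) (J : Set (Fin n)) : Set E3 :=
  convexHull ℝ (P ∪ ⋃ j ∈ J, K j)

/-! The cupola is first built as an affine model, then made so flat that its cone nearly coincides
with the plane `H i`, and the interaction of different cupolas is reduced to open conditions.

Model. In affine coordinates in which the visibility cone is the nonnegative orthant, take B_i = e_i
and A_i = a e_i - b e_{i+2}. For b > 0 and a > 1 + b these six points are always in Schönhardt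
position (`frame_schonhardtPosition`). The chain from A_i to B_{i+1} lies on a shallow parabola of
bulge β over that edge of the convex hull, so along a chain every linear inequality is a quadratic
in the position, and the expected facet inequalities can be checked directly
(`CupolaModel.rhs_le_and_eq_iff`). There are no further facets: a valid inequality that is tight on
an edge of two listed facets is a nonnegative combination of their inequalities
(`eq_combination_of_edge`), and the quadratics along the chains exclude a facet without such an edge
(`CupolaModel.exists_tight_subset`). At β = 0 all required inequalities other than β > 0 are strict,
so a small β > 0 satisfies them (`exists_cupolaModel`).

Flattening. Take coordinates whose axis 0 is the line where `H i` meets the plane of `F i`, whose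
coordinate 1 measures the distance from `H i`, and whose coordinate 2 is the height over `F i`. For
small τ the skylight is a triangle at height τ² whose length stays fixed while its width is of order
τ²; the apex is τ/3 higher, and the bottom is only τ⁵ below the skylight. As τ tends to 0 the cupola
collapses to a segment in the relative interior of `F i`, while below `F i` its cone becomes
unboundedly long along axis 0 and infinitely thin across `H i`. So it contains any given finite set
of points of `H i` below the facet, misses any given compact set off `H i`, and every given compact
set not above the plane of `F i` is beyond the bottom (`exists_flat_cupola`). A prescribed line
crosses the height τ² inside the skylight.

Assembly. The other facets `F j` are compact and disjoint from `H i`, so the cone over `F i` can be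
made to avoid a neighbourhood of them whose radius is fixed before any cupola is chosen
(`exists_separated_cupola`). Each cupola is then placed in an open convex set around the relative
interior of its facet that encodes all remaining requirements, and the cupolas are chosen one after
the other. -/

open Filter Topology

/-! ### Faces of convex hulls and uniqueness of facet inequalities -/

/-- A point of a convex hull that maximizes a linear functional lies in the convex hull of the
maximizing generators. -/
theorem mem_convexHull_face {S : Set E3} {f : E3 →L[ℝ] ℝ} {c : ℝ} (hS : ∀ x ∈ S, f x ≤ c)
    {x : E3} (hx : x ∈ convexHull ℝ S) (hfx : f x = c) :
    x ∈ convexHull ℝ (S ∩ {y | f y = c}) := by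
  have hconv : Convex ℝ {y : E3 | f y < c ∨ (f y = c ∧ y ∈ convexHull ℝ (S ∩ {y | f y = c}))} := by
    rw [convex_iff_forall_pos]
    intro y hy z hz a b ha hb hab
    simp only [Set.mem_ofPred_eq, map_add, map_smul, smul_eq_mul] at *
    have hb' : b = 1 - a := by linarith
    rcases hy with hy | ⟨hy, hy'⟩ <;> rcases hz with hz | ⟨hz, hz'⟩
    · left; subst hb'; nlinarith
    · left; subst hb'; nlinarith
    · left; subst hb'; nlinarith
    · right
      refine ⟨by rw [hy, hz, ← add_mul, hab, one_mul], convex_convexHull ℝ _ hy' hz' ha.le hb.le hab⟩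
  have hsub := convexHull_min (s := S) (fun y hy => ?_) hconv
  · rcases hsub hx with h | h
    · exact absurd hfx h.ne
    · exact h.2
  · rcases (hS y hy).lt_or_eq with h | h
    · exact Or.inl h
    · exact Or.inr ⟨h, subset_convexHull ℝ _ ⟨hy, h⟩⟩

theorem le_of_mem_convexHull {S : Set E3} {f : E3 →L[ℝ] ℝ} {c : ℝ} (hS : ∀ x ∈ S, f x ≤ c)
    {x : E3} (hx : x ∈ convexHull ℝ S) : f x ≤ c :=
  convexHull_min (t := {x | f x ≤ c}) hS (convex_halfSpace_le f.isLinear c) hx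

theorem face_convexHull {S : Set E3} {f : E3 →L[ℝ] ℝ} {c : ℝ} (hS : ∀ x ∈ S, f x ≤ c) :
    {x ∈ convexHull ℝ S | f x = c} = convexHull ℝ (S ∩ {y | f y = c}) := by
  ext x
  constructor
  · exact fun h => mem_convexHull_face hS h.1 h.2
  · intro h
    refine ⟨convexHull_mono Set.inter_subset_left h, le_antisymm ?_ ?_⟩
    · exact le_of_mem_convexHull (fun y hy => hS y hy.1) h
    · have := le_of_mem_convexHull (f := -f) (c := -c) (S := S ∩ {y | f y = c})
        (fun y hy => by simp [hy.2.symm]) h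
      simpa using this

theorem vectorSpan_eq_top_of_interior {P : Set E3} (hP : (interior P).Nonempty) :
    vectorSpan ℝ P = ⊤ := by
  have h := isOpen_interior.affineSpan_eq_top hP
  have h2 : affineSpan ℝ P = ⊤ := top_unique (h ▸ affineSpan_mono ℝ interior_subset)
  rw [← direction_affineSpan, h2, AffineSubspace.direction_top]

theorem finrank_E3 : Module.finrank ℝ E3 = 3 := by simp [E3]

theorem IsFacetIneq.nonempty {P G : Set E3} {f : E3 →L[ℝ] ℝ} {c : ℝ} (h : IsFacetIneq P G f c) :
    G.Nonempty := by
  by_contra hG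
  rw [Set.not_nonempty_iff_eq_empty] at hG
  have := h.2.2
  rw [hG, vectorSpan_empty, finrank_bot] at this
  omega

theorem IsFacetIneq.exists_lt {P G : Set E3} {f : E3 →L[ℝ] ℝ} {c : ℝ} (hfull : vectorSpan ℝ P = ⊤)
    (h : IsFacetIneq P G f c) : ∃ p ∈ P, f p < c := by
  by_contra! hc
  have hGP : G = P := by
    rw [h.2.1]
    ext x
    exact ⟨fun hx => hx.1, fun hx => ⟨hx, le_antisymm (h.1 x hx) (hc x hx)⟩⟩
  have := h.2.2
  rw [hGP, hfull, finrank_top, finrank_E3] at this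
  omega

theorem finrank_ker_two {f : E3 →L[ℝ] ℝ} (hf : f ≠ 0) :
    Module.finrank ℝ (LinearMap.ker (f : E3 →ₗ[ℝ] ℝ)) = 2 := by
  have h := Module.Dual.finrank_ker_add_one_of_ne_zero (f := (f : E3 →ₗ[ℝ] ℝ))
    (fun h => hf (by ext x; exact congrArg (fun g => g x) h))
  rw [finrank_E3] at h
  omega

theorem vectorSpan_eq_ker {G : Set E3} {f : E3 →L[ℝ] ℝ} {c : ℝ} (hf : f ≠ 0)
    (hG : ∀ x ∈ G, f x = c) (hr : Module.finrank ℝ (vectorSpan ℝ G) = 2) :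
    vectorSpan ℝ G = LinearMap.ker (f : E3 →ₗ[ℝ] ℝ) := by
  refine Submodule.eq_of_le_of_finrank_eq ?_ (by rw [hr, finrank_ker_two hf])
  rw [vectorSpan_def, Submodule.span_le]
  rintro _ ⟨x, hx, y, hy, rfl⟩
  simp [hG x hx, hG y hy]

theorem IsFacetIneq.ne_zero {P G : Set E3} {f : E3 →L[ℝ] ℝ} {c : ℝ} (hfull : vectorSpan ℝ P = ⊤)
    (h : IsFacetIneq P G f c) : f ≠ 0 := by
  rintro rfl
  obtain ⟨p, hp, hlt⟩ := h.exists_lt hfull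
  obtain ⟨q, hq⟩ := h.nonempty
  rw [h.2.1] at hq
  have := hq.2
  simp at this hlt
  linarith

/-- Facet inequalities are unique up to a positive factor. -/
theorem IsFacetIneq.unique {P G G' : Set E3} {f g : E3 →L[ℝ] ℝ} {c d : ℝ}
    (hfull : vectorSpan ℝ P = ⊤) (h : IsFacetIneq P G f c) (h' : IsFacetIneq P G' g d)
    (hGG : G ⊆ G') : ∃ r : ℝ, 0 < r ∧ g = r • f ∧ d = r * c := by
  have hf := h.ne_zero hfull
  have hg := h'.ne_zero hfull
  have hGf : ∀ x ∈ G, f x = c := fun x hx => by rw [h.2.1] at hx; exact hx.2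
  have hGg : ∀ x ∈ G, g x = d := fun x hx => by
    have := hGG hx
    rw [h'.2.1] at this; exact this.2
  have hker := (vectorSpan_eq_ker hf hGf h.2.2).symm.trans (vectorSpan_eq_ker hg hGg h.2.2)
  obtain ⟨p, hp, hlt⟩ := h.exists_lt hfull
  obtain ⟨q, hq⟩ := h.nonempty
  have hqf := hGf q hq
  have hqg := hGg q hq
  have hfe : f (q - p) > 0 := by simp; linarith
  have key : ∀ x, g x * f (q - p) = g (q - p) * f x := by
    intro x
    -- The kernels of f and g agree, since both are the direction of G; this vector is in the first
    -- one.
    have : f (q - p) • x - f x • (q - p) ∈ LinearMap.ker (f : E3 →ₗ[ℝ] ℝ) := by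
      simp [mul_comm]
    rw [hker] at this
    rw [LinearMap.mem_ker] at this
    simp only [ContinuousLinearMap.coe_coe, map_sub, map_smul, smul_eq_mul] at this ⊢
    linarith
  have hge : 0 < g (q - p) := by
    have h1 : 0 ≤ g (q - p) := by
      have := h'.1 p hp
      simp; linarith
    refine lt_of_le_of_ne h1 fun h0 => hg ?_
    ext x
    have := key x
    rw [← h0, zero_mul] at this
    exact (mul_eq_zero.1 this).resolve_right hfe.ne'
  refine ⟨g (q - p) / f (q - p), by positivity, ?_, ?_⟩
  · ext x
    have := key x
    simp only [smul_apply, smul_eq_mul]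
    field_simp
    linarith
  · have := key q
    rw [hqf, hqg] at this
    field_simp
    linarith

theorem IsFacetIneq.eq_of_subset {P G G' : Set E3} {f g : E3 →L[ℝ] ℝ} {c d : ℝ}
    (hfull : vectorSpan ℝ P = ⊤) (h : IsFacetIneq P G f c) (h' : IsFacetIneq P G' g d)
    (hGG : G ⊆ G') : G = G' := by
  obtain ⟨r, hr, rfl, rfl⟩ := h.unique hfull h' hGG
  rw [h.2.1, h'.2.1]
  ext x
  simp [hr.ne']

/-- A facet is the hull of the generators on it, and there are finitely many sets of generators. -/
theorem finite_setOf_isFacet {s : Set E3} (hs : s.Finite) :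
    {G | IsFacet (convexHull ℝ s) G}.Finite := by
  refine (hs.finite_subsets.image (convexHull ℝ)).subset ?_
  rintro G ⟨f, c, h⟩
  refine ⟨s ∩ {y | f y = c}, Set.inter_subset_left, ?_⟩
  rw [h.2.1, face_convexHull fun x hx => h.1 x (subset_convexHull ℝ _ hx)]

/-- A relative interior point can be moved slightly in any direction of the affine hull. -/
theorem eventually_add_smul_mem_intrinsicInterior {S : Set E3} {x v : E3}
    (hx : x ∈ intrinsicInterior ℝ S) (hv : v ∈ vectorSpan ℝ S) :
    ∀ᶠ t : ℝ in 𝓝 0, x + t • v ∈ intrinsicInterior ℝ S := by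
  rw [← direction_affineSpan] at hv
  obtain ⟨y, hy, rfl⟩ := mem_intrinsicInterior.1 hx
  have hmem : ∀ t : ℝ, (y : E3) + t • v ∈ affineSpan ℝ S := fun t => by
    rw [add_comm]
    exact AffineSubspace.vadd_mem_of_mem_direction (Submodule.smul_mem _ t hv) y.2
  let γ : ℝ → affineSpan ℝ S := fun t => ⟨y + t • v, hmem t⟩
  have hγ : Continuous γ := by
    refine Continuous.subtype_mk ?_ _
    fun_prop
  have h0 : γ 0 = y := Subtype.ext (by simp [γ])
  have : ∀ᶠ t in 𝓝 0, γ t ∈ interior ((↑) ⁻¹' S : Set (affineSpan ℝ S)) :=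
    hγ.continuousAt.eventually_mem (by rw [h0]; exact isOpen_interior.mem_nhds hy)
  exact this.mono fun t ht => mem_intrinsicInterior.2 ⟨γ t, ht, rfl⟩

/-- If f were smaller at y, then moving from x a little further away from y would stay in S and
exceed c. -/
theorem eq_of_le_of_mem_intrinsicInterior {S : Set E3} {f : E3 →L[ℝ] ℝ} {c : ℝ}
    (hS : ∀ x ∈ S, f x ≤ c) {x : E3} (hx : x ∈ intrinsicInterior ℝ S) (hfx : f x = c) :
    ∀ y ∈ S, f y = c := by
  intro y hy
  have hv : x - y ∈ vectorSpan ℝ S := vsub_mem_vectorSpan ℝ (intrinsicInterior_subset hx) hy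
  have h1 := eventually_add_smul_mem_intrinsicInterior hx hv
  have h2 : ∃ᶠ t : ℝ in 𝓝 0, 0 < t := (eventually_mem_nhdsWithin (s := Set.Ioi (0:ℝ))).frequently.filter_mono
    nhdsWithin_le_nhds
  obtain ⟨t, ht, ht'⟩ := (h2.and_eventually h1).exists
  have h3 := hS _ (intrinsicInterior_subset ht')
  simp only [map_add, map_smul, map_sub, smul_eq_mul, hfx] at h3
  have := hS y hy
  nlinarith

/-! ### The open region that a cupola over a facet may occupy -/

/-- The points that strictly satisfy the inequalities of all facets not containing `F`. -/
def facetRegion (P F : Set E3) : Set E3 :=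
  {p | ∀ G f c, IsFacetIneq P G f c → ¬ F ⊆ G → f p < c}

theorem convex_facetRegion (P F : Set E3) : Convex ℝ (facetRegion P F) := by
  intro x hx y hy a b ha hb hab G f c h hG
  exact convex_halfSpace_lt f.isLinear c (hx G f c h hG) (hy G f c h hG) ha hb hab

/-- The infinitely many inequalities reduce to one half-space per facet, by uniqueness up to a
positive factor, and there are finitely many facets. -/
theorem isOpen_facetRegion {P : Set E3} (hP : IsPolytope3 P) (F : Set E3) :
    IsOpen (facetRegion P F) := by
  obtain ⟨⟨s, hs, rfl⟩, hint⟩ := hP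
  have hfull := vectorSpan_eq_top_of_interior hint
  have : facetRegion (convexHull ℝ s) F = ⋂ G ∈ {G | IsFacet (convexHull ℝ s) G},
      {p | ∀ f c, IsFacetIneq (convexHull ℝ s) G f c → ¬ F ⊆ G → f p < c} := by
    ext p
    simp only [facetRegion, Set.mem_ofPred_eq, Set.mem_iInter]
    exact ⟨fun h G _ f c => h G f c, fun h G f c hf => h G ⟨f, c, hf⟩ f c hf⟩
  rw [this]
  refine (finite_setOf_isFacet hs).isOpen_biInter ?_
  rintro G ⟨f, c, h⟩
  by_cases hFG : F ⊆ G
  · simp [hFG]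
  · have : {p | ∀ g d, IsFacetIneq (convexHull ℝ s) G g d → ¬ F ⊆ G → g p < d} = {p | f p < c} := by
      ext p
      constructor
      · exact fun hp => hp f c h hFG
      · intro hp g d hg _
        obtain ⟨r, hr, rfl, rfl⟩ := h.unique hfull hg subset_rfl
        simpa [hr] using hp
    rw [this]
    exact isOpen_lt f.continuous continuous_const

/-- A facet inequality that is tight at a relative interior point of F is tight on all of F, so that
facet contains F. -/
theorem intrinsicInterior_subset_facetRegion {P F : Set E3} (hFP : F ⊆ P) :
    intrinsicInterior ℝ F ⊆ facetRegion P F := by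
  intro x hx G f c h hG
  refine lt_of_le_of_ne (h.1 x (hFP (intrinsicInterior_subset hx))) fun hfx => hG fun y hy => ?_
  have := eq_of_le_of_mem_intrinsicInterior (fun y hy => h.1 y (hFP hy)) hx hfx y hy
  rw [h.2.1]
  exact ⟨hFP hy, this⟩

theorem mem_beyond_of_mem_facetRegion {P F : Set E3} (hfull : vectorSpan ℝ P = ⊤)
    {f : E3 →L[ℝ] ℝ} {c : ℝ} (h : IsFacetIneq P F f c) {p : E3} (hp : p ∈ facetRegion P F)
    (hfp : c < f p) : p ∈ beyond P F := by
  intro G g d hg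
  refine ⟨fun hFG => ?_, fun hFG => hp G g d hg hFG⟩
  obtain ⟨r, hr, rfl, rfl⟩ := h.unique hfull hg hFG
  simpa [hr] using hfp

/-- A hyperplane that separates v from the hull of the remaining generators exposes v. -/
theorem exists_exposing {s : Set E3} (hs : s.Finite) {v : E3}
    (hv : v ∈ (convexHull ℝ s).extremePoints ℝ) :
    ∃ g : E3 →L[ℝ] ℝ, ∀ x ∈ convexHull ℝ s, x ≠ v → g x < g v := by
  rw [(convex_convexHull ℝ s).mem_extremePoints_iff_mem_sdiff_convexHull_sdiff] at hv
  have hv' : v ∉ convexHull ℝ (s \ {v}) := fun h =>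
    hv.2 (convexHull_mono (Set.sdiff_subset_sdiff_left (subset_convexHull ℝ s)) h)
  obtain ⟨g, u, hg, hgv⟩ := geometric_hahn_banach_closed_point (convex_convexHull ℝ (s \ {v}))
    ((hs.subset Set.sdiff_subset).isClosed_convexHull ℝ) hv'
  refine ⟨g, fun x hx hxv => ?_⟩
  have hconv : Convex ℝ {y : E3 | g y < g v ∨ y = v} := by
    rw [convex_iff_forall_pos]
    intro y hy z hz a b ha hb hab
    simp only [Set.mem_ofPred_eq, map_add, map_smul, smul_eq_mul] at *
    have hb' : b = 1 - a := by linarith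
    rcases hy with hy | rfl <;> rcases hz with hz | rfl
    · left; subst hb'; nlinarith
    · left; subst hb'; nlinarith
    · left; subst hb'; nlinarith
    · right; rw [← add_smul, hab, one_smul]
  have hsub := convexHull_min (s := s) (fun y hy => ?_) hconv
  · exact (hsub hx).resolve_right hxv
  · by_cases hyv : y = v
    · exact Or.inr hyv
    · exact Or.inl ((hg y (subset_convexHull ℝ _ ⟨hy, hyv⟩)).trans hgv)

/-! ### Cyclic coordinate triples -/

/-- The vector with entries `x, y, z` at the positions `i, i + 1, i + 2`. -/
def cyc (i : Fin 3) (x y z : ℝ) : Fin 3 → ℝ := fun k => if k = i then x else if k = i + 1 then y else z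

theorem cyc_self (i : Fin 3) (x y z : ℝ) : cyc i x y z i = x := by simp [cyc]

theorem cyc_add_one (i : Fin 3) (x y z : ℝ) : cyc i x y z (i + 1) = y := by
  fin_cases i <;> simp [cyc]

theorem cyc_add_two (i : Fin 3) (x y z : ℝ) : cyc i x y z (i + 2) = z := by
  fin_cases i <;> simp [cyc]

theorem eq_cyc (i : Fin 3) (v : Fin 3 → ℝ) : v = cyc i (v i) (v (i + 1)) (v (i + 2)) := by
  funext k
  fin_cases i <;> fin_cases k <;> simp [cyc]

theorem cyc_add_one_eq (i : Fin 3) (x y z : ℝ) : cyc (i + 1) x y z = cyc i z x y := by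
  funext k
  fin_cases i <;> fin_cases k <;> simp [cyc]

theorem cyc_add_two_eq (i : Fin 3) (x y z : ℝ) : cyc (i + 2) x y z = cyc i y z x := by
  funext k
  fin_cases i <;> fin_cases k <;> simp [cyc]

theorem cyc_dotProduct (i : Fin 3) (x y z x' y' z' : ℝ) :
    cyc i x y z ⬝ᵥ cyc i x' y' z' = x * x' + y * y' + z * z' := by
  fin_cases i <;> simp [cyc, dotProduct, Fin.sum_univ_three] <;> ring

theorem fin3_cases (i j : Fin 3) : j = i ∨ j = i + 1 ∨ j = i + 2 := by
  revert i j; decide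

/-! ### The cupola model and its facet inequalities -/

/-- The parameters of a cupola in the coordinates of its visibility cone: the bottom has the
vertices `a e i - b e (i + 2)`, the skylight has the vertices `e i`, the inner chain vertices bulge
by `β`, and `p` are the positions along a chain.  The remaining entries are coefficients of the
side facets. -/
structure CupolaModel (m : ℕ) where
  a : ℝ
  b : ℝ
  β : ℝ
  p : Fin (m + 2) → ℝ
  νB : Fin (m + 1) → ℝ
  lamA : Fin (m + 1) → ℝ
  νA : Fin (m + 1) → ℝ
  hm : 1 ≤ m
  hb : 0 < b
  hβ : 0 < β
  hab : β < a - 1 - b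
  p_zero : p 0 = 1
  p_last : p (Fin.last (m + 1)) = 0
  p_anti : StrictAnti p
  -- This makes the facet functional through B_i equal to 1 + νB β (p - p_k)(p - p_{k+1}) on chain
  -- i: the two sides agree at p = 0 by the form of the normal and at p = 1 by this equation.
  νB_eq : ∀ k : Fin (m + 1), (b + β * (1 - p k.castSucc) * (1 - p k.succ)) * νB k = a - 1
  νB_gt : ∀ k, 1 < νB k
  νB_gt' : ∀ k : Fin (m + 1), (1 + νB k * (β * p k.castSucc * p k.succ)) * (b + β) < νB k * a - 1
  -- The first equation plays the same role for the triangle at A_{i+1}; the second puts A_{i+1}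
  -- itself on the facet plane.
  lamA_eq : ∀ k : Fin (m + 1),
    lamA k * a = 1 + νA k * (b + β * (1 - p k.castSucc) * (1 - p k.succ))
  lamA_eq' : ∀ k : Fin (m + 1), (1 + νA k * (β * p k.castSucc * p k.succ)) * a = 1 + lamA k * b
  lamA_gt : ∀ k, 1 < lamA k
  νA_gt : ∀ k, 1 + lamA k * β < νA k
  νA_gt' : ∀ k : Fin (m + 1), (1 + νA k * (β * p k.castSucc * p k.succ)) * (b + β) < νA k * a - 1
  -- The plane through B_i, A_{i+1}, B_{i+2} is x + ((1 + b)/a) y + z = 1, and B_{i+1} has the value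
  -- (1 + b)/a < 1; inner chain vertices must exceed 1.
  side : ∀ k, k ≠ 0 → k ≠ Fin.last (m + 1) →
    1 < p k * a - (b * p k + β * p k * (1 - p k)) + (1 - p k) * ((1 + b) / a)

/-- The facets of an `m`-cupola. -/
inductive CupolaFacet (m : ℕ)
  | bot : CupolaFacet m
  | top : CupolaFacet m
  | sideB (i : Fin 3) (k : Fin (m + 1)) : CupolaFacet m
  | sideA (i : Fin 3) (k : Fin (m + 1)) : CupolaFacet m

namespace CupolaFacet

/-- The indices of the vertices of a facet. -/
def verts {m : ℕ} : CupolaFacet m → Set (Fin 3 × Fin (m + 2))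
  | bot => {x | x.2 = 0}
  | top => {x | x.2 = Fin.last (m + 1)}
  -- The apex B_i is the last vertex of chain i + 2, because chain i ends in B_{i+1}.
  | sideB i k => {(i, k.castSucc), (i, k.succ), (i + 2, Fin.last (m + 1))}
  | sideA i k => {(i, k.castSucc), (i, k.succ), (i + 1, 0)}

end CupolaFacet

namespace CupolaModel

variable {m : ℕ} (M : CupolaModel m)

/-- The vertices in coordinates. -/
def vert (x : Fin 3 × Fin (m + 2)) : Fin 3 → ℝ :=
  cyc x.1 (M.a * M.p x.2) (1 - M.p x.2) (-(M.b * M.p x.2 + M.β * M.p x.2 * (1 - M.p x.2)))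

/-- The inner normals of the facets. -/
def normal : CupolaFacet m → Fin 3 → ℝ
  | .bot => fun _ => -1
  | .top => fun _ => 1
  | .sideB i k => cyc i 1 (1 + M.νB k * (M.β * M.p k.castSucc * M.p k.succ)) (M.νB k)
  | .sideA i k => cyc i (M.lamA k) (1 + M.νA k * (M.β * M.p k.castSucc * M.p k.succ)) (M.νA k)

/-- The right hand sides of the facet inequalities. -/
def rhs : CupolaFacet m → ℝ
  | .bot => -(M.a - M.b)
  | .top => 1
  | .sideB _ _ => 1
  | .sideA _ _ => 1

theorem p_nonneg (k : Fin (m + 2)) : 0 ≤ M.p k := M.p_last ▸ M.p_anti.antitone (Fin.le_last k)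

theorem p_le_one (k : Fin (m + 2)) : M.p k ≤ 1 := M.p_zero ▸ M.p_anti.antitone (Fin.zero_le k)

theorem p_eq_zero_iff (k : Fin (m + 2)) : M.p k = 0 ↔ k = Fin.last (m + 1) := by
  rw [← M.p_last]; exact M.p_anti.injective.eq_iff

theorem p_eq_one_iff (k : Fin (m + 2)) : M.p k = 1 ↔ k = 0 := by
  rw [← M.p_zero]; exact M.p_anti.injective.eq_iff

/-- No chain position lies strictly between two consecutive ones, so the quadratic with these two
zeros is nonnegative at all positions. -/
theorem p_mul_nonneg (k : Fin (m + 1)) (l : Fin (m + 2)) :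
    0 ≤ (M.p l - M.p k.castSucc) * (M.p l - M.p k.succ) := by
  rcases le_or_gt l k.castSucc with h | h
  · have h1 := M.p_anti.antitone h
    have h2 := M.p_anti.antitone (Fin.castSucc_lt_succ (i := k)).le
    exact mul_nonneg (by linarith) (by linarith)
  · have h1 := M.p_anti.antitone (Fin.castSucc_lt_iff_succ_le.1 h)
    have h2 := M.p_anti.antitone (Fin.castSucc_lt_succ (i := k)).le
    exact mul_nonneg_of_nonpos_of_nonpos (by linarith) (by linarith)

theorem p_mul_eq_zero_iff (k : Fin (m + 1)) (l : Fin (m + 2)) :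
    (M.p l - M.p k.castSucc) * (M.p l - M.p k.succ) = 0 ↔ l = k.castSucc ∨ l = k.succ := by
  rw [mul_eq_zero, sub_eq_zero, sub_eq_zero, M.p_anti.injective.eq_iff, M.p_anti.injective.eq_iff]

theorem const_dotProduct_cyc (i : Fin 3) (c x y z : ℝ) :
    (fun _ => c) ⬝ᵥ cyc i x y z = c * (x + y + z) := by
  fin_cases i <;> simp [cyc, dotProduct, Fin.sum_univ_three] <;> ring

theorem normal_sideB_zero (i : Fin 3) (k : Fin (m + 1)) (l : Fin (m + 2)) :
    M.normal (.sideB i k) ⬝ᵥ M.vert (i, l) =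
      1 + M.νB k * M.β * ((M.p l - M.p k.castSucc) * (M.p l - M.p k.succ)) := by
  simp only [normal, vert, cyc_dotProduct]
  linear_combination (-M.p l) * M.νB_eq k

theorem normal_sideB_one (i : Fin 3) (k : Fin (m + 1)) (l : Fin (m + 2)) :
    1 < M.normal (.sideB i k) ⬝ᵥ M.vert (i + 1, l) := by
  simp only [normal, vert, cyc_add_one_eq, cyc_dotProduct]
  have h1 := M.νB_gt k
  have h2 := M.p_nonneg l
  have h3 := M.p_le_one l
  have h4 := M.hab
  have hb := M.hb
  have hβ := M.hβ
  have h5 : 0 ≤ M.νB k * (M.β * M.p k.castSucc * M.p k.succ) := by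
    have := M.p_nonneg k.castSucc
    have := M.p_nonneg k.succ
    positivity
  generalize M.νB k * (M.β * M.p k.castSucc * M.p k.succ) = w at *
  generalize M.p l = s at *
  have e1 : 0 ≤ w * (M.a * s) := mul_nonneg h5 (mul_nonneg (by linarith) h2)
  rcases h2.eq_or_lt with rfl | h2
  · nlinarith
  · have e2 : 0 < s * (M.a - 1 - M.b - M.β * (1 - s)) := mul_pos h2 (by nlinarith)
    have e3 : 0 ≤ (M.νB k - 1) * (1 - s) := mul_nonneg (by linarith) (by linarith)
    nlinarith

/-- The factor p isolates the only tight vertex of chain i + 2, its end B_i. -/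
theorem normal_sideB_two (i : Fin 3) (k : Fin (m + 1)) (l : Fin (m + 2)) :
    ∃ c > 0, M.normal (.sideB i k) ⬝ᵥ M.vert (i + 2, l) = 1 + M.p l * c := by
  simp only [normal, vert, cyc_add_two_eq, cyc_dotProduct]
  have h1 := M.νB_gt k
  have h2 := M.p_nonneg l
  have h3 := M.p_le_one l
  have hb := M.hb
  have hβ := M.hβ
  have h6 := M.νB_gt' k
  have h5 : 0 ≤ M.νB k * (M.β * M.p k.castSucc * M.p k.succ) := by
    have := M.p_nonneg k.castSucc
    have := M.p_nonneg k.succ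
    positivity
  generalize M.νB k * (M.β * M.p k.castSucc * M.p k.succ) = w at *
  generalize M.p l = s at *
  refine ⟨M.νB k * M.a - 1 - (1 + w) * (M.b + M.β * (1 - s)), ?_, by ring⟩
  have : 0 ≤ (1 + w) * (M.β * s) := by positivity
  nlinarith

theorem normal_sideA_zero (i : Fin 3) (k : Fin (m + 1)) (l : Fin (m + 2)) :
    M.normal (.sideA i k) ⬝ᵥ M.vert (i, l) =
      1 + M.νA k * M.β * ((M.p l - M.p k.castSucc) * (M.p l - M.p k.succ)) := by
  simp only [normal, vert, cyc_dotProduct]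
  linear_combination M.p l * M.lamA_eq k

/-- The factor 1 - p isolates the only tight vertex of chain i + 1, its start A_{i+1}. -/
theorem normal_sideA_one (i : Fin 3) (k : Fin (m + 1)) (l : Fin (m + 2)) :
    ∃ c > 0, M.normal (.sideA i k) ⬝ᵥ M.vert (i + 1, l) = 1 + (1 - M.p l) * c := by
  simp only [normal, vert, cyc_add_one_eq, cyc_dotProduct]
  have h2 := M.p_nonneg l
  have h3 := M.p_le_one l
  have hβ := M.hβ
  have h7 := M.lamA_gt k
  refine ⟨M.νA k - 1 - M.lamA k * M.β * M.p l, ?_, ?_⟩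
  · have : 0 ≤ M.lamA k * M.β * (1 - M.p l) :=
      mul_nonneg (mul_nonneg (by linarith) hβ.le) (by linarith)
    have := M.νA_gt k
    nlinarith
  · linear_combination M.p l * M.lamA_eq' k

theorem normal_sideA_two (i : Fin 3) (k : Fin (m + 1)) (l : Fin (m + 2)) :
    1 < M.normal (.sideA i k) ⬝ᵥ M.vert (i + 2, l) := by
  simp only [normal, vert, cyc_add_two_eq, cyc_dotProduct]
  have h1 := M.νA_gt k
  have h2 := M.p_nonneg l
  have h3 := M.p_le_one l
  have hb := M.hb
  have hβ := M.hβ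
  have h6 := M.νA_gt' k
  have h7 := M.lamA_gt k
  have h5 : 0 ≤ M.νA k * (M.β * M.p k.castSucc * M.p k.succ) := by
    have := M.p_nonneg k.castSucc
    have := M.p_nonneg k.succ
    have : 0 ≤ M.νA k := by nlinarith
    positivity
  generalize M.νA k * (M.β * M.p k.castSucc * M.p k.succ) = w at *
  generalize M.p l = s at *
  have e1 : 0 ≤ (1 + w) * (M.β * s) := by positivity
  have e2 : 0 ≤ s * (M.νA k * M.a - 1 - (1 + w) * (M.b + M.β) + (1 + w) * (M.β * s)) :=
    mul_nonneg h2 (by linarith)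
  rcases h2.eq_or_lt with rfl | h2
  · nlinarith
  · have e2 : 0 < s * (M.νA k * M.a - 1 - (1 + w) * (M.b + M.β) + (1 + w) * (M.β * s)) :=
      mul_pos h2 (by linarith)
    have e3 : 0 ≤ (M.lamA k - 1) * (1 - s) := mul_nonneg (by linarith) (by linarith)
    nlinarith

theorem normal_top (i : Fin 3) (l : Fin (m + 2)) :
    ∃ c > 0, M.normal .top ⬝ᵥ M.vert (i, l) = 1 + M.p l * c := by
  simp only [normal, vert, const_dotProduct_cyc]
  refine ⟨M.a - 1 - M.b - M.β * (1 - M.p l), ?_, by ring⟩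
  have := M.hab
  have := mul_nonneg M.hβ.le (M.p_nonneg l)
  nlinarith

theorem normal_bot (i : Fin 3) (l : Fin (m + 2)) :
    ∃ c > 0, M.normal .bot ⬝ᵥ M.vert (i, l) = -(M.a - M.b) + (1 - M.p l) * c := by
  simp only [normal, vert, const_dotProduct_cyc]
  refine ⟨M.a - 1 - M.b + M.β * M.p l, ?_, by ring⟩
  have := M.hab
  have := M.hβ
  have := mul_nonneg M.hβ.le (M.p_nonneg l)
  nlinarith

/-- The signed incidence table of vertices and facets. On each chain the slack is a nonnegative
quadratic, a linear factor times a positive number, or positive, so its zeros can be read off. -/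
theorem rhs_le_and_eq_iff (t : CupolaFacet m) (x : Fin 3 × Fin (m + 2)) :
    M.rhs t ≤ M.normal t ⬝ᵥ M.vert x ∧ (M.normal t ⬝ᵥ M.vert x = M.rhs t ↔ x ∈ t.verts) := by
  obtain ⟨j, l⟩ := x
  have hl := M.p_nonneg l
  have hl' := M.p_le_one l
  have ne1 : ∀ i : Fin 3, i + 1 ≠ i := by decide
  have ne2 : ∀ i : Fin 3, i + 2 ≠ i := by decide
  have ne3 : ∀ i : Fin 3, i + 1 ≠ i + 2 := by decide
  have ne4 : ∀ i : Fin 3, i + 2 ≠ i + 1 := by decide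
  cases t with
  | bot =>
    obtain ⟨c, hc, h⟩ := M.normal_bot j l
    rw [h]
    refine ⟨by simp only [rhs]; nlinarith, ?_⟩
    simp [rhs, CupolaFacet.verts, hc.ne', sub_eq_zero, eq_comm (a := (1 : ℝ)), M.p_eq_one_iff]
  | top =>
    obtain ⟨c, hc, h⟩ := M.normal_top j l
    rw [h]
    refine ⟨by simp only [rhs]; nlinarith, ?_⟩
    simp [rhs, CupolaFacet.verts, hc.ne', M.p_eq_zero_iff]
  | sideB i k =>
    have hν := M.νB_gt k
    have hβ := M.hβ
    rcases fin3_cases i j with rfl | rfl | rfl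
    · rw [M.normal_sideB_zero]
      have h0 : 0 < M.νB k * M.β := by positivity
      refine ⟨?_, ?_⟩
      · have := mul_nonneg h0.le (M.p_mul_nonneg k l)
        simp only [rhs]; linarith
      · simp only [rhs, add_eq_left, mul_eq_zero, h0.ne', false_or, CupolaFacet.verts]
        rw [← mul_eq_zero, M.p_mul_eq_zero_iff]
        simp [(ne2 j).symm]
    · have := M.normal_sideB_one i k l
      refine ⟨this.le, ?_⟩
      simp [rhs, this.ne', CupolaFacet.verts, ne1, ne3]
    · obtain ⟨c, hc, h⟩ := M.normal_sideB_two i k l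
      rw [h]
      refine ⟨by simp only [rhs]; nlinarith, ?_⟩
      simp [rhs, CupolaFacet.verts, hc.ne', M.p_eq_zero_iff, ne2]
  | sideA i k =>
    have hν : 0 < M.νA k := by
      have := M.νA_gt k
      have := mul_pos (zero_lt_one.trans (M.lamA_gt k)) M.hβ
      linarith
    have hβ := M.hβ
    rcases fin3_cases i j with rfl | rfl | rfl
    · rw [M.normal_sideA_zero]
      have h0 : 0 < M.νA k * M.β := by positivity
      refine ⟨?_, ?_⟩
      · have := mul_nonneg h0.le (M.p_mul_nonneg k l)
        simp only [rhs]; linarith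
      · simp only [rhs, add_eq_left, mul_eq_zero, h0.ne', false_or, CupolaFacet.verts]
        rw [← mul_eq_zero, M.p_mul_eq_zero_iff]
        simp [(ne1 j).symm]
    · obtain ⟨c, hc, h⟩ := M.normal_sideA_one i k l
      rw [h]
      refine ⟨by simp only [rhs]; nlinarith, ?_⟩
      simp [rhs, CupolaFacet.verts, hc.ne', sub_eq_zero, eq_comm (a := (1 : ℝ)), M.p_eq_one_iff,
        ne1]
    · have := M.normal_sideA_two i k l
      refine ⟨this.le, ?_⟩
      simp [rhs, this.ne', CupolaFacet.verts, ne2, ne4]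

end CupolaModel

/-! ### Completeness of the list of facets -/

/-- The three differences from v form a basis, on which the slack of f agrees with the combination
fixed by its values at u₁ and u₂. Validity of f at these two points makes the coefficients
nonnegative. -/
theorem eq_combination_of_edge {f f₁ f₂ : E3 →L[ℝ] ℝ} {c c₁ c₂ : ℝ} {v w u₁ u₂ : E3} (hvw : v ≠ w)
    (hfv : f v = c) (hfw : f w = c) (h1v : f₁ v = c₁) (h1w : f₁ w = c₁) (h2v : f₂ v = c₂)
    (h2w : f₂ w = c₂) (h1u : f₁ u₁ = c₁) (h2u : f₂ u₁ < c₂) (h2u' : f₂ u₂ = c₂)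
    (h1u' : f₁ u₂ < c₁) (hu : f u₁ ≤ c) (hu' : f u₂ ≤ c) :
    ∃ x y : ℝ, 0 ≤ x ∧ 0 ≤ y ∧ ∀ p, c - f p = x * (c₁ - f₁ p) + y * (c₂ - f₂ p) := by
  have hli : LinearIndependent ℝ ![w - v, u₁ - v, u₂ - v] := by
    rw [Fintype.linearIndependent_iff]
    intro g hg
    simp only [Fin.sum_univ_three, Matrix.cons_val_zero, Matrix.cons_val_one,
      Matrix.cons_val_two, Matrix.head_cons, Matrix.tail_cons] at hg
    have e1 := congrArg f₁ hg
    have e2 := congrArg f₂ hg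
    simp only [map_add, map_smul, map_sub, map_zero, smul_eq_mul, h1v, h1w, h2v, h2w, h1u, h2u',
      sub_self, mul_zero, zero_add, add_zero] at e1 e2
    have g2 : g 2 = 0 := (mul_eq_zero.1 e1).resolve_right (by linarith)
    have g1 : g 1 = 0 := (mul_eq_zero.1 e2).resolve_right (by linarith)
    rw [g1, g2, zero_smul, zero_smul, add_zero, add_zero, smul_eq_zero, sub_eq_zero] at hg
    have g0 : g 0 = 0 := hg.resolve_right hvw.symm
    intro i; fin_cases i <;> assumption
  let B := basisOfLinearIndependentOfCardEqFinrank hli (by simp)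
  have hB : ⇑B = ![w - v, u₁ - v, u₂ - v] := coe_basisOfLinearIndependentOfCardEqFinrank hli _
  have k1 : c₁ - f₁ u₂ ≠ 0 := by linarith
  have k2 : c₂ - f₂ u₁ ≠ 0 := by linarith
  refine ⟨(c - f u₂) / (c₁ - f₁ u₂), (c - f u₁) / (c₂ - f₂ u₁),
    div_nonneg (by linarith) (by linarith), div_nonneg (by linarith) (by linarith), ?_⟩
  set x := (c - f u₂) / (c₁ - f₁ u₂) with hx
  set y := (c - f u₁) / (c₂ - f₂ u₁) with hy
  have hx' : x * (c₁ - f₁ u₂) = c - f u₂ := div_mul_cancel₀ _ k1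
  have hy' : y * (c₂ - f₂ u₁) = c - f u₁ := div_mul_cancel₀ _ k2
  have hlin : (f : E3 →ₗ[ℝ] ℝ) = ((x • f₁ + y • f₂ : E3 →L[ℝ] ℝ) : E3 →ₗ[ℝ] ℝ) := by
    refine B.ext fun i => ?_
    rw [hB]
    fin_cases i
    · simp [hfv, hfw, h1v, h1w, h2v, h2w]
    · simp [hfv, h1v, h2v, h1u]; linarith
    · simp [hfv, h1v, h2v, h2u']; linarith
  intro p
  have := congrArg (fun g => g (p - v)) hlin
  simp only [ContinuousLinearMap.coe_coe, add_apply, smul_apply,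
    map_sub, smul_eq_mul, hfv, h1v, h2v] at this
  linarith

theorem finrank_vectorSpan_triangle {v w u : E3} {g : E3 →L[ℝ] ℝ} (hvw : v ≠ w) (hg : g v = g w)
    (hgu : g u ≠ g v) : Module.finrank ℝ (vectorSpan ℝ ({v, w, u} : Set E3)) = 2 := by
  have hnc : ¬ Collinear ℝ ({v, w, u} : Set E3) := by
    rw [collinear_iff_of_mem (p₀ := v) (by simp)]
    rintro ⟨d, h⟩
    obtain ⟨x, hx⟩ := h w (by simp)
    obtain ⟨y, hy⟩ := h u (by simp)
    have h1 := congrArg g hx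
    have h2 := congrArg g hy
    simp only [vadd_eq_add, map_add, map_smul, smul_eq_mul] at h1 h2
    have hx0 : x ≠ 0 := by
      rintro rfl
      simp at hx
      exact hvw hx.symm
    have : g d = 0 := (mul_eq_zero.1 (show x * g d = 0 by linarith)).resolve_left hx0
    rw [this] at h2
    exact hgu (by linarith)
  have hai := affineIndependent_iff_not_collinear_set.2 hnc
  have h := hai.finrank_vectorSpan (n := 2) (by simp)
  rwa [show Set.range ![v, w, u] = {v, w, u} by
    rw [Matrix.range_cons, Matrix.range_cons, Matrix.range_cons, Matrix.range_empty]
    ext x; simp only [Set.mem_union, Set.mem_singleton_iff, Set.mem_insert_iff, Set.mem_empty_iff_false]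
    tauto] at h

namespace CupolaFacet

variable {m : ℕ}

/-- Two vertex indices that are joined by a common edge of two of the triangular facets. -/
def Edge (v w : Fin 3 × Fin (m + 2)) : Prop :=
  ∃ (t₁ t₂ : CupolaFacet m) (u₁ u₂ : Fin 3 × Fin (m + 2)), v ∈ t₁.verts ∧ w ∈ t₁.verts ∧
    v ∈ t₂.verts ∧ w ∈ t₂.verts ∧ u₁ ∈ t₁.verts ∧ u₁ ∉ t₂.verts ∧ u₂ ∈ t₂.verts ∧ u₂ ∉ t₁.verts

theorem Edge.symm {v w : Fin 3 × Fin (m + 2)} (h : Edge v w) : Edge w v := by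
  obtain ⟨t₁, t₂, u₁, u₂, h1, h2, h3, h4, h5⟩ := h
  exact ⟨t₁, t₂, u₁, u₂, h2, h1, h4, h3, h5⟩

theorem fin3_ne (i : Fin 3) : i + 1 ≠ i ∧ i + 2 ≠ i ∧ i + 1 ≠ i + 2 ∧ i ≠ i + 1 ∧ i ≠ i + 2 ∧
    i + 2 ≠ i + 1 := by
  revert i; decide

theorem fin3_add (i : Fin 3) : i + 1 + 1 = i + 2 ∧ i + 1 + 2 = i ∧ i + 2 + 1 = i ∧
    i + 2 + 2 = i + 1 := by
  revert i; decide

theorem edge_chain (i : Fin 3) (k : Fin (m + 1)) : Edge (i, k.castSucc) (i, k.succ) := by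
  obtain ⟨h1, h2, h3, h4, h5, h6⟩ := fin3_ne i
  refine ⟨sideB i k, sideA i k, (i + 2, Fin.last _), (i + 1, 0), ?_⟩
  simp [verts, *]

theorem edge_bot (i : Fin 3) : Edge (m := m) (i + 1, 0) (i, 0) := by
  obtain ⟨h1, h2, h3, h4, h5, h6⟩ := fin3_ne i
  refine ⟨bot, sideA i 0, (i + 2, 0), (i, 1), ?_⟩
  simp [verts, *]

theorem edge_top (i : Fin 3) : Edge (m := m) (i + 2, Fin.last (m + 1)) (i, Fin.last (m + 1)) := by
  obtain ⟨h1, h2, h3, h4, h5, h6⟩ := fin3_ne i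
  refine ⟨top, sideB i (Fin.last m), (i + 1, Fin.last _), (i, (Fin.last m).castSucc), ?_⟩
  simp [verts, *]

theorem edge_vertical (i : Fin 3) : Edge (m := m) (i + 1, 0) (i, Fin.last (m + 1)) := by
  obtain ⟨h1, h2, h3, h4, h5, h6⟩ := fin3_ne i
  obtain ⟨a1, a2, a3, a4⟩ := fin3_add i
  refine ⟨sideA i (Fin.last m), sideB (i + 1) 0, (i, (Fin.last m).castSucc), (i + 1, 1), ?_⟩
  simp [verts, *]

/-- The triangles `sideA i k` form a fan with apex A_{i+1} over chain i. Consecutive triangles share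
an inner spoke; the two outer spokes border the bottom and the fan of B_{i+1}. -/
theorem edge_A (i : Fin 3) (l : Fin (m + 2)) : Edge (i + 1, 0) (i, l) := by
  obtain ⟨h1, h2, h3, h4, h5, h6⟩ := fin3_ne i
  by_cases h0 : l = 0
  · subst h0; exact edge_bot i
  by_cases hl : l = Fin.last (m + 1)
  · subst hl; exact edge_vertical i
  obtain ⟨k, rfl⟩ := Fin.exists_succ_eq.2 h0
  obtain ⟨k', hk'⟩ := Fin.exists_castSucc_eq.2 hl
  refine ⟨sideA i k, sideA i k', (i, k.castSucc), (i, k'.succ), ?_⟩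
  have hv : k'.val = k.val + 1 := by simpa using congrArg Fin.val hk'
  simp [verts, *, Fin.ext_iff, -Fin.val_eq_zero_iff]; omega

/-- The mirror situation: the triangles `sideB i k` form a fan with apex B_i over chain i. -/
theorem edge_B (i : Fin 3) (l : Fin (m + 2)) : Edge (i + 2, Fin.last (m + 1)) (i, l) := by
  obtain ⟨h1, h2, h3, h4, h5, h6⟩ := fin3_ne i
  by_cases hl : l = Fin.last (m + 1)
  · subst hl; exact edge_top i
  by_cases h0 : l = 0
  · subst h0
    have := edge_vertical (m := m) (i + 2)
    rw [(fin3_add i).2.2.1] at this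
    exact this.symm
  obtain ⟨k, rfl⟩ := Fin.exists_succ_eq.2 h0
  obtain ⟨k', hk'⟩ := Fin.exists_castSucc_eq.2 hl
  refine ⟨sideB i k, sideB i k', (i, k.castSucc), (i, k'.succ), ?_⟩
  have hv : k'.val = k.val + 1 := by simpa using congrArg Fin.val hk'
  simp [verts, *, Fin.ext_iff, -Fin.val_eq_zero_iff]; omega

end CupolaFacet

/-! ### Affine frames -/

section Frame

variable (r : E3) (bs : Module.Basis (Fin 3) ℝ E3)

/-- The point with coordinates `v` in the frame with origin `r` and basis `bs`. -/
noncomputable def framePt (v : Fin 3 → ℝ) : E3 := r + ∑ k, v k • bs k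

/-- The linear functional with coefficients `n` in the basis `bs`. -/
noncomputable def frameLin (n : Fin 3 → ℝ) : E3 →L[ℝ] ℝ :=
  LinearMap.toContinuousLinearMap (∑ k, n k • bs.coord k)

theorem frameLin_apply (n : Fin 3 → ℝ) (x : E3) : frameLin bs n x = n ⬝ᵥ ⇑(bs.repr x) := by
  simp [frameLin, dotProduct]

theorem frameLin_framePt (n v : Fin 3 → ℝ) :
    frameLin bs n (framePt r bs v) = frameLin bs n r + n ⬝ᵥ v := by
  rw [framePt, map_add, frameLin_apply bs n (∑ k, v k • bs k)]
  congr 2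
  exact bs.repr_sum_self v

theorem eq_frameLin (f : E3 →L[ℝ] ℝ) : f = frameLin bs (fun k => f (bs k)) := by
  have : (f : E3 →ₗ[ℝ] ℝ) = (frameLin bs (fun k => f (bs k)) : E3 →ₗ[ℝ] ℝ) := by
    refine bs.ext fun i => ?_
    simp [frameLin_apply, dotProduct, Finsupp.single_apply]
  ext x
  exact congrArg (fun g => g x) this

theorem framePt_repr (x : E3) : framePt r bs (bs.repr (x - r)) = x := by
  rw [framePt, bs.sum_repr, add_sub_cancel]

theorem framePt_injective : Function.Injective (framePt r bs) := by
  intro v w h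
  have h' : ∑ k, v k • bs k = ∑ k, w k • bs k := by simpa [framePt] using h
  rw [← bs.repr_sum_self v, ← bs.repr_sum_self w, h']

theorem repr_framePt_sub (v : Fin 3 → ℝ) : ⇑(bs.repr (framePt r bs v - r)) = v := by
  rw [framePt, add_sub_cancel_left]; exact bs.repr_sum_self v

end Frame

/-! ### The model in a frame: no facets beyond the listed ones -/

namespace CupolaModel

variable {m : ℕ} (M : CupolaModel m) (r : E3) (bs : Module.Basis (Fin 3) ℝ E3)

/-- The vertices of the cupola in a frame. -/
noncomputable def pt (x : Fin 3 × Fin (m + 2)) : E3 := framePt r bs (M.vert x)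

/-- The functional of a facet inequality. -/
noncomputable def fn (t : CupolaFacet m) : E3 →L[ℝ] ℝ := frameLin bs (-(M.normal t))

/-- The right hand side of a facet inequality. -/
noncomputable def cst (t : CupolaFacet m) : ℝ := frameLin bs (-(M.normal t)) r - M.rhs t

/-- The sign change turns the inner inequality of the model into the outer form of `IsFacetIneq`
with the same slack. -/
theorem cst_sub_fn (t : CupolaFacet m) (v : Fin 3 → ℝ) :
    M.cst r bs t - M.fn bs t (framePt r bs v) = M.normal t ⬝ᵥ v - M.rhs t := by
  rw [cst, fn, frameLin_framePt, neg_dotProduct]; ring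

theorem fn_pt_le (t : CupolaFacet m) (x : Fin 3 × Fin (m + 2)) :
    M.fn bs t (M.pt r bs x) ≤ M.cst r bs t := by
  have := M.cst_sub_fn r bs t (M.vert x)
  have := (M.rhs_le_and_eq_iff t x).1
  rw [pt]; linarith

theorem fn_pt_eq_iff (t : CupolaFacet m) (x : Fin 3 × Fin (m + 2)) :
    M.fn bs t (M.pt r bs x) = M.cst r bs t ↔ x ∈ t.verts := by
  have := M.cst_sub_fn r bs t (M.vert x)
  rw [← (M.rhs_le_and_eq_iff t x).2, pt]
  constructor <;> intro h <;> linarith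

theorem fn_pt_lt (t : CupolaFacet m) {x : Fin 3 × Fin (m + 2)} (hx : x ∉ t.verts) :
    M.fn bs t (M.pt r bs x) < M.cst r bs t :=
  lt_of_le_of_ne (M.fn_pt_le r bs t x) (fun h => hx ((M.fn_pt_eq_iff r bs t x).1 h))

theorem bulge_nonneg (k : Fin (m + 2)) : 0 ≤ M.b * M.p k + M.β * M.p k * (1 - M.p k) := by
  have := M.p_nonneg k
  have := M.p_le_one k
  have := M.hb
  have := M.hβ
  have : 0 ≤ 1 - M.p k := by linarith
  positivity

theorem a_pos : 0 < M.a := by linarith [M.hab, M.hb, M.hβ]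

/-- In entry i the first point is nonnegative and the second nonpositive, so equality forces both
positions to be 0, where the points are different unit vectors. -/
theorem vert_ne_of_add_one (i : Fin 3) (k l : Fin (m + 2)) : M.vert (i, k) ≠ M.vert (i + 1, l) := by
  intro h
  simp only [vert] at h
  rw [cyc_add_one_eq] at h
  have h1 := congrFun h i
  have h2 := congrFun h (i + 1)
  simp only [cyc_self, cyc_add_one] at h1 h2
  have hk := M.p_nonneg k
  have hl := M.p_nonneg l
  have hl' := M.p_le_one l
  have ha := M.a_pos
  have hk0 : M.p k = 0 := by nlinarith [M.bulge_nonneg l, mul_nonneg ha.le hk]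
  have hl0 : M.p l = 0 := by
    rw [hk0] at h1
    have := M.hb
    have := mul_nonneg (mul_nonneg M.hβ.le hl) (sub_nonneg.2 hl')
    nlinarith
  rw [hk0, hl0] at h2
  simp at h2

theorem vert_injective : Function.Injective M.vert := by
  rintro ⟨i, k⟩ ⟨j, l⟩ h
  rcases fin3_cases i j with rfl | rfl | rfl
  · have := congrFun h (j + 1)
    simp only [vert, cyc_add_one] at this
    rw [M.p_anti.injective (show M.p k = M.p l by linarith)]
  · exact absurd h (M.vert_ne_of_add_one i k l)
  · refine absurd h.symm ?_
    have := M.vert_ne_of_add_one (i + 2) l k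
    rwa [(CupolaFacet.fin3_add i).2.2.1] at this

theorem pt_injective : Function.Injective (M.pt r bs) :=
  (framePt_injective r bs).comp M.vert_injective

/-- A valid inequality that is tight on an edge is tight only on vertices of an adjacent facet. -/
theorem tight_subset_of_edge {f : E3 →L[ℝ] ℝ} {c : ℝ} (hle : ∀ x, f (M.pt r bs x) ≤ c)
    (hlt : ∃ x, f (M.pt r bs x) < c) {v w : Fin 3 × Fin (m + 2)} (hvw : v ≠ w)
    (hE : CupolaFacet.Edge v w) (hv : f (M.pt r bs v) = c) (hw : f (M.pt r bs w) = c) :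
    ∃ t : CupolaFacet m, ∀ x, f (M.pt r bs x) = c → x ∈ t.verts := by
  obtain ⟨t₁, t₂, u₁, u₂, h1v, h1w, h2v, h2w, h1u, h2u, h2u', h1u'⟩ := hE
  have e := M.fn_pt_eq_iff r bs
  obtain ⟨x, y, hx, hy, h⟩ := eq_combination_of_edge ((M.pt_injective r bs).ne hvw) hv hw
    ((e t₁ v).2 h1v) ((e t₁ w).2 h1w) ((e t₂ v).2 h2v) ((e t₂ w).2 h2w) ((e t₁ u₁).2 h1u)
    (M.fn_pt_lt r bs t₂ h2u) ((e t₂ u₂).2 h2u') (M.fn_pt_lt r bs t₁ h1u') (hle u₁) (hle u₂)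
  -- A positive coefficient confines the tight vertices to the corresponding facet; both
  -- coefficients cannot vanish, since some vertex has positive slack.
  rcases hx.eq_or_lt with rfl | hx
  · rcases hy.eq_or_lt with rfl | hy
    · obtain ⟨z, hz⟩ := hlt
      have := h (M.pt r bs z)
      linarith
    · refine ⟨t₂, fun z hz => (e t₂ z).1 ?_⟩
      have := h (M.pt r bs z)
      have h' := M.fn_pt_le r bs t₂ z
      nlinarith
  · refine ⟨t₁, fun z hz => (e t₁ z).1 ?_⟩
    have := h (M.pt r bs z)
    have h' := M.fn_pt_le r bs t₁ z
    have h'' := mul_nonneg hy (sub_nonneg.2 (M.fn_pt_le r bs t₂ z))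
    nlinarith

/-- Along a chain, a linear inequality is a quadratic polynomial in the position. -/
theorem slack_eq (f : E3 →L[ℝ] ℝ) (c : ℝ) (i : Fin 3) (l : Fin (m + 2)) :
    c - f (M.pt r bs (i, l)) = c - f r - (f (bs i) * (M.a * M.p l) + f (bs (i + 1)) * (1 - M.p l) -
      f (bs (i + 2)) * (M.b * M.p l + M.β * M.p l * (1 - M.p l))) := by
  conv_lhs => rw [eq_frameLin bs f]
  rw [pt, frameLin_framePt, ← eq_frameLin bs f, vert,
    eq_cyc i (fun k => f (bs k)), cyc_dotProduct]
  ring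

/-- Three values of the slack along a chain. -/
theorem slack_three (f : E3 →L[ℝ] ℝ) (c : ℝ) (i : Fin 3) (k l j : Fin (m + 2)) :
    (M.p k - M.p l) * (c - f (M.pt r bs (i, j))) =
      (M.p j - M.p l) * (c - f (M.pt r bs (i, k))) + (M.p k - M.p j) * (c - f (M.pt r bs (i, l)))
      - f (bs (i + 2)) * M.β * (M.p k - M.p l) * (M.p k - M.p j) * (M.p l - M.p j) := by
  simp only [slack_eq]; ring

/-- Here `hpair` says that there are at least three tight vertices. The slack along the chain is a
quadratic with zeros at k and l, and in each case of its curvature some edge turns out to be tight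
or the inequality fails. -/
theorem tight_subset_of_chain {f : E3 →L[ℝ] ℝ} {c : ℝ} (hle : ∀ x, f (M.pt r bs x) ≤ c)
    (hlt : ∃ x, f (M.pt r bs x) < c)
    (hpair : ∀ v w, ∃ x, f (M.pt r bs x) = c ∧ x ≠ v ∧ x ≠ w) {i : Fin 3} {k l : Fin (m + 2)}
    (hkl : k < l) (hk : f (M.pt r bs (i, k)) = c) (hl : f (M.pt r bs (i, l)) = c) :
    ∃ t : CupolaFacet m, ∀ x, f (M.pt r bs x) = c → x ∈ t.verts := by
  have edge := fun {v w} => M.tight_subset_of_edge r bs hle hlt (v := v) (w := w)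
  have hp : 0 < M.p k - M.p l := sub_pos.2 (M.p_anti hkl)
  have hβ := M.hβ
  have key := M.slack_three r bs f c i k l
  rw [hk, hl, sub_self] at key
  simp only [mul_zero, zero_add, zero_sub] at key
  obtain ⟨k', rfl⟩ := Fin.exists_castSucc_eq.2 (hkl.trans_le (Fin.le_last l)).ne
  have hkl' := Fin.castSucc_lt_iff_succ_le.1 hkl
  rcases hkl'.eq_or_lt with h | hkl'
  · subst h
    exact edge (by simp [Fin.ext_iff]) (CupolaFacet.edge_chain i k') hk hl
  have h1 : 0 < M.p k'.castSucc - M.p k'.succ := sub_pos.2 (M.p_anti Fin.castSucc_lt_succ)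
  have h2 : 0 < M.p k'.succ - M.p l := sub_pos.2 (M.p_anti hkl')
  -- The leading coefficient of the slack is -β f(bs (i + 2)). A convex quadratic would be negative
  -- between its zeros; an affine one vanishes on the whole chain; a concave one is negative outside
  -- its zeros, so these are the two chain ends.
  rcases lt_trichotomy (f (bs (i + 2))) 0 with hz | hz | hz
  · have key2 := key k'.succ
    have := hle (i, k'.succ)
    have h3 : 0 < -f (bs (i + 2)) * M.β * (M.p k'.castSucc - M.p l) *
        (M.p k'.castSucc - M.p k'.succ) * (M.p k'.succ - M.p l) := by
      have : 0 < -f (bs (i + 2)) := by linarith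
      positivity
    nlinarith
  · have key2 := key k'.succ
    rw [hz] at key2
    simp only [zero_mul, neg_zero] at key2
    have h4 := (mul_eq_zero.1 key2).resolve_left hp.ne'
    exact edge (by simp [Fin.ext_iff]) (CupolaFacet.edge_chain i k') hk (by linarith)
  · have outer : ∀ j, (j < k'.castSucc ∨ l < j) → False := by
      intro j hj
      have h5 : 0 < (M.p k'.castSucc - M.p j) * (M.p l - M.p j) := by
        rcases hj with hj | hj
        · have := M.p_anti hj
          exact mul_pos_of_neg_of_neg (by linarith) (by linarith)
        · have := M.p_anti hj
          exact mul_pos (by linarith) (by linarith)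
      have h6 : 0 < f (bs (i + 2)) * M.β * (M.p k'.castSucc - M.p l) *
        ((M.p k'.castSucc - M.p j) * (M.p l - M.p j)) := by positivity
      have := key j
      have := hle (i, j)
      nlinarith
    have hk0 : k'.castSucc = 0 := by
      by_contra h0
      exact outer 0 (Or.inl (Fin.pos_iff_ne_zero.2 h0))
    have hl0 : l = Fin.last (m + 1) := by
      by_contra h0
      exact outer (Fin.last _) (Or.inr (Fin.lt_last_iff_ne_last.2 h0))
    subst hl0
    rw [hk0] at hk
    -- Strict concavity excludes a third tight vertex on this chain; one on another chain is joined
    -- by an edge to B_{i+1} or to A_i.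
    obtain ⟨⟨j, x⟩, hx, hx1, hx2⟩ := hpair (i, 0) (i, Fin.last _)
    obtain ⟨a1, a2, a3, a4⟩ := CupolaFacet.fin3_add i
    obtain ⟨b1, b2, b3, b4, b5, b6⟩ := CupolaFacet.fin3_ne i
    rcases fin3_cases i j with rfl | rfl | rfl
    · have hx0 : x ≠ 0 := fun h => hx1 (by rw [h])
      have hxl : x ≠ Fin.last _ := fun h => hx2 (by rw [h])
      have h5 : 0 < M.p 0 - M.p x := sub_pos.2 (M.p_anti (Fin.pos_iff_ne_zero.2 hx0))
      have h7 : 0 < M.p x - M.p (Fin.last _) :=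
        sub_pos.2 (M.p_anti (Fin.lt_last_iff_ne_last.2 hxl))
      have h8 := key x
      rw [hk0, hx, sub_self, mul_zero] at h8
      rw [hk0] at hp
      have : 0 < f (bs (j + 2)) * M.β * (M.p 0 - M.p (Fin.last _)) * (M.p 0 - M.p x) *
        (M.p x - M.p (Fin.last _)) := by positivity
      nlinarith
    · have := CupolaFacet.edge_B (m := m) (i + 1) x
      rw [a2] at this
      exact edge (by simp [b4]) this hl hx
    · have := CupolaFacet.edge_A (m := m) (i + 2) x
      rw [a3] at this
      exact edge (by simp [b5]) this hk hx

/-- Without two tight vertices on one chain, three tight vertices occupy one position on each chain.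
A chain end among them yields a tight edge. Three inner positions are impossible by the cyclic sum
at the end. -/
theorem exists_tight_subset {f : E3 →L[ℝ] ℝ} {c : ℝ} (hle : ∀ x, f (M.pt r bs x) ≤ c)
    (hlt : ∃ x, f (M.pt r bs x) < c)
    (hpair : ∀ v w, ∃ x, f (M.pt r bs x) = c ∧ x ≠ v ∧ x ≠ w) :
    ∃ t : CupolaFacet m, ∀ x, f (M.pt r bs x) = c → x ∈ t.verts := by
  have edge := fun {v w} => M.tight_subset_of_edge r bs hle hlt (v := v) (w := w)
  by_cases hch : ∃ i k l, k < l ∧ f (M.pt r bs (i, k)) = c ∧ f (M.pt r bs (i, l)) = c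
  · obtain ⟨i, k, l, hkl, hk, hl⟩ := hch
    exact M.tight_subset_of_chain r bs hle hlt hpair hkl hk hl
  have huniq : ∀ x y, f (M.pt r bs x) = c → f (M.pt r bs y) = c → x ≠ y → x.1 ≠ y.1 := by
    rintro ⟨i, k⟩ ⟨j, l⟩ hx hy hxy hij
    simp only at hij
    subst hij
    rcases lt_trichotomy k l with h | h | h
    · exact hch ⟨i, k, l, h, hx, hy⟩
    · exact hxy (by rw [h])
    · exact hch ⟨i, l, k, h, hy, hx⟩
  have hall : ∀ i, ∃ l, f (M.pt r bs (i, l)) = c := by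
    obtain ⟨x, hx, -, -⟩ := hpair (0, 0) (0, 0)
    obtain ⟨y, hy, hyx, -⟩ := hpair x x
    obtain ⟨z, hz, hzx, hzy⟩ := hpair x y
    have h1 := huniq y x hy hx hyx
    have h2 := huniq z x hz hx hzx
    have h3 := huniq z y hz hy hzy
    intro i
    have : i = x.1 ∨ i = y.1 ∨ i = z.1 := by
      generalize x.1 = x at *; generalize y.1 = y at *; generalize z.1 = z at *
      revert i x y z; decide
    rcases this with rfl | rfl | rfl
    · exact ⟨_, hx⟩
    · exact ⟨_, hy⟩
    · exact ⟨_, hz⟩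
  choose l hl using hall
  by_cases h0 : ∃ i, l i = 0
  · obtain ⟨i, hi⟩ := h0
    have := CupolaFacet.edge_A (m := m) (i + 2) (l (i + 2))
    rw [(CupolaFacet.fin3_add i).2.2.1, ← hi] at this
    exact edge (by simp [(CupolaFacet.fin3_ne i).2.2.2.2.1]) this (hl i) (hl (i + 2))
  by_cases h1 : ∃ i, l i = Fin.last _
  · obtain ⟨i, hi⟩ := h1
    have := CupolaFacet.edge_B (m := m) (i + 1) (l (i + 1))
    rw [(CupolaFacet.fin3_add i).2.1, ← hi] at this
    exact edge (by simp [(CupolaFacet.fin3_ne i).2.2.2.1]) this (hl i) (hl (i + 1))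
  push Not at h0 h1
  exfalso
  have hβ := M.hβ
  have hpos : ∀ i, 0 < M.p (l i) ∧ M.p (l i) < 1 := fun i =>
    ⟨(M.p_nonneg _).lt_of_ne fun h => h1 i ((M.p_eq_zero_iff _).1 h.symm),
      (M.p_le_one _).lt_of_ne fun h => h0 i ((M.p_eq_one_iff _).1 h)⟩
  -- The slack is zero at an inner position, positive at A_i and nonnegative at B_{i+1}, so the
  -- quadratic is strictly convex.
  have hneg : ∀ i, f (bs (i + 2)) < 0 := by
    intro i
    obtain ⟨hp0, hp1⟩ := hpos i
    have h3 := M.slack_three r bs f c i 0 (Fin.last _) (l i)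
    rw [M.p_zero, M.p_last, hl i] at h3
    simp only [sub_zero, sub_self, mul_zero, mul_one, zero_sub] at h3
    have h4 : f (M.pt r bs (i, 0)) < c := (hle (i, 0)).lt_of_ne fun h =>
      hch ⟨i, 0, l i, Fin.pos_iff_ne_zero.2 (h0 i), h, hl i⟩
    have h5 := mul_pos hp0 (sub_pos.2 h4)
    have h6 := mul_nonneg (sub_nonneg.2 hp1.le) (sub_nonneg.2 (hle (i, Fin.last _)))
    by_contra! h7
    have : 0 ≤ f (bs (i + 2)) * M.β * (1 - M.p (l i)) * M.p (l i) :=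
      mul_nonneg (mul_nonneg (mul_nonneg h7 hβ.le) (by linarith)) hp0.le
    nlinarith
  -- This compares the zero slack at the inner position with the nonnegative slack at position 0 and
  -- divides by the position.
  have hineq : ∀ i, 0 ≤ M.a * f (bs i) - f (bs (i + 1)) - (M.b + M.β) * f (bs (i + 2)) := by
    intro i
    obtain ⟨hp0, hp1⟩ := hpos i
    have h3 := M.slack_eq r bs f c i (l i)
    have h4 := M.slack_eq r bs f c i (Fin.last _)
    rw [hl i] at h3
    rw [M.p_last] at h4
    have h5 := hle (i, Fin.last _)
    have h6 := hneg i
    have h7 : 0 ≤ M.p (l i) * (M.a * f (bs i) - f (bs (i + 1)) -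
        (M.b + M.β * (1 - M.p (l i))) * f (bs (i + 2))) := by nlinarith
    have h8 := nonneg_of_mul_nonneg_right h7 hp0
    have h9 : 0 ≤ -f (bs (i + 2)) * (M.β * M.p (l i)) := by
      have : 0 ≤ -f (bs (i + 2)) := by linarith
      positivity
    nlinarith
  have e0 := hineq 0
  have e1 := hineq 1
  have e2 := hineq 2
  have n0 := hneg 0
  have n1 := hneg 1
  have n2 := hneg 2
  rw [show (0 : Fin 3) + 1 = 1 from rfl, show (0 : Fin 3) + 2 = 2 from rfl] at e0
  rw [show (1 : Fin 3) + 1 = 2 from rfl, show (1 : Fin 3) + 2 = 0 from rfl] at e1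
  rw [show (2 : Fin 3) + 1 = 0 from rfl, show (2 : Fin 3) + 2 = 1 from rfl] at e2
  rw [show (0 : Fin 3) + 2 = 2 from rfl] at n0
  rw [show (1 : Fin 3) + 2 = 0 from rfl] at n1
  rw [show (2 : Fin 3) + 2 = 1 from rfl] at n2
  have := M.hab
  -- In the cyclic sum each value of f on the basis gets the coefficient a - 1 - b - β > 0, although
  -- all these values are negative.
  have h10 : 0 ≤ (M.a - 1 - M.b - M.β) * (f (bs 0) + f (bs 1) + f (bs 2)) := by linarith
  nlinarith

end CupolaModel

/-! ### Exposed vertices and separation of hulls -/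

theorem mem_extremePoints_of_exposing {S : Set E3} {v : E3} (hv : v ∈ S) {g : E3 →L[ℝ] ℝ}
    (hg : ∀ y ∈ S, y ≠ v → g y < g v) : v ∈ (convexHull ℝ S).extremePoints ℝ := by
  have hle : ∀ y ∈ S, g y ≤ g v := fun y hy => by
    by_cases h : y = v
    · rw [h]
    · exact (hg y hy h).le
  refine exposedPoints_subset_extremePoints ⟨subset_convexHull ℝ S hv, g, fun y hy =>
    ⟨le_of_mem_convexHull hle hy, fun h => ?_⟩⟩
  have := mem_convexHull_face hle hy (le_antisymm (le_of_mem_convexHull hle hy) h)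
  have h2 : S ∩ {y | g y = g v} ⊆ {v} := fun z hz => by
    by_contra hzv
    exact (hg z hz.1 hzv).ne hz.2
  simpa using convexHull_mono (𝕜 := ℝ) h2 this

/-- Two sets that are weakly separated by a hyperplane, which the first set meets only in points of
the second, have convex hulls that meet properly. -/
theorem convexHull_inter_subset_of_sep {T T' : Set E3} {g : E3 →L[ℝ] ℝ} {c : ℝ}
    (h : ∀ x ∈ T, c ≤ g x) (h' : ∀ x ∈ T', g x ≤ c) (he : ∀ x ∈ T, g x = c → x ∈ T') :
    convexHull ℝ T ∩ convexHull ℝ T' ⊆ convexHull ℝ (T ∩ T') := by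
  rintro x ⟨hx, hx'⟩
  have h1 := le_of_mem_convexHull h' hx'
  have hn : ∀ y ∈ T, (-g) y ≤ -c := fun y hy => by simpa using h y hy
  have h2 := le_of_mem_convexHull hn hx
  simp only [neg_apply] at h2
  have h3 := mem_convexHull_face hn hx (le_antisymm (by simpa using h2) (by simpa using h1))
  have hsub : T ∩ {y | (-g) y = -c} ⊆ T ∩ T' := fun y hy =>
    ⟨hy.1, he y hy.1 (by have := hy.2; simpa using this)⟩
  exact convexHull_mono hsub h3

/-! ### Orientations in a frame -/

section Orient

variable (r : E3) (bs : Module.Basis (Fin 3) ℝ E3)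

/-- The determinant of a basis. -/
noncomputable def basisDet : ℝ := Matrix.det (Matrix.of fun k j : Fin 3 => bs k j)

theorem basisDet_ne_zero : basisDet bs ≠ 0 := by
  have hli : LinearIndependent ℝ (fun k => WithLp.linearEquiv 2 ℝ (Fin 3 → ℝ) (bs k)) :=
    bs.linearIndependent.map' _ (LinearEquiv.ker _)
  have := (Matrix.linearIndependent_rows_iff_isUnit
    (A := Matrix.of fun k j : Fin 3 => bs k j)).1 hli
  exact ((Matrix.isUnit_iff_isUnit_det _).1 this).ne_zero

theorem orient_framePt (v₀ v₁ v₂ v₃ : Fin 3 → ℝ) :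
    orient (framePt r bs v₀) (framePt r bs v₁) (framePt r bs v₂) (framePt r bs v₃) =
      Matrix.det (Matrix.of ![v₁ - v₀, v₂ - v₀, v₃ - v₀]) * basisDet bs := by
  rw [basisDet, ← Matrix.det_mul, orient]
  congr 1
  ext a b
  have key : ∀ v : Fin 3 → ℝ, (framePt r bs v - framePt r bs v₀) b =
      ∑ k, (v - v₀) k * bs k b := by
    intro v
    simp only [framePt, Fin.sum_univ_three, PiLp.sub_apply, PiLp.add_apply, PiLp.smul_apply,
      smul_eq_mul, Pi.sub_apply]
    ring
  fin_cases a
  · simpa [Matrix.mul_apply] using key v₁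
  · simpa [Matrix.mul_apply] using key v₂
  · simpa [Matrix.mul_apply] using key v₃

theorem cyc_sub (i : Fin 3) (x y z x' y' z' : ℝ) :
    cyc i x y z - cyc i x' y' z' = cyc i (x - x') (y - y') (z - z') := by
  funext k
  fin_cases i <;> fin_cases k <;> simp [cyc]

theorem det_cyc (i : Fin 3) (x y z x' y' z' x'' y'' z'' : ℝ) :
    Matrix.det (Matrix.of ![cyc i x y z, cyc i x' y' z', cyc i x'' y'' z'']) =
      x * (y' * z'' - z' * y'') - y * (x' * z'' - z' * x'') + z * (x' * y'' - y' * x'') := by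
  fin_cases i <;> simp [Matrix.det_fin_three, cyc] <;> ring

theorem orient_framePt_cyc (i : Fin 3) (x₀ y₀ z₀ x y z x' y' z' x'' y'' z'' : ℝ) :
    orient (framePt r bs (cyc i x₀ y₀ z₀)) (framePt r bs (cyc i x y z))
      (framePt r bs (cyc i x' y' z')) (framePt r bs (cyc i x'' y'' z'')) =
      ((x - x₀) * ((y' - y₀) * (z'' - z₀) - (z' - z₀) * (y'' - y₀))
        - (y - y₀) * ((x' - x₀) * (z'' - z₀) - (z' - z₀) * (x'' - x₀))
        + (z - z₀) * ((x' - x₀) * (y'' - y₀) - (y' - y₀) * (x'' - x₀))) * basisDet bs := by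
  rw [orient_framePt, cyc_sub, cyc_sub, cyc_sub, det_cyc]

end Orient

/-! ### The Schönhardt polytope in a frame -/

section Schonhardt

variable (r : E3) (bs : Module.Basis (Fin 3) ℝ E3) (a b : ℝ)

/-- Vertices of the bottom. -/
noncomputable def frameA (i : Fin 3) : E3 := framePt r bs (cyc i a 0 (-b))

/-- Vertices of the skylight. -/
noncomputable def frameB (i : Fin 3) : E3 := framePt r bs (cyc i 1 0 0)

theorem frameA_add_one (i : Fin 3) : frameA r bs a b (i + 1) = framePt r bs (cyc i (-b) a 0) := by
  rw [frameA, cyc_add_one_eq]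

theorem frameA_add_two (i : Fin 3) : frameA r bs a b (i + 2) = framePt r bs (cyc i 0 (-b) a) := by
  rw [frameA, cyc_add_two_eq]

theorem frameB_add_one (i : Fin 3) : frameB r bs (i + 1) = framePt r bs (cyc i 0 1 0) := by
  rw [frameB, cyc_add_one_eq]

theorem frameB_add_two (i : Fin 3) : frameB r bs (i + 2) = framePt r bs (cyc i 0 0 1) := by
  rw [frameB, cyc_add_two_eq]

variable {a b}

theorem frame_injective (hb : 0 < b) (hab : 1 + b < a) :
    Function.Injective (Sum.elim (frameA r bs a b) (frameB r bs)) := by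
  have hinj := framePt_injective r bs
  rintro (i | i) (j | j) h
  · congr 1
    have h := hinj h
    rcases fin3_cases i j with rfl | rfl | rfl
    · rfl
    · rw [cyc_add_one_eq] at h
      have := congrFun h i
      simp only [cyc_self] at this
      linarith
    · rw [cyc_add_two_eq] at h
      have := congrFun h i
      simp only [cyc_self] at this
      linarith
  · exfalso
    have h := hinj h
    have := congrFun h i
    have h2 := congrFun h (i + 1)
    have h3 := congrFun h (i + 2)
    rcases fin3_cases i j with rfl | rfl | rfl
    · simp only [cyc_self] at this; linarith
    · rw [cyc_add_one_eq] at this; simp only [cyc_self] at this; linarith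
    · rw [cyc_add_two_eq] at this; simp only [cyc_self] at this; linarith
  · exfalso
    have h := hinj h
    have := congrFun h j
    rcases fin3_cases j i with rfl | rfl | rfl
    · simp only [cyc_self] at this; linarith
    · rw [cyc_add_one_eq] at this; simp only [cyc_self] at this; linarith
    · rw [cyc_add_two_eq] at this; simp only [cyc_self] at this; linarith
  · congr 1
    have h := hinj h
    have := congrFun h i
    rcases fin3_cases i j with rfl | rfl | rfl
    · rfl
    · rw [cyc_add_one_eq] at this; simp only [cyc_self] at this; linarith
    · rw [cyc_add_two_eq] at this; simp only [cyc_self] at this; linarith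

/-- Separation by one plane, in coordinates: points of the first triangle on the plane must be
vertices of the second. -/
theorem sep_triple (n : Fin 3 → ℝ) (c : ℝ) {u v w u' v' w' : Fin 3 → ℝ}
    (h1 : c < n ⬝ᵥ u ∨ (c = n ⬝ᵥ u ∧ (u = u' ∨ u = v' ∨ u = w')))
    (h2 : c < n ⬝ᵥ v ∨ (c = n ⬝ᵥ v ∧ (v = u' ∨ v = v' ∨ v = w')))
    (h3 : c < n ⬝ᵥ w ∨ (c = n ⬝ᵥ w ∧ (w = u' ∨ w = v' ∨ w = w')))
    (h1' : n ⬝ᵥ u' ≤ c) (h2' : n ⬝ᵥ v' ≤ c) (h3' : n ⬝ᵥ w' ≤ c) :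
    convexHull ℝ {framePt r bs u, framePt r bs v, framePt r bs w} ∩
      convexHull ℝ {framePt r bs u', framePt r bs v', framePt r bs w'} ⊆
    convexHull ℝ ({framePt r bs u, framePt r bs v, framePt r bs w} ∩
      {framePt r bs u', framePt r bs v', framePt r bs w'}) := by
  have key : ∀ y, (c < n ⬝ᵥ y ∨ (c = n ⬝ᵥ y ∧ (y = u' ∨ y = v' ∨ y = w'))) →
      frameLin bs n r + c ≤ frameLin bs n (framePt r bs y) ∧
      (frameLin bs n (framePt r bs y) = frameLin bs n r + c →
        framePt r bs y ∈ ({framePt r bs u', framePt r bs v', framePt r bs w'} : Set E3)) := by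
    intro y hy
    rw [frameLin_framePt]
    rcases hy with hy | ⟨hy, hy'⟩
    · exact ⟨by linarith, fun h => by linarith⟩
    · refine ⟨by linarith, fun _ => ?_⟩
      rcases hy' with rfl | rfl | rfl <;> simp
  refine convexHull_inter_subset_of_sep (g := frameLin bs n) (c := frameLin bs n r + c) ?_ ?_ ?_
  · rintro x (rfl | rfl | rfl)
    exacts [(key _ h1).1, (key _ h2).1, (key _ h3).1]
  · rintro x (rfl | rfl | rfl) <;> rw [frameLin_framePt] <;> linarith
  · rintro x (rfl | rfl | rfl)
    exacts [(key _ h1).2, (key _ h2).2, (key _ h3).2]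

/-- The relation of meeting properly. -/
def MeetProperly (T T' : Set E3) : Prop :=
  convexHull ℝ T ∩ convexHull ℝ T' ⊆ convexHull ℝ (T ∩ T')

theorem MeetProperly.symm {T T' : Set E3} (h : MeetProperly T T') : MeetProperly T' T := by
  unfold MeetProperly at *
  rwa [Set.inter_comm, Set.inter_comm T']

theorem MeetProperly.refl (T : Set E3) : MeetProperly T T := by
  unfold MeetProperly; simp

theorem range_eq_triple {α : Type*} (f : Fin 3 → α) (i : Fin 3) :
    Set.range f = {f i, f (i + 1), f (i + 2)} := by
  ext x
  constructor
  · rintro ⟨j, rfl⟩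
    rcases fin3_cases i j with rfl | rfl | rfl <;> simp
  · rintro (rfl | rfl | rfl) <;> simp

/-- Each pair of triangles is weakly separated by an explicit plane; cyclic symmetry leaves one pair
of every type. -/
theorem frame_meetProperly (hb : 0 < b) (hab : 1 + b < a) (T T' : Set E3)
    (hT : T ∈ schonhardtTriangles (frameA r bs a b) (frameB r bs))
    (hT' : T' ∈ schonhardtTriangles (frameA r bs a b) (frameB r bs)) : MeetProperly T T' := by
  have hbot : ∀ i, Set.range (frameA r bs a b) = {framePt r bs (cyc i a 0 (-b)),
      framePt r bs (cyc i (-b) a 0), framePt r bs (cyc i 0 (-b) a)} := fun i => by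
    rw [range_eq_triple _ i, frameA_add_one, frameA_add_two, frameA]
  have htop : ∀ i, Set.range (frameB r bs) = {framePt r bs (cyc i 1 0 0),
      framePt r bs (cyc i 0 1 0), framePt r bs (cyc i 0 0 1)} := fun i => by
    rw [range_eq_triple _ i, frameB_add_one, frameB_add_two, frameB]
  let X : Fin 3 → Set E3 := fun i => {frameA r bs a b i, frameA r bs a b (i + 1), frameB r bs i}
  let Y : Fin 3 → Set E3 := fun i =>
    {frameB r bs i, frameA r bs a b (i + 1), frameB r bs (i + 1)}
  have hX : ∀ i, X i = {framePt r bs (cyc i a 0 (-b)), framePt r bs (cyc i (-b) a 0),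
      framePt r bs (cyc i 1 0 0)} := fun i => by
    simp only [X, frameA_add_one]; rfl
  have hX1 : ∀ i, X (i + 1) = {framePt r bs (cyc i (-b) a 0), framePt r bs (cyc i 0 (-b) a),
      framePt r bs (cyc i 0 1 0)} := fun i => by
    simp only [hX, cyc_add_one_eq]
  have hY : ∀ i, Y i = {framePt r bs (cyc i 1 0 0), framePt r bs (cyc i (-b) a 0),
      framePt r bs (cyc i 0 1 0)} := fun i => by
    simp only [Y, frameA_add_one, frameB, cyc_add_one_eq]
  have hY1 : ∀ i, Y (i + 1) = {framePt r bs (cyc i 0 1 0), framePt r bs (cyc i 0 (-b) a),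
      framePt r bs (cyc i 0 0 1)} := fun i => by
    simp only [hY, cyc_add_one_eq]
  have hY2 : ∀ i, Y (i + 2) = {framePt r bs (cyc i 0 0 1), framePt r bs (cyc i a 0 (-b)),
      framePt r bs (cyc i 1 0 0)} := fun i => by
    simp only [hY, cyc_add_two_eq]
  have ha1 : 0 < a - 1 - b := by linarith
  have bt : MeetProperly (Set.range (frameA r bs a b)) (Set.range (frameB r bs)) := by
    rw [hbot 0, htop 0]
    refine sep_triple r bs (cyc 0 1 1 1) 1 ?_ ?_ ?_ ?_ ?_ ?_ <;> simp only [cyc_dotProduct]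
    · left; linarith
    · left; linarith
    · left; linarith
    all_goals linarith
  have Xb : ∀ i, MeetProperly (X i) (Set.range (frameA r bs a b)) := by
    intro i
    rw [hX, hbot i]
    refine sep_triple r bs (cyc i (-1) (-1) (-1)) (-(a - b)) ?_ ?_ ?_ ?_ ?_ ?_ <;>
      simp only [cyc_dotProduct]
    · right; exact ⟨by ring, by simp⟩
    · right; exact ⟨by ring, by simp⟩
    · left; linarith
    all_goals linarith
  have Yb : ∀ i, MeetProperly (Y i) (Set.range (frameA r bs a b)) := by
    intro i
    rw [hY, hbot i]
    refine sep_triple r bs (cyc i (-1) (-1) (-1)) (-(a - b)) ?_ ?_ ?_ ?_ ?_ ?_ <;>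
      simp only [cyc_dotProduct]
    · left; linarith
    · right; exact ⟨by ring, by simp⟩
    · left; linarith
    all_goals linarith
  have Xt : ∀ i, MeetProperly (X i) (Set.range (frameB r bs)) := by
    intro i
    rw [hX, htop i]
    refine sep_triple r bs (cyc i 1 1 1) 1 ?_ ?_ ?_ ?_ ?_ ?_ <;>
      simp only [cyc_dotProduct]
    · left; linarith
    · left; linarith
    · right; exact ⟨by ring, by simp⟩
    all_goals linarith
  have Yt : ∀ i, MeetProperly (Y i) (Set.range (frameB r bs)) := by
    intro i
    rw [hY, htop i]
    refine sep_triple r bs (cyc i 1 1 1) 1 ?_ ?_ ?_ ?_ ?_ ?_ <;>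
      simp only [cyc_dotProduct]
    · right; exact ⟨by ring, by simp⟩
    · left; linarith
    · right; exact ⟨by ring, by simp⟩
    all_goals linarith
  have XX : ∀ i, MeetProperly (X i) (X (i + 1)) := by
    intro i
    rw [hX1, hX]
    refine sep_triple r bs (cyc i (a - 1) b 0) b ?_ ?_ ?_ ?_ ?_ ?_ <;>
      simp only [cyc_dotProduct]
    · left; nlinarith
    · right; exact ⟨by ring, by simp⟩
    · left; linarith
    all_goals nlinarith
  have YY : ∀ i, MeetProperly (Y i) (Y (i + 1)) := by
    intro i
    rw [hY1, hY]
    -- The middle entry may be any number strictly between b and a - 1; the midpoint is taken.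
    refine sep_triple r bs (cyc i (a - 1) ((b + a - 1) / 2) 0) ((b + a - 1) / 2)
      ?_ ?_ ?_ ?_ ?_ ?_ <;> simp only [cyc_dotProduct]
    · left; linarith
    · left; nlinarith
    · right; exact ⟨by ring, by simp⟩
    all_goals nlinarith
  have XY : ∀ i, MeetProperly (X i) (Y i) := by
    intro i
    rw [hX, hY]
    refine sep_triple r bs (cyc i a (1 + b) a) a ?_ ?_ ?_ ?_ ?_ ?_ <;>
      simp only [cyc_dotProduct]
    · left; nlinarith
    · right; exact ⟨by ring, by simp⟩
    · right; exact ⟨by ring, by simp⟩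
    all_goals nlinarith
  have XY1 : ∀ i, MeetProperly (X i) (Y (i + 1)) := by
    intro i
    rw [hX, hY1]
    refine sep_triple r bs (cyc i (a - 1) ((b + a - 1) / 2) 0) ((b + a - 1) / 2)
      ?_ ?_ ?_ ?_ ?_ ?_ <;> simp only [cyc_dotProduct]
    · left; nlinarith
    · left; nlinarith
    · left; linarith
    all_goals nlinarith
  have XY2 : ∀ i, MeetProperly (X i) (Y (i + 2)) := by
    intro i
    rw [hX, hY2]
    refine sep_triple r bs (cyc i 0 1 0) 0 ?_ ?_ ?_ ?_ ?_ ?_ <;>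
      simp only [cyc_dotProduct]
    · right; exact ⟨by ring, by simp⟩
    · left; linarith
    · right; exact ⟨by ring, by simp⟩
    all_goals linarith
  have XX' : ∀ i j, MeetProperly (X i) (X j) := by
    intro i j
    rcases fin3_cases i j with rfl | rfl | rfl
    · exact .refl _
    · exact XX i
    · have := XX (i + 2)
      rw [(CupolaFacet.fin3_add i).2.2.1] at this
      exact this.symm
  have YY' : ∀ i j, MeetProperly (Y i) (Y j) := by
    intro i j
    rcases fin3_cases i j with rfl | rfl | rfl
    · exact .refl _
    · exact YY i
    · have := YY (i + 2)
      rw [(CupolaFacet.fin3_add i).2.2.1] at this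
      exact this.symm
  have XY' : ∀ i j, MeetProperly (X i) (Y j) := by
    intro i j
    rcases fin3_cases i j with rfl | rfl | rfl
    exacts [XY _, XY1 _, XY2 _]
  rcases hT with ((rfl | rfl) | ⟨i, rfl⟩) | ⟨i, rfl⟩ <;>
    rcases hT' with ((rfl | rfl) | ⟨j, rfl⟩) | ⟨j, rfl⟩
  exacts [.refl _, bt, (Xb _).symm, (Yb _).symm, bt.symm, .refl _, (Xt _).symm, (Yt _).symm,
    Xb _, Xt _, XX' _ _, XY' _ _, Yb _, Yt _, (XY' _ _).symm, YY' _ _]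

theorem frame_schonhardtPosition (hb : 0 < b) (hab : 1 + b < a) :
    SchonhardtPosition (frameA r bs a b) (frameB r bs) := by
  refine ⟨frame_injective r bs hb hab,
    fun T hT T' hT' => frame_meetProperly r bs hb hab T T' hT hT', ?_⟩
  -- The orientation sign σ is opposite to the sign of the determinant of the frame.
  have key : ∀ s : ℝ, s * basisDet bs < 0 → ∀ i : Fin 3,
      s * orient (frameA r bs a b i) (frameA r bs a b (i + 1)) (frameB r bs i)
        (frameA r bs a b (i + 2)) < 0 ∧
      s * orient (frameB r bs i) (frameB r bs (i + 1)) (frameB r bs (i + 2))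
        (frameA r bs a b (i + 1)) < 0 ∧
      s * orient (frameA r bs a b i) (frameA r bs a b (i + 1)) (frameB r bs i)
        (frameB r bs (i + 2)) < 0 ∧
      0 < s * orient (frameA r bs a b i) (frameA r bs a b (i + 1)) (frameB r bs i)
        (frameB r bs (i + 1)) := by
    intro s hs i
    have h1 : ∀ x : ℝ, 0 < x → s * (x * basisDet bs) < 0 := fun x hx => by
      rw [mul_left_comm]; exact mul_neg_of_pos_of_neg hx hs
    have h2 : ∀ x : ℝ, x < 0 → 0 < s * (x * basisDet bs) := fun x hx => by
      rw [mul_left_comm]; exact mul_pos_of_neg_of_neg hx hs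
    -- In terms of b and d = a - 1 - b the four determinants become, up to sign, polynomials with
    -- positive coefficients.
    obtain ⟨d, hd, rfl⟩ : ∃ d : ℝ, 0 < d ∧ a = 1 + b + d := ⟨a - 1 - b, by linarith, by ring⟩
    rw [frameA_add_one, frameA_add_two, frameB_add_one, frameB_add_two, frameA, frameB]
    simp only [orient_framePt_cyc]
    refine ⟨h1 _ ?_, h1 _ ?_, h1 _ ?_, h2 _ ?_⟩
    · ring_nf; positivity
    · ring_nf; positivity
    · ring_nf; positivity
    · rw [← neg_pos]; ring_nf; positivity
  rcases (basisDet_ne_zero bs).lt_or_gt with h | h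
  · exact ⟨1, Or.inl rfl, key 1 (by linarith)⟩
  · exact ⟨-1, Or.inr rfl, key (-1) (by linarith)⟩

/-- The plane B_i B_{i+1} A_{i+1} is the coordinate plane on which entry i + 2 vanishes, so the
product of orientations is that entry times a positive square. -/
theorem frame_visibilityCone (hab : 1 + b < a) :
    visibilityCone (frameA r bs a b) (frameB r bs) = {x | ∀ k, 0 ≤ bs.repr (x - r) k} := by
  ext x
  obtain ⟨v, rfl⟩ : ∃ v, x = framePt r bs v := ⟨_, (framePt_repr r bs x).symm⟩
  simp only [visibilityCone, Set.mem_ofPred_eq]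
  have key : ∀ i : Fin 3, 0 ≤ orient (frameB r bs i) (frameB r bs (i + 1)) (frameA r bs a b (i + 1))
      (framePt r bs v) * orient (frameB r bs i) (frameB r bs (i + 1)) (frameA r bs a b (i + 1))
      (frameB r bs (i + 2)) ↔ 0 ≤ v (i + 2) := by
    intro i
    rw [frameA_add_one, frameB_add_one, frameB_add_two, frameB, eq_cyc i v]
    simp only [orient_framePt_cyc, cyc_add_two]
    have h : 0 < ((1 + b - a) * basisDet bs) ^ 2 := by
      have : (1 + b - a) * basisDet bs ≠ 0 :=
        mul_ne_zero (by linarith) (basisDet_ne_zero bs)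
      positivity
    conv_rhs => rw [← mul_nonneg_iff_of_pos_left h]
    ring_nf
  have hk : ∀ k, bs.repr (framePt r bs v - r) k = v k := fun k =>
    congrFun (repr_framePt_sub r bs v) k
  simp only [key, hk]
  constructor
  · intro h k
    have := h (k + 1)
    rwa [(CupolaFacet.fin3_add k).2.1] at this
  · exact fun h i => h _

theorem isTriangularCone_frame :
    IsTriangularCone {x : E3 | ∀ k, 0 ≤ bs.repr (x - r) k} := by
  refine ⟨r, bs, bs.linearIndependent, ?_⟩
  ext x
  constructor
  · exact fun h => ⟨bs.repr (x - r), h, (framePt_repr r bs x).symm⟩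
  · rintro ⟨t, ht, rfl⟩ k
    have := congrFun (repr_framePt_sub r bs t) k
    rw [framePt] at this
    rw [this]
    exact ht k

theorem subset_interior_frame :
    {x : E3 | ∀ k, 0 < bs.repr (x - r) k} ⊆ interior {x : E3 | ∀ k, 0 ≤ bs.repr (x - r) k} := by
  refine interior_maximal (fun x hx k => (hx k).le) ?_
  have : {x : E3 | ∀ k, 0 < bs.repr (x - r) k} = ⋂ k, {x : E3 | 0 < bs.repr (x - r) k} := by
    ext x; simp
  rw [this]
  refine isOpen_iInter_of_finite fun k => isOpen_lt continuous_const ?_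
  have := (LinearMap.toContinuousLinearMap (bs.coord k)).continuous.comp (continuous_sub_right r)
  exact this

end Schonhardt

theorem IsFacetIneq.vectorSpan_eq_top {P G : Set E3} {f : E3 →L[ℝ] ℝ} {c : ℝ}
    (h : IsFacetIneq P G f c) (hlt : ∃ p ∈ P, f p < c) : vectorSpan ℝ P = ⊤ := by
  obtain ⟨p, hp, hlt⟩ := hlt
  obtain ⟨q, hq⟩ := h.nonempty
  have hGP : G ⊆ P := fun x hx => by rw [h.2.1] at hx; exact hx.1
  have hGf : ∀ x ∈ G, f x = c := fun x hx => by rw [h.2.1] at hx; exact hx.2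
  have hpos : 0 < f (q - p) := by rw [map_sub, hGf q hq]; linarith
  have hf : f ≠ 0 := by rintro rfl; simp at hpos
  have hker := vectorSpan_eq_ker hf hGf h.2.2
  rw [Submodule.eq_top_iff']
  intro x
  have h1 : x - (f x / f (q - p)) • (q - p) ∈ vectorSpan ℝ P := by
    refine vectorSpan_mono ℝ hGP ?_
    rw [hker, LinearMap.mem_ker, ContinuousLinearMap.coe_coe, map_sub, map_smul, smul_eq_mul,
      div_mul_cancel₀ _ hpos.ne', sub_self]
  have h2 := Submodule.smul_mem _ (f x / f (q - p)) (vsub_mem_vectorSpan ℝ (hGP hq) hp)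
  have h3 := Submodule.add_mem _ h1 h2
  rwa [vsub_eq_sub, sub_add_cancel] at h3

/-! ### The model yields a cupola -/

namespace CupolaModel

variable {m : ℕ} (M : CupolaModel m) (r : E3) (bs : Module.Basis (Fin 3) ℝ E3)

theorem pt_zero (i : Fin 3) : M.pt r bs (i, 0) = frameA r bs M.a M.b i := by
  simp [pt, vert, frameA, M.p_zero]

theorem pt_last (i : Fin 3) : M.pt r bs (i, Fin.last (m + 1)) = frameB r bs (i + 1) := by
  simp [pt, vert, frameB_add_one, M.p_last]

theorem pt_last' (i : Fin 3) : M.pt r bs (i + 2, Fin.last (m + 1)) = frameB r bs i := by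
  rw [pt_last, (CupolaFacet.fin3_add i).2.2.1]

theorem range_frameA : Set.range (frameA r bs M.a M.b) =
    M.pt r bs '' (CupolaFacet.bot : CupolaFacet m).verts := by
  ext x
  constructor
  · rintro ⟨i, rfl⟩
    exact ⟨(i, 0), rfl, M.pt_zero r bs i⟩
  · rintro ⟨⟨i, k⟩, hk, rfl⟩
    obtain rfl : k = 0 := hk
    exact ⟨i, (M.pt_zero r bs i).symm⟩

theorem range_frameB : Set.range (frameB r bs) =
    M.pt r bs '' (CupolaFacet.top : CupolaFacet m).verts := by
  ext x
  constructor
  · rintro ⟨i, rfl⟩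
    exact ⟨(i + 2, Fin.last _), rfl, M.pt_last' r bs i⟩
  · rintro ⟨⟨i, k⟩, hk, rfl⟩
    obtain rfl : k = Fin.last _ := hk
    exact ⟨i + 1, (M.pt_last r bs i).symm⟩

theorem triple_sideB (i : Fin 3) (k : Fin (m + 1)) :
    {frameB r bs i, M.pt r bs (i, k.castSucc), M.pt r bs (i, k.succ)} =
      M.pt r bs '' (CupolaFacet.sideB i k).verts := by
  rw [CupolaFacet.verts, Set.image_insert_eq, Set.image_pair, pt_last']
  ext x; simp only [Set.mem_insert_iff, Set.mem_singleton_iff]; tauto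

theorem triple_sideA (i : Fin 3) (k : Fin (m + 1)) :
    {frameA r bs M.a M.b (i + 1), M.pt r bs (i, k.castSucc), M.pt r bs (i, k.succ)} =
      M.pt r bs '' (CupolaFacet.sideA i k).verts := by
  rw [CupolaFacet.verts, Set.image_insert_eq, Set.image_pair, pt_zero]
  ext x; simp only [Set.mem_insert_iff, Set.mem_singleton_iff]; tauto

theorem range_le (t : CupolaFacet m) : ∀ y ∈ Set.range (M.pt r bs), M.fn bs t y ≤ M.cst r bs t := by
  rintro _ ⟨x, rfl⟩
  exact M.fn_pt_le r bs t x

theorem range_inter (t : CupolaFacet m) :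
    Set.range (M.pt r bs) ∩ {y | M.fn bs t y = M.cst r bs t} = M.pt r bs '' t.verts := by
  ext y
  constructor
  · rintro ⟨⟨x, rfl⟩, hx⟩
    exact ⟨x, (M.fn_pt_eq_iff r bs t x).1 hx, rfl⟩
  · rintro ⟨x, hx, rfl⟩
    exact ⟨⟨x, rfl⟩, (M.fn_pt_eq_iff r bs t x).2 hx⟩

theorem finrank_of_triple {t t' : CupolaFacet m} {v w u : Fin 3 × Fin (m + 2)}
    (ht : t.verts = {v, w, u}) (hvw : v ≠ w) (hv : v ∈ t'.verts) (hw : w ∈ t'.verts)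
    (hu : u ∉ t'.verts) :
    Module.finrank ℝ (vectorSpan ℝ (convexHull ℝ (M.pt r bs '' t.verts))) = 2 := by
  rw [← direction_affineSpan, affineSpan_convexHull, direction_affineSpan, ht,
    Set.image_insert_eq, Set.image_pair]
  have e := M.fn_pt_eq_iff r bs t'
  refine finrank_vectorSpan_triangle (g := M.fn bs t') ((M.pt_injective r bs).ne hvw) ?_ ?_
  · rw [(e v).2 hv, (e w).2 hw]
  · rw [(e v).2 hv]
    exact fun h => hu ((e u).1 h)

theorem finrank_facet (t : CupolaFacet m) :
    Module.finrank ℝ (vectorSpan ℝ (convexHull ℝ (M.pt r bs '' t.verts))) = 2 := by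
  cases t with
  | bot =>
    refine M.finrank_of_triple r bs (t' := .sideA 0 0) (v := (0, 0)) (w := (1, 0)) (u := (2, 0))
      ?_ (by simp) (by simp [CupolaFacet.verts]) (by simp [CupolaFacet.verts])
      (by simp [CupolaFacet.verts])
    ext ⟨i, k⟩
    fin_cases i <;> simp [CupolaFacet.verts]
  | top =>
    refine M.finrank_of_triple r bs (t' := .sideB 0 (Fin.last m)) (v := (0, Fin.last _))
      (w := (2, Fin.last _)) (u := (1, Fin.last _))
      ?_ (by simp) (by simp [CupolaFacet.verts]) (by simp [CupolaFacet.verts])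
      (by simp [CupolaFacet.verts])
    ext ⟨i, k⟩
    fin_cases i <;> simp [CupolaFacet.verts]
  | sideB i k =>
    obtain ⟨h1, h2, h3, h4, h5, h6⟩ := CupolaFacet.fin3_ne i
    exact M.finrank_of_triple r bs (t' := .sideA i k) rfl (by simp [Fin.ext_iff])
      (by simp [CupolaFacet.verts]) (by simp [CupolaFacet.verts]) (by simp [CupolaFacet.verts, *])
  | sideA i k =>
    obtain ⟨h1, h2, h3, h4, h5, h6⟩ := CupolaFacet.fin3_ne i
    exact M.finrank_of_triple r bs (t' := .sideB i k) rfl (by simp [Fin.ext_iff])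
      (by simp [CupolaFacet.verts]) (by simp [CupolaFacet.verts]) (by simp [CupolaFacet.verts, *])

theorem isFacetIneq (t : CupolaFacet m) :
    IsFacetIneq (convexHull ℝ (Set.range (M.pt r bs))) (convexHull ℝ (M.pt r bs '' t.verts))
      (M.fn bs t) (M.cst r bs t) := by
  refine ⟨fun x => le_of_mem_convexHull (M.range_le r bs t), ?_, M.finrank_facet r bs t⟩
  rw [face_convexHull (M.range_le r bs t), M.range_inter]

theorem vectorSpan_range : vectorSpan ℝ (convexHull ℝ (Set.range (M.pt r bs))) = ⊤ := by
  refine (M.isFacetIneq r bs .bot).vectorSpan_eq_top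
    ⟨M.pt r bs (0, 1), subset_convexHull ℝ _ ⟨_, rfl⟩, M.fn_pt_lt r bs .bot ?_⟩
  simp [CupolaFacet.verts]

/-- A facet is two-dimensional, so its tight vertices are not contained in a pair. By
`exists_tight_subset` they belong to a listed facet, and inclusion of facets is equality. -/
theorem isFacet_iff (G : Set E3) : IsFacet (convexHull ℝ (Set.range (M.pt r bs))) G ↔
    ∃ t : CupolaFacet m, G = convexHull ℝ (M.pt r bs '' t.verts) := by
  constructor
  · rintro ⟨f, c, h⟩
    have hle : ∀ x, f (M.pt r bs x) ≤ c := fun x => h.1 _ (subset_convexHull ℝ _ ⟨x, rfl⟩)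
    have hG : G = convexHull ℝ (Set.range (M.pt r bs) ∩ {y | f y = c}) := by
      rw [h.2.1, face_convexHull]
      rintro _ ⟨x, rfl⟩
      exact hle x
    have hlt : ∃ x, f (M.pt r bs x) < c := by
      by_contra! hc
      obtain ⟨p, hp, hlt⟩ := h.exists_lt (M.vectorSpan_range r bs)
      have := le_of_mem_convexHull (f := -f) (c := -c) (S := Set.range (M.pt r bs)) (by
        rintro _ ⟨x, rfl⟩
        simpa using hc x) hp
      simp only [neg_apply] at this
      linarith
    have hpair : ∀ v w, ∃ x, f (M.pt r bs x) = c ∧ x ≠ v ∧ x ≠ w := by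
      intro v w
      by_contra! hc
      have hsub : Set.range (M.pt r bs) ∩ {y | f y = c} ⊆ {M.pt r bs v, M.pt r bs w} := by
        rintro _ ⟨⟨x, rfl⟩, hx⟩
        by_cases hxv : x = v
        · left; rw [hxv]
        · right; rw [hc x hx hxv]; rfl
      have h1 := h.2.2
      rw [hG, ← direction_affineSpan, affineSpan_convexHull, direction_affineSpan] at h1
      have h2 := Submodule.finrank_mono (vectorSpan_mono ℝ hsub)
      have h3 := (collinear_iff_finrank_le_one (k := ℝ)).1
        (collinear_pair ℝ (M.pt r bs v) (M.pt r bs w))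
      omega
    obtain ⟨t, ht⟩ := M.exists_tight_subset r bs hle hlt hpair
    refine ⟨t, h.eq_of_subset (M.vectorSpan_range r bs) (M.isFacetIneq r bs t) ?_⟩
    rw [hG]
    refine convexHull_mono ?_
    rintro _ ⟨⟨x, rfl⟩, hx⟩
    exact ⟨x, ht x hx, rfl⟩
  · rintro ⟨t, rfl⟩
    exact ⟨_, _, M.isFacetIneq r bs t⟩

theorem exists_verts_inter (x : Fin 3 × Fin (m + 2)) :
    ∃ t₁ t₂ t₃ : CupolaFacet m, ∀ y, (y ∈ t₁.verts ∧ y ∈ t₂.verts ∧ y ∈ t₃.verts) ↔ y = x := by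
  obtain ⟨i, l⟩ := x
  obtain ⟨h1, h2, h3, h4, h5, h6⟩ := CupolaFacet.fin3_ne i
  by_cases h0 : l = 0
  · refine ⟨.bot, .sideA i 0, .sideB i 0, ?_⟩
    rintro ⟨j, k⟩
    simp only [CupolaFacet.verts, Set.mem_ofPred_eq, Set.mem_insert_iff, Set.mem_singleton_iff,
      Prod.mk.injEq, h0]
    constructor
    · rintro ⟨rfl, (⟨rfl, -⟩ | ⟨rfl, -⟩ | ⟨rfl, -⟩), h⟩ <;> simp_all
    · rintro ⟨rfl, rfl⟩; simp
  by_cases hl : l = Fin.last (m + 1)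
  · refine ⟨.top, .sideA i (Fin.last m), .sideB i (Fin.last m), ?_⟩
    rintro ⟨j, k⟩
    simp only [CupolaFacet.verts, Set.mem_ofPred_eq, Set.mem_insert_iff, Set.mem_singleton_iff,
      Prod.mk.injEq, hl]
    constructor
    · rintro ⟨rfl, (⟨rfl, -⟩ | ⟨rfl, -⟩ | ⟨rfl, h⟩), h'⟩ <;> simp_all
    · rintro ⟨rfl, rfl⟩; simp
  obtain ⟨k, rfl⟩ := Fin.exists_succ_eq.2 h0
  obtain ⟨k', hk'⟩ := Fin.exists_castSucc_eq.2 hl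
  have hv : k'.val = k.val + 1 := by simpa using congrArg Fin.val hk'
  refine ⟨.sideA i k, .sideA i k', .sideB i k, ?_⟩
  rintro ⟨j, n⟩
  simp only [CupolaFacet.verts, Set.mem_insert_iff, Set.mem_singleton_iff, Prod.mk.injEq,
    Fin.ext_iff, Fin.val_castSucc, Fin.val_succ, Fin.val_last, Fin.val_zero]
  constructor
  · rintro ⟨ha, hb, hc⟩
    have i1 : ¬ (i.val = (i + 1).val) := fun h => h4 (Fin.ext h)
    have i2 : ¬ (i.val = (i + 2).val) := fun h => h5 (Fin.ext h)
    have i3 : ¬ ((i + 1).val = (i + 2).val) := fun h => h3 (Fin.ext h)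
    omega
  · rintro ⟨hj, hn⟩
    refine ⟨Or.inr (Or.inl ⟨hj, hn⟩), Or.inl ⟨hj, by omega⟩, Or.inr (Or.inl ⟨hj, hn⟩)⟩

/-- Every vertex is the only vertex common to three suitable facets, so the sum of their functionals
exposes it. -/
theorem extremePoints_eq : (convexHull ℝ (Set.range (M.pt r bs))).extremePoints ℝ =
    Set.range (M.pt r bs) := by
  refine Set.Subset.antisymm extremePoints_convexHull_subset ?_
  rintro _ ⟨x, rfl⟩
  obtain ⟨t₁, t₂, t₃, h⟩ := exists_verts_inter (m := m) x
  refine mem_extremePoints_of_exposing ⟨x, rfl⟩ (g := M.fn bs t₁ + M.fn bs t₂ + M.fn bs t₃) ?_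
  rintro _ ⟨y, rfl⟩ hyx
  have hyx' : ¬ y = x := fun h => hyx (by rw [h])
  obtain ⟨x1, x2, x3⟩ := (h x).2 rfl
  rw [← h y] at hyx'
  have e1 := (M.fn_pt_eq_iff r bs t₁ x).2 x1
  have e2 := (M.fn_pt_eq_iff r bs t₂ x).2 x2
  have e3 := (M.fn_pt_eq_iff r bs t₃ x).2 x3
  have l1 := M.fn_pt_le r bs t₁ y
  have l2 := M.fn_pt_le r bs t₂ y
  have l3 := M.fn_pt_le r bs t₃ y
  simp only [add_apply]
  by_cases m1 : y ∈ t₁.verts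
  · by_cases m2 : y ∈ t₂.verts
    · have := M.fn_pt_lt r bs t₃ (fun m3 => hyx' ⟨m1, m2, m3⟩)
      linarith
    · have := M.fn_pt_lt r bs t₂ m2
      linarith
  · have := M.fn_pt_lt r bs t₁ m1
    linarith

theorem chain_side (i : Fin 3) (k : Fin (m + 2)) (h0 : k ≠ 0) (hl : k ≠ Fin.last (m + 1)) :
    orient (frameB r bs i) (frameA r bs M.a M.b (i + 1)) (frameB r bs (i + 2)) (M.pt r bs (i, k)) *
      orient (frameB r bs i) (frameA r bs M.a M.b (i + 1)) (frameB r bs (i + 2))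
        (frameB r bs (i + 1)) < 0 := by
  rw [frameA_add_one, frameB_add_one, frameB_add_two, frameB, pt, vert]
  simp only [orient_framePt_cyc]
  have h := M.side k h0 hl
  have ha := M.a_pos
  have h1 : M.a < M.a * (M.p k * M.a - (M.b * M.p k + M.β * M.p k * (1 - M.p k)) +
      (1 - M.p k) * ((1 + M.b) / M.a)) := by
    have := mul_lt_mul_of_pos_left h ha
    linarith
  have h2 : M.a * ((1 + M.b) / M.a) = 1 + M.b := mul_div_cancel₀ _ ha.ne'
  have h3 : 0 < basisDet bs ^ 2 := by have := basisDet_ne_zero bs; positivity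
  have h4 : 0 < M.a - 1 - M.b := M.hβ.trans M.hab
  have h5 : 0 < M.a * (M.p k * M.a - (M.b * M.p k + M.β * M.p k * (1 - M.p k))) +
      (1 - M.p k) * (1 + M.b) - M.a := by
    rw [← h2]; linarith
  have := mul_pos (mul_pos h5 h4) h3
  linarith

/-- The cupola of a model in a frame. -/
noncomputable def toCupola : Cupola m where
  A := frameA r bs M.a M.b
  B := frameB r bs
  q i k := M.pt r bs (i, k)
  q_zero i := M.pt_zero r bs i
  q_last i := M.pt_last r bs i
  q_injective := M.pt_injective r bs
  vertices_eq := M.extremePoints_eq r bs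
  schonhardt := frame_schonhardtPosition r bs M.hb (by linarith [M.hab, M.hβ])
  facet_iff G := by
    refine (M.isFacet_iff r bs G).trans ?_
    constructor
    · rintro ⟨t, rfl⟩
      cases t with
      | bot => exact Or.inl (by rw [M.range_frameA])
      | top => exact Or.inr (Or.inl (by rw [M.range_frameB]))
      | sideB i k => exact Or.inr (Or.inr ⟨i, k, Or.inl (by rw [M.triple_sideB])⟩)
      | sideA i k => exact Or.inr (Or.inr ⟨i, k, Or.inr (by rw [M.triple_sideA])⟩)
    · rintro (rfl | rfl | ⟨i, k, rfl | rfl⟩)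
      · exact ⟨.bot, by rw [M.range_frameA]⟩
      · exact ⟨.top, by rw [M.range_frameB]⟩
      · exact ⟨.sideB i k, by rw [M.triple_sideB]⟩
      · exact ⟨.sideA i k, by rw [M.triple_sideA]⟩
  chain_side i k h0 hl := M.chain_side r bs i k h0 hl

theorem body_toCupola : (M.toCupola r bs).body = convexHull ℝ (Set.range (M.pt r bs)) := rfl

theorem bottom_toCupola : (M.toCupola r bs).bottom =
    convexHull ℝ (M.pt r bs '' (CupolaFacet.bot : CupolaFacet m).verts) := by
  rw [← M.range_frameA]; rfl

/-- Since the facet list is complete and facet inequalities are unique up to scaling, `IsBeyond`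
reduces to the inequalities of the model. -/
theorem mem_beyond_bottom {v : Fin 3 → ℝ} (hbot : M.normal .bot ⬝ᵥ v < M.rhs .bot)
    (h : ∀ t, t ≠ .bot → M.rhs t < M.normal t ⬝ᵥ v) :
    framePt r bs v ∈ beyond (M.toCupola r bs).body (M.toCupola r bs).bottom := by
  intro G f c hf
  rw [body_toCupola] at hf
  rw [bottom_toCupola]
  obtain ⟨t, rfl⟩ := (M.isFacet_iff r bs G).1 ⟨f, c, hf⟩
  obtain ⟨s, hs, rfl, rfl⟩ := (M.isFacetIneq r bs t).unique (M.vectorSpan_range r bs) hf subset_rfl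
  have key := M.cst_sub_fn r bs t v
  have ht : convexHull ℝ (M.pt r bs '' (CupolaFacet.bot : CupolaFacet m).verts) ⊆
      convexHull ℝ (M.pt r bs '' t.verts) ↔ t = .bot := by
    refine ⟨fun hsub => ?_, fun h => h ▸ subset_rfl⟩
    have hall : ∀ i : Fin 3, (i, (0 : Fin (m + 2))) ∈ t.verts := fun i => by
      have h1 := hsub (subset_convexHull ℝ _ ⟨(i, 0), rfl, rfl⟩)
      rw [(M.isFacetIneq r bs t).2.1] at h1
      exact (M.fn_pt_eq_iff r bs t _).1 h1.2
    cases t with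
    | bot => rfl
    | top => have := hall 0; simp [CupolaFacet.verts, Fin.ext_iff] at this
    | sideB i k =>
      rcases hall (i + 2) with h | h | h
      · exact absurd (Prod.ext_iff.1 h).1 (CupolaFacet.fin3_ne i).2.1
      · exact absurd (Prod.ext_iff.1 h).1 (CupolaFacet.fin3_ne i).2.1
      · have := (Prod.ext_iff.1 h).2
        simp [Fin.ext_iff] at this
    | sideA i k =>
      rcases hall (i + 2) with h | h | h
      · exact absurd (Prod.ext_iff.1 h).1 (CupolaFacet.fin3_ne i).2.1
      · exact absurd (Prod.ext_iff.1 h).1 (CupolaFacet.fin3_ne i).2.1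
      · exact absurd (Prod.ext_iff.1 h).1 (CupolaFacet.fin3_ne i).2.2.2.2.2
  rw [ht]
  simp only [smul_apply, smul_eq_mul]
  constructor
  · rintro rfl
    exact mul_lt_mul_of_pos_left (by linarith) hs
  · intro hne
    have := h t hne
    exact mul_lt_mul_of_pos_left (by linarith) hs

theorem cone_toCupola : (M.toCupola r bs).cone = {x | ∀ k, 0 ≤ bs.repr (x - r) k} :=
  frame_visibilityCone r bs (by linarith [M.hab, M.hβ])

/-- Entry i + 2 of a vertex of chain i is negative unless its position is 0. -/
theorem pt_mem_cone_iff (x : Fin 3 × Fin (m + 2)) :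
    M.pt r bs x ∈ (M.toCupola r bs).cone ↔ x.2 = Fin.last (m + 1) := by
  obtain ⟨i, l⟩ := x
  rw [cone_toCupola, Set.mem_ofPred_eq, pt]
  have hk : ∀ k, bs.repr (framePt r bs (M.vert (i, l)) - r) k = M.vert (i, l) k := fun k =>
    congrFun (repr_framePt_sub r bs _) k
  simp only [hk]
  simp only [vert]
  constructor
  · intro h
    have := h (i + 2)
    rw [cyc_add_two] at this
    rw [← M.p_eq_zero_iff]
    have h1 := M.p_nonneg l
    have h2 := M.p_le_one l
    have h3 := mul_nonneg (mul_nonneg M.hβ.le h1) (sub_nonneg.2 h2)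
    have := M.hb
    nlinarith
  · rintro rfl k
    rw [M.p_last]
    rcases fin3_cases i k with rfl | rfl | rfl
    · simp [cyc_self]
    · simp [cyc_add_one]
    · simp [cyc_add_two]

theorem range_inter_cone : Set.range (M.pt r bs) ∩ (M.toCupola r bs).cone =
    Set.range (M.toCupola r bs).B := by
  refine Set.Subset.antisymm ?_ ?_
  · rintro _ ⟨⟨⟨i, l⟩, rfl⟩, hx⟩
    rw [pt_mem_cone_iff] at hx
    obtain rfl : l = _ := hx
    exact ⟨i + 1, (M.pt_last r bs i).symm⟩
  · rintro _ ⟨i, rfl⟩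
    have : (M.toCupola r bs).B i = M.pt r bs (i + 2, Fin.last _) := (M.pt_last' r bs i).symm
    rw [this]
    exact ⟨⟨_, rfl⟩, (M.pt_mem_cone_iff r bs _).2 rfl⟩

end CupolaModel

/-! ### Choice of the bulge: models close to a Schönhardt polytope -/

theorem eventually_pos_of_continuousAt {g : ℝ → ℝ} (hg : ContinuousAt g 0) (h0 : 0 < g 0) :
    ∀ᶠ β in 𝓝[>] (0 : ℝ), 0 < g β :=
  (hg.eventually (lt_mem_nhds h0)).filter_mono nhdsWithin_le_nhds

/-- Compactness of K makes the strict inequality uniform, so it survives a small perturbation of the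
normal. -/
theorem eventually_dotProduct_gt {K : Set (Fin 3 → ℝ)} (hK : IsCompact K) {i : Fin 3}
    {g₀ g₁ g₂ : ℝ → ℝ} (h₀ : ContinuousAt g₀ 0) (h₁ : ContinuousAt g₁ 0) (h₂ : ContinuousAt g₂ 0)
    (h : ∀ v ∈ K, 1 < g₀ 0 * v i + g₁ 0 * v (i + 1) + g₂ 0 * v (i + 2)) :
    ∀ᶠ β in 𝓝[>] (0 : ℝ), ∀ v ∈ K, 1 < cyc i (g₀ β) (g₁ β) (g₂ β) ⬝ᵥ v := by
  have key : ∀ᶠ β in 𝓝 (0 : ℝ), ∀ v ∈ K,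
      1 < g₀ β * v i + g₁ β * v (i + 1) + g₂ β * v (i + 2) := by
    refine hK.eventually_forall_of_forall_eventually fun v hv => ?_
    have hc : ContinuousAt (fun z : ℝ × (Fin 3 → ℝ) =>
        g₀ z.1 * z.2 i + g₁ z.1 * z.2 (i + 1) + g₂ z.1 * z.2 (i + 2)) (0, v) := by
      have k : ∀ {g : ℝ → ℝ}, ContinuousAt g 0 → ∀ j, ContinuousAt
          (fun z : ℝ × (Fin 3 → ℝ) => g z.1 * z.2 j) (0, v) := fun hg j =>
        (ContinuousAt.comp (x := ((0 : ℝ), v)) hg continuousAt_fst).mul (by fun_prop)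
      exact ((k h₀ i).add (k h₁ (i + 1))).add (k h₂ (i + 2))
    have := hc.eventually (lt_mem_nhds (h v hv))
    exact this
  refine (key.filter_mono nhdsWithin_le_nhds).mono fun β hβ v hv => ?_
  have := hβ v hv
  rwa [eq_cyc i v, cyc_dotProduct]

/-- Positions of the vertices on a chain. -/
noncomputable def chainPos (m : ℕ) (θ : ℝ) (k : Fin (m + 2)) : ℝ :=
  if k = Fin.last (m + 1) then 0 else 1 - θ * (k.val / (m + 1))

/-- All positions except the last crowd within θ of the A end, which the side condition on inner
chain vertices requires. -/
theorem chainPos_bounds {m : ℕ} {θ : ℝ} (h0 : 0 < θ) {k : Fin (m + 2)}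
    (hk : k ≠ Fin.last (m + 1)) : 1 - θ < chainPos m θ k ∧ chainPos m θ k ≤ 1 := by
  rw [chainPos, if_neg hk]
  have h1 : (k.val : ℝ) < m + 1 := by
    have := Fin.lt_last_iff_ne_last.2 hk
    rw [Fin.lt_def, Fin.val_last] at this
    exact_mod_cast this
  have h2 : (k.val : ℝ) / (m + 1) < 1 := (div_lt_one (by positivity)).2 h1
  have h3 : 0 ≤ (k.val : ℝ) / (m + 1) := by positivity
  constructor <;> nlinarith

theorem chainPos_strictAnti {m : ℕ} {θ : ℝ} (h0 : 0 < θ) (h1 : θ < 1) :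
    StrictAnti (chainPos m θ) := by
  intro k l hkl
  have hk : k ≠ Fin.last (m + 1) := (hkl.trans_le (Fin.le_last l)).ne
  by_cases hl : l = Fin.last (m + 1)
  · have := chainPos_bounds (m := m) h0 hk
    rw [hl, chainPos, if_pos rfl]
    linarith
  · rw [chainPos, chainPos, if_neg hk, if_neg hl]
    have : (k.val : ℝ) < l.val := by exact_mod_cast hkl
    have h2 : (k.val : ℝ) / (m + 1) < l.val / (m + 1) := by gcongr
    nlinarith

/-- Existence of cupola models for a given Schönhardt polytope. -/
theorem exists_cupolaModel {m : ℕ} (hm : 1 ≤ m) {a b : ℝ} (hb : 0 < b) (hab : 1 + b < a)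
    {K N : Set (Fin 3 → ℝ)} (hK : IsCompact K) (hN : IsOpen N) (hNc : Convex ℝ N)
    (hAN : ∀ i, cyc i a 0 (-b) ∈ N) (hBN : ∀ i, cyc i 1 0 0 ∈ N)
    (hKbot : ∀ v ∈ K, a - b < v 0 + v 1 + v 2)
    (hKB : ∀ v ∈ K, ∀ i, 1 < v i + v (i + 1) + (a - 1) / b * v (i + 2))
    (hKA : ∀ v ∈ K, ∀ i,
      1 < (a - 1) / b * v i + v (i + 1) + (a ^ 2 - a - b) / b ^ 2 * v (i + 2)) :
    ∃ M : CupolaModel m, M.a = a ∧ M.b = b ∧ (∀ x, M.vert x ∈ N) ∧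
      ∀ v ∈ K, M.normal .bot ⬝ᵥ v < M.rhs .bot ∧ ∀ t, t ≠ .bot → M.rhs t < M.normal t ⬝ᵥ v := by
  -- This choice gives (1 - θ)(a - b) = (a - b + 1)/2 > 1, which is the side condition at β = 0.
  set θ := (a - b - 1) / (2 * (a - b)) with hθ
  have hd : 0 < a - b := by linarith
  have hθ0 : 0 < θ := div_pos (by linarith) (by linarith)
  have hθe : θ * (2 * (a - b)) = a - b - 1 := div_mul_cancel₀ _ (by linarith)
  have hθ1 : θ < 1 := by
    rw [hθ, div_lt_one (by linarith)]; linarith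
  have ha : 0 < a := by linarith
  set p := chainPos m θ with hp
  have hanti : StrictAnti p := chainPos_strictAnti hθ0 hθ1
  have hp0 : p 0 = 1 := by simp [hp, chainPos, Fin.ext_iff]
  have hpl : p (Fin.last (m + 1)) = 0 := by simp [hp, chainPos]
  let L : Fin (m + 1) → ℝ → ℝ := fun k β => b + β * (1 - p k.castSucc) * (1 - p k.succ)
  let l : Fin (m + 1) → ℝ → ℝ := fun k β => β * p k.castSucc * p k.succ
  let nB : Fin (m + 1) → ℝ → ℝ := fun k β => (a - 1) / L k β
  -- Eliminating lamA from its two defining equations leaves νA · D = a² - a - b.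
  let D : Fin (m + 1) → ℝ → ℝ := fun k β => b * L k β - a ^ 2 * l k β
  let nA : Fin (m + 1) → ℝ → ℝ := fun k β => (a ^ 2 - a - b) / D k β
  let lA : Fin (m + 1) → ℝ → ℝ := fun k β => (1 + nA k β * L k β) / a
  have cL : ∀ k, Continuous (L k) := fun k => by fun_prop
  have cl : ∀ k, Continuous (l k) := fun k => by fun_prop
  have cD : ∀ k, Continuous (D k) := fun k => by fun_prop
  have L0 : ∀ k, L k 0 = b := fun k => by simp [L]
  have l0 : ∀ k, l k 0 = 0 := fun k => by simp [l]
  have D0 : ∀ k, D k 0 = b ^ 2 := fun k => by simp [D, L0, l0, sq]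
  have cnB : ∀ k, ContinuousAt (nB k) 0 := fun k =>
    continuousAt_const.div (cL k).continuousAt (by rw [L0]; exact hb.ne')
  have cnA : ∀ k, ContinuousAt (nA k) 0 := fun k =>
    continuousAt_const.div (cD k).continuousAt (by rw [D0]; positivity)
  have clA : ∀ k, ContinuousAt (lA k) 0 := fun k =>
    ((continuousAt_const.add ((cnA k).mul (cL k).continuousAt)).div_const a)
  have cl' : ∀ k, ContinuousAt (l k) 0 := fun k => (cl k).continuousAt
  have nB0 : ∀ k, nB k 0 = (a - 1) / b := fun k => by simp only [nB, L0]
  have nA0 : ∀ k, nA k 0 = (a ^ 2 - a - b) / b ^ 2 := fun k => by simp only [nA, D0]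
  have lA0 : ∀ k, lA k 0 = (a - 1) / b := fun k => by
    simp only [lA, nA0, L0]
    field_simp
    ring
  have hnB1 : 1 < (a - 1) / b := by rw [one_lt_div hb]; linarith
  have hnA1 : 1 < (a ^ 2 - a - b) / b ^ 2 := by rw [one_lt_div (by positivity)]; nlinarith
  have cid : ContinuousAt (fun β : ℝ => β) 0 := continuousAt_id
  -- Apart from β > 0, every condition holds strictly at β = 0 and depends continuously on β.
  have ev : ∀ᶠ β in 𝓝[>] (0 : ℝ), 0 < β ∧ 0 < a - 1 - b - β ∧
      (∀ k, 0 < L k β) ∧ (∀ k, 0 < D k β) ∧ (∀ k, 0 < nB k β - 1) ∧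
      (∀ k, 0 < nB k β * a - 1 - (1 + nB k β * l k β) * (b + β)) ∧
      (∀ k, 0 < lA k β - 1) ∧ (∀ k, 0 < nA k β - (1 + lA k β * β)) ∧
      (∀ k, 0 < nA k β * a - 1 - (1 + nA k β * l k β) * (b + β)) ∧
      (∀ k, k ≠ 0 → k ≠ Fin.last (m + 1) → 0 < p k * a - (b * p k + β * p k * (1 - p k)) +
        (1 - p k) * ((1 + b) / a) - 1) ∧
      (∀ x : Fin 3 × Fin (m + 2), cyc x.1 (a * p x.2) (1 - p x.2)
        (-(b * p x.2 + β * p x.2 * (1 - p x.2))) ∈ N) ∧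
      (∀ (i : Fin 3) k, ∀ v ∈ K, 1 < cyc i 1 (1 + nB k β * l k β) (nB k β) ⬝ᵥ v) ∧
      (∀ (i : Fin 3) k, ∀ v ∈ K, 1 < cyc i (lA k β) (1 + nA k β * l k β) (nA k β) ⬝ᵥ v) := by
    simp only [eventually_and, eventually_all]
    refine ⟨eventually_mem_nhdsWithin, eventually_pos_of_continuousAt (by fun_prop) (by linarith),
      fun k => eventually_pos_of_continuousAt (cL k).continuousAt (by rw [L0]; exact hb),
      fun k => eventually_pos_of_continuousAt (cD k).continuousAt (by rw [D0]; positivity),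
      fun k => eventually_pos_of_continuousAt ((cnB k).sub continuousAt_const)
        (by rw [nB0]; linarith),
      fun k => eventually_pos_of_continuousAt ((((cnB k).mul continuousAt_const).sub
        continuousAt_const).sub ((continuousAt_const.add ((cnB k).mul (cl' k))).mul
          (continuousAt_const.add cid))) ?_,
      fun k => eventually_pos_of_continuousAt ((clA k).sub continuousAt_const)
        (by rw [lA0]; linarith),
      fun k => eventually_pos_of_continuousAt ((cnA k).sub (continuousAt_const.add
        ((clA k).mul cid))) (by rw [nA0, mul_zero]; linarith),
      fun k => eventually_pos_of_continuousAt ((((cnA k).mul continuousAt_const).sub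
        continuousAt_const).sub ((continuousAt_const.add ((cnA k).mul (cl' k))).mul
          (continuousAt_const.add cid))) ?_,
      fun k hk hk' => eventually_pos_of_continuousAt (by fun_prop) ?_, ?_,
      fun i k => eventually_dotProduct_gt hK continuousAt_const
        (continuousAt_const.add ((cnB k).mul (cl' k))) (cnB k) fun v hv => ?_,
      fun i k => eventually_dotProduct_gt hK (clA k)
        (continuousAt_const.add ((cnA k).mul (cl' k))) (cnA k) fun v hv => ?_⟩
    · rw [nB0, l0]; nlinarith
    · rw [nA0, l0]; nlinarith
    · obtain ⟨h1, h2⟩ := chainPos_bounds (m := m) hθ0 hk'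
      rw [← hp] at h1 h2
      have h3 : 0 ≤ (1 + b) / a := by positivity
      have h4 : 0 ≤ (1 - p k) * ((1 + b) / a) := mul_nonneg (by linarith) h3
      have h5 : 0 < (p k - (1 - θ)) * (a - b) := mul_pos (by linarith) hd
      nlinarith
    · rintro ⟨i, k⟩
      have hc : Continuous fun β : ℝ => cyc i (a * p k) (1 - p k)
          (-(b * p k + β * p k * (1 - p k))) := by
        refine continuous_pi fun j => ?_
        unfold cyc
        split_ifs <;> fun_prop
      refine (hc.continuousAt.eventually_mem (hN.mem_nhds ?_)).filter_mono nhdsWithin_le_nhds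
      -- Without bulge the vertex is a convex combination of A_i and B_{i+1}.
      have h1 := hNc (hAN i) (hBN (i + 1)) (a := p k) (b := 1 - p k)
        (by rw [← hpl]; exact hanti.antitone (Fin.le_last k))
        (by rw [sub_nonneg, ← hp0]; exact hanti.antitone (Fin.zero_le k)) (by ring)
      convert h1 using 1
      rw [cyc_add_one_eq]
      funext j
      simp only [cyc, Pi.add_apply, Pi.smul_apply, smul_eq_mul]
      split_ifs <;> ring
    · have := hKB v hv i
      rw [nB0, l0]; linarith
    · have := hKA v hv i
      rw [nA0, lA0, l0]; linarith
  obtain ⟨β, hβ, h1, h2, h3, h4, h5, h6, h7, h8, h9, h10, h11, h12⟩ := ev.exists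
  refine ⟨⟨a, b, β, p, fun k => nB k β, fun k => lA k β, fun k => nA k β, hm, hb, hβ, by linarith,
    hp0, hpl, hanti, fun k => mul_div_cancel₀ _ (h2 k).ne', fun k => by linarith [h4 k],
    fun k => by linarith [h5 k], fun k => div_mul_cancel₀ _ ha.ne', fun k => ?_,
    fun k => by linarith [h6 k], fun k => by linarith [h7 k], fun k => by linarith [h8 k],
    fun k hk hk' => by linarith [h9 k hk hk']⟩, rfl, rfl, h10, fun v hv => ⟨?_, ?_⟩⟩
  · have e1 : nA k β * D k β = a ^ 2 - a - b := div_mul_cancel₀ _ (h3 k).ne'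
    have e2 : lA k β * a = 1 + nA k β * L k β := div_mul_cancel₀ _ ha.ne'
    change (1 + nA k β * l k β) * a = 1 + lA k β * b
    have e3 : nA k β * (b * L k β - a ^ 2 * l k β) = a ^ 2 - a - b := e1
    apply mul_right_cancel₀ ha.ne'
    linear_combination -e3 - b * e2
  · have := hKbot v hv
    simp only [CupolaModel.normal, CupolaModel.rhs, dotProduct, Fin.sum_univ_three]
    linarith
  · intro t ht
    cases t with
    | bot => exact absurd rfl ht
    | top =>
      have := hKbot v hv
      simp only [CupolaModel.normal, CupolaModel.rhs, dotProduct, Fin.sum_univ_three]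
      linarith
    | sideB i k => exact h11 i k v hv
    | sideA i k => exact h12 i k v hv

theorem eq_of_mem_affineSpan {T : Set E3} {f : E3 →L[ℝ] ℝ} {c : ℝ} (hT : ∀ x ∈ T, f x = c) {x : E3}
    (hx : x ∈ affineSpan ℝ T) : f x = c := by
  have hle : affineSpan ℝ T ≤ AffineSubspace.comap (f : E3 →ₗ[ℝ] ℝ).toAffineMap
      (AffineSubspace.mk' c ⊥) := by
    rw [affineSpan_le]
    intro y hy
    simp [hT y hy]
  have := hle hx
  simpa [sub_eq_zero] using this

/-! ### Topology of frames and the relative interior of the skylight -/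

section FrameTopology

variable (r : E3) (bs : Module.Basis (Fin 3) ℝ E3)

theorem continuous_framePt : Continuous (framePt r bs) := by
  unfold framePt
  fun_prop

theorem framePt_combo {V V' : Fin 3 → ℝ} {a b : ℝ} (hab : a + b = 1) :
    framePt r bs (a • V + b • V') = a • framePt r bs V + b • framePt r bs V' := by
  obtain rfl : b = 1 - a := by linarith
  simp only [framePt, Fin.sum_univ_three, Pi.add_apply, Pi.smul_apply, smul_eq_mul]
  module

theorem convex_preimage_framePt {W : Set E3} (hW : Convex ℝ W) : Convex ℝ (framePt r bs ⁻¹' W) := by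
  intro V hV V' hV' a b ha hb hab
  rw [Set.mem_preimage, framePt_combo r bs hab]
  exact hW hV hV' ha hb hab

theorem continuous_frame_repr : Continuous fun x : E3 => ⇑(bs.repr (x - r)) := by
  refine continuous_pi fun k => ?_
  exact (LinearMap.toContinuousLinearMap (bs.coord k)).continuous.comp (continuous_sub_right r)

theorem framePt_mem_convexHull_frameB {V : Fin 3 → ℝ} (hV : ∀ k, 0 ≤ V k) (hsum : ∑ k, V k = 1) :
    framePt r bs V ∈ convexHull ℝ (Set.range (frameB r bs)) := by
  have h := (convex_convexHull ℝ (Set.range (frameB r bs))).sum_mem (t := Finset.univ)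
    (fun k _ => hV k) hsum (z := frameB r bs) (fun k _ => subset_convexHull ℝ _ ⟨k, rfl⟩)
  convert h using 1
  have hB : ∀ k, frameB r bs k = r + bs k := fun k => by
    simp [frameB, framePt, cyc]
  simp only [hB, smul_add, Finset.sum_add_distrib, ← Finset.sum_smul, hsum, one_smul, framePt]

theorem sum_repr_of_mem_affineSpan {x : E3}
    (hx : x ∈ affineSpan ℝ (convexHull ℝ (Set.range (frameB r bs)))) :
    ∑ k, bs.repr (x - r) k = 1 := by
  rw [affineSpan_convexHull] at hx
  have h := eq_of_mem_affineSpan (f := frameLin bs (fun _ => 1))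
    (c := frameLin bs (fun _ => 1) r + 1) (T := Set.range (frameB r bs)) ?_ hx
  · have h2 := frameLin_framePt r bs (fun _ => 1) (bs.repr (x - r))
    rw [framePt_repr, h] at h2
    simp only [dotProduct, one_mul] at h2
    linarith
  · rintro _ ⟨k, rfl⟩
    rw [frameB, frameLin_framePt, CupolaModel.const_dotProduct_cyc]
    ring

/-- In the affine span of the skylight, where the coordinates sum to 1, they are barycentric;
positivity is therefore an open condition that implies membership. -/
theorem framePt_mem_intrinsicInterior {V : Fin 3 → ℝ} (hV : ∀ k, 0 < V k) (hsum : ∑ k, V k = 1) :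
    framePt r bs V ∈ intrinsicInterior ℝ (convexHull ℝ (Set.range (frameB r bs))) := by
  have hmem := framePt_mem_convexHull_frameB r bs (fun k => (hV k).le) hsum
  have hspan := subset_affineSpan ℝ _ hmem
  rw [mem_intrinsicInterior]
  refine ⟨⟨_, hspan⟩, ?_, rfl⟩
  have hopen : IsOpen {x : affineSpan ℝ (convexHull ℝ (Set.range (frameB r bs))) |
      ∀ k, 0 < bs.repr ((x : E3) - r) k} := by
    simp only [Set.ofPred_forall]
    refine isOpen_iInter_of_finite fun k => isOpen_lt continuous_const ?_
    exact ((continuous_apply k).comp (continuous_frame_repr r bs)).comp continuous_subtype_val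
  refine interior_maximal ?_ hopen ?_
  · intro x hx
    have h1 := sum_repr_of_mem_affineSpan r bs x.2
    have h2 := framePt_mem_convexHull_frameB r bs (fun k => (hx k).le) h1
    rwa [framePt_repr] at h2
  · intro k
    have := congrFun (repr_framePt_sub r bs V) k
    change 0 < bs.repr (framePt r bs V - r) k
    rw [this]
    exact hV k

end FrameTopology

/-! ### Flat cupolas close to a facet -/

section Scaled

variable (p₀ : E3) (e : Module.Basis (Fin 3) ℝ E3) (s τ : ℝ)

/-- The coordinates with respect to the visibility cone of a point given by coordinates in `e`. -/
noncomputable def coneCoord (v : Fin 3 → ℝ) : Fin 3 → ℝ :=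
  ![((1 - v 1 / τ ^ 2) / (1 + s) - v 0) / 2 + τ - v 2 / τ,
    ((1 - v 1 / τ ^ 2) / (1 + s) + v 0) / 2 + τ - v 2 / τ,
    (s + v 1 / τ ^ 2) / (1 + s) + τ - v 2 / τ]

/-- The inverse of `coneCoord`. -/
noncomputable def ofConeCoord (V : Fin 3 → ℝ) : Fin 3 → ℝ :=
  -- The unit vectors go to the skylight vertices (-1, -sτ², τ²), (1, -sτ², τ²) and (0, τ², τ²), and
  -- the origin goes to the apex at height τ² + τ/3.
  ![V 1 - V 0,
    τ ^ 2 * (1 - 2 * s) / 3 - τ ^ 2 * (1 + s) / 3 * (V 0 + V 1) + τ ^ 2 * (2 + 2 * s) / 3 * V 2,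
    τ ^ 2 + τ / 3 - τ / 3 * (V 0 + V 1 + V 2)]

/-- The apex of the cone. -/
noncomputable def coneApex : E3 := framePt p₀ e (ofConeCoord s τ 0)

/-- The edge directions of the cone. -/
noncomputable def coneDir (k : Fin 3) : E3 :=
  ![-e 0 - (τ ^ 2 * (1 + s) / 3) • e 1 - (τ / 3) • e 2,
    e 0 - (τ ^ 2 * (1 + s) / 3) • e 1 - (τ / 3) • e 2,
    (τ ^ 2 * (2 + 2 * s) / 3) • e 1 - (τ / 3) • e 2] k

variable {s τ}

theorem linearIndependent_coneDir (hs : 0 < s) (hτ : 0 < τ) :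
    LinearIndependent ℝ (coneDir e s τ) := by
  rw [Fintype.linearIndependent_iff]
  intro g hg
  have h2 : ∑ k, (![g 1 - g 0, -(τ ^ 2 * (1 + s) / 3) * (g 0 + g 1) +
      τ ^ 2 * (2 + 2 * s) / 3 * g 2, -(τ / 3) * (g 0 + g 1 + g 2)] : Fin 3 → ℝ) k • e k = 0 := by
    rw [← hg]
    simp only [Fin.sum_univ_three, coneDir, Matrix.cons_val_zero, Matrix.cons_val_one,
      Matrix.cons_val]
    module
  have h3 := Fintype.linearIndependent_iff.1 e.linearIndependent _ h2
  have e0 := h3 0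
  have e1 := h3 1
  have e2 := h3 2
  simp only [Matrix.cons_val_zero, Matrix.cons_val_one, Matrix.cons_val] at e0 e1 e2
  have f2 : g 0 + g 1 + g 2 = 0 := (mul_eq_zero.1 e2).resolve_left (by linarith)
  have f1 : τ ^ 2 * (1 + s) * g 2 = 0 := by linear_combination e1 + (τ ^ 2 * (1 + s) / 3) * f2
  have g2 : g 2 = 0 := (mul_eq_zero.1 f1).resolve_left (by positivity)
  intro i
  fin_cases i
  · change g 0 = 0; linarith
  · change g 1 = 0; linarith
  · exact g2

/-- The basis of edge directions of the cone. -/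
noncomputable def coneBasis (hs : 0 < s) (hτ : 0 < τ) : Module.Basis (Fin 3) ℝ E3 :=
  basisOfLinearIndependentOfCardEqFinrank (linearIndependent_coneDir e hs hτ) (by simp)

theorem framePt_cone (hs : 0 < s) (hτ : 0 < τ) (V : Fin 3 → ℝ) :
    framePt (coneApex p₀ e s τ) (coneBasis e hs hτ) V = framePt p₀ e (ofConeCoord s τ V) := by
  have hB : ⇑(coneBasis e hs hτ) = coneDir e s τ :=
    coe_basisOfLinearIndependentOfCardEqFinrank _ _
  simp only [framePt, coneApex, hB, Fin.sum_univ_three, coneDir, ofConeCoord, Matrix.cons_val_zero,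
    Matrix.cons_val_one, Matrix.cons_val, Pi.zero_apply]
  module

theorem ofConeCoord_coneCoord (hs : 0 < s) (hτ : 0 < τ) (v : Fin 3 → ℝ) :
    ofConeCoord s τ (coneCoord s τ v) = v := by
  funext k
  fin_cases k <;> simp [ofConeCoord, coneCoord] <;> field_simp <;> ring

theorem framePt_coneCoord (hs : 0 < s) (hτ : 0 < τ) (v : Fin 3 → ℝ) :
    framePt (coneApex p₀ e s τ) (coneBasis e hs hτ) (coneCoord s τ v) = framePt p₀ e v := by
  rw [framePt_cone, ofConeCoord_coneCoord hs hτ]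

theorem continuous_coneCoord (s τ : ℝ) : Continuous (coneCoord s τ) := by
  refine continuous_pi fun k => ?_
  fin_cases k
  · change Continuous fun v : Fin 3 → ℝ => ((1 - v 1 / τ ^ 2) / (1 + s) - v 0) / 2 + τ - v 2 / τ
    fun_prop
  · change Continuous fun v : Fin 3 → ℝ => ((1 - v 1 / τ ^ 2) / (1 + s) + v 0) / 2 + τ - v 2 / τ
    fun_prop
  · change Continuous fun v : Fin 3 → ℝ => (s + v 1 / τ ^ 2) / (1 + s) + τ - v 2 / τ
    fun_prop

/-- The coordinate sum measures depth below the apex: it is 1 at the skylight height τ² and 1 + 3τ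
at the height 0 of the facet. -/
theorem sum_coneCoord (hs : 0 < s) (v : Fin 3 → ℝ) :
    coneCoord s τ v 0 + coneCoord s τ v 1 + coneCoord s τ v 2 = 1 + 3 * (τ - v 2 / τ) := by
  simp only [coneCoord, Matrix.cons_val_zero, Matrix.cons_val_one, Matrix.cons_val]
  generalize v 1 / τ ^ 2 = t
  have : (1 - t) / (1 + s) + (s + t) / (1 + s) = 1 := by field_simp; ring
  linarith

/-- A lower bound for the cone coordinates on a bounded set below the facet. -/
theorem coneCoord_ge (hs : 0 < s) (hτ : 0 < τ) (hτ1 : τ ≤ 1) {R : ℝ} {v : Fin 3 → ℝ}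
    (h0 : |v 0| ≤ R) (h1 : |v 1| ≤ R) (h2 : v 2 ≤ 0) (k : Fin 3) :
    -R ≤ τ ^ 2 * coneCoord s τ v k := by
  have hτ2 : τ ^ 2 ≤ 1 := by nlinarith
  have hτp : 0 < τ ^ 2 := by positivity
  obtain ⟨a0, b0⟩ := abs_le.1 h0
  obtain ⟨a1, b1⟩ := abs_le.1 h1
  have hR : 0 ≤ R := (abs_nonneg _).trans h0
  have h3 : 0 ≤ τ ^ 2 * (τ - v 2 / τ) := by
    have : v 2 / τ ≤ 0 := div_nonpos_of_nonpos_of_nonneg h2 hτ.le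
    exact mul_nonneg hτp.le (by linarith)
  have e1 : τ ^ 2 * (v 1 / τ ^ 2) = v 1 := mul_div_cancel₀ _ hτp.ne'
  have hx : |τ ^ 2 * v 0| ≤ R := by
    rw [abs_mul, abs_of_pos hτp]
    nlinarith [abs_nonneg (v 0)]
  obtain ⟨a2, b2⟩ := abs_le.1 hx
  have k1 : -R ≤ (τ ^ 2 - v 1) / (1 + s) := by
    rw [le_div_iff₀ (by linarith)]; nlinarith
  have k2 : -R ≤ (τ ^ 2 * s + v 1) / (1 + s) := by
    rw [le_div_iff₀ (by linarith)]; nlinarith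
  have l1 : τ ^ 2 * ((1 - v 1 / τ ^ 2) / (1 + s)) = (τ ^ 2 - v 1) / (1 + s) := by
    rw [← mul_div_assoc, mul_sub, e1, mul_one]
  have l2 : τ ^ 2 * ((s + v 1 / τ ^ 2) / (1 + s)) = (τ ^ 2 * s + v 1) / (1 + s) := by
    rw [← mul_div_assoc, mul_add, e1]
  fin_cases k
  · change -R ≤ τ ^ 2 * (((1 - v 1 / τ ^ 2) / (1 + s) - v 0) / 2 + τ - v 2 / τ)
    linarith
  · change -R ≤ τ ^ 2 * (((1 - v 1 / τ ^ 2) / (1 + s) + v 0) / 2 + τ - v 2 / τ)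
    linarith
  · change -R ≤ τ ^ 2 * ((s + v 1 / τ ^ 2) / (1 + s) + τ - v 2 / τ)
    linarith

/-- With a - 1 - b = 3τ⁴ the side normals at β = 0 differ from (1, 1, 1) by O(τ⁴). The coordinates
are at least -R/τ², so the error is O(τ²), while points with v 2 ≤ 0 have coordinate sum at least 1
+ 3τ. -/
theorem coneCoord_facet (hs : 0 < s) (hτ : 0 < τ) (hτ1 : τ < 1) {R : ℝ}
    (hR : τ * (R * (3 * s + 4)) < s ^ 2) {v : Fin 3 → ℝ}
    (h0 : |v 0| ≤ R) (h1 : |v 1| ≤ R) (h2 : v 2 ≤ 0) :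
    (1 + s + 3 * τ ^ 4 - s < coneCoord s τ v 0 + coneCoord s τ v 1 + coneCoord s τ v 2) ∧
    (∀ i, 1 < coneCoord s τ v i + coneCoord s τ v (i + 1) +
      (1 + s + 3 * τ ^ 4 - 1) / s * coneCoord s τ v (i + 2)) ∧
    (∀ i, 1 < (1 + s + 3 * τ ^ 4 - 1) / s * coneCoord s τ v i + coneCoord s τ v (i + 1) +
      ((1 + s + 3 * τ ^ 4) ^ 2 - (1 + s + 3 * τ ^ 4) - s) / s ^ 2 * coneCoord s τ v (i + 2)) := by
  have hge := coneCoord_ge hs hτ hτ1.le h0 h1 h2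
  have hsum := sum_coneCoord (τ := τ) hs v
  have hR0 : 0 ≤ R := (abs_nonneg _).trans h0
  have hz : 0 ≤ - (v 2 / τ) := neg_nonneg.2 (div_nonpos_of_nonpos_of_nonneg h2 hτ.le)
  have hτ4 : τ ^ 4 < τ := by
    have := pow_lt_pow_right_of_lt_one₀ hτ hτ1 (show 1 < 4 by norm_num)
    simpa using this
  have hsum' : ∀ i, coneCoord s τ v i + coneCoord s τ v (i + 1) + coneCoord s τ v (i + 2) =
      1 + 3 * (τ - v 2 / τ) := by
    intro i
    rw [← hsum]
    fin_cases i
    · rfl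
    · simp; ring
    · simp; ring
  generalize coneCoord s τ v = V at *
  have hs2 : 0 < s ^ 2 := by positivity
  refine ⟨by linarith, fun i => ?_, fun i => ?_⟩
  · have e1 : (1 + s + 3 * τ ^ 4 - 1) / s = 1 + 3 * τ ^ 4 / s := by field_simp; ring
    rw [e1]
    have h3 := hsum' i
    have h4 := hge (i + 2)
    have h5 : -(3 * τ) < 3 * τ ^ 4 / s * V (i + 2) := by
      have : 3 * τ ^ 4 / s * V (i + 2) = 3 * τ ^ 2 / s * (τ ^ 2 * V (i + 2)) := by ring
      rw [this]
      have h6 : 3 * τ ^ 2 / s * (-R) ≤ 3 * τ ^ 2 / s * (τ ^ 2 * V (i + 2)) :=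
        mul_le_mul_of_nonneg_left h4 (by positivity)
      refine lt_of_lt_of_le ?_ h6
      have h7 : 3 * τ ^ 2 / s * (-R) = -(3 * τ) * (τ * R / s) := by ring
      rw [h7]
      have h8 : τ * R / s < 1 := by
        rw [div_lt_one hs]
        have := mul_nonneg hτ.le hR0
        by_contra! hc
        nlinarith
      nlinarith
    linarith
  · set ε := 3 * τ ^ 4 with hε
    have hε0 : 0 < ε := by positivity
    have hε1 : ε < 3 := by
      have : τ ^ 4 < 1 := by linarith
      linarith
    have e1 : (1 + s + ε - 1) / s = 1 + ε / s := by field_simp; ring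
    have e2 : ((1 + s + ε) ^ 2 - (1 + s + ε) - s) / s ^ 2 = 1 + ε * (1 + 2 * s + ε) / s ^ 2 := by
      field_simp; ring
    rw [e1, e2]
    have h3 := hsum' i
    have h4 := hge (i + 2)
    have h4' := hge i
    have k1 : -(3 * τ ^ 2 * R / s) ≤ ε / s * V i := by
      have : ε / s * V i = 3 * τ ^ 2 / s * (τ ^ 2 * V i) := by rw [hε]; ring
      rw [this]
      have h6 := mul_le_mul_of_nonneg_left h4' (show 0 ≤ 3 * τ ^ 2 / s by positivity)
      refine le_trans (le_of_eq ?_) h6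
      ring
    -- The bound ε < 3 replaces 1 + 2s + ε by 4 + 2s; together with the previous error term this
    -- produces the factor 3s + 4 of the hypothesis.
    have k2 : -(3 * τ ^ 2 * R * (4 + 2 * s) / s ^ 2) ≤ ε * (1 + 2 * s + ε) / s ^ 2 * V (i + 2) := by
      have : ε * (1 + 2 * s + ε) / s ^ 2 * V (i + 2) =
          3 * τ ^ 2 * (1 + 2 * s + ε) / s ^ 2 * (τ ^ 2 * V (i + 2)) := by rw [hε]; ring
      rw [this]
      have h6 := mul_le_mul_of_nonneg_left h4
        (show 0 ≤ 3 * τ ^ 2 * (1 + 2 * s + ε) / s ^ 2 by positivity)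
      refine le_trans ?_ h6
      rw [mul_neg, neg_le_neg_iff]
      have : 3 * τ ^ 2 * (1 + 2 * s + ε) / s ^ 2 * R = 3 * τ ^ 2 * R * (1 + 2 * s + ε) / s ^ 2 := by
        ring
      rw [this]
      exact div_le_div_of_nonneg_right (mul_le_mul_of_nonneg_left (by linarith) (by positivity))
        hs2.le
    have k3 : 3 * τ ^ 2 * R / s + 3 * τ ^ 2 * R * (4 + 2 * s) / s ^ 2 < 3 * τ := by
      have : 3 * τ ^ 2 * R / s + 3 * τ ^ 2 * R * (4 + 2 * s) / s ^ 2 =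
          3 * τ * ((τ * (R * (3 * s + 4))) / s ^ 2) := by field_simp; ring
      rw [this]
      have : (τ * (R * (3 * s + 4))) / s ^ 2 < 1 := by rwa [div_lt_one hs2]
      nlinarith
    linarith

/-- The cone is close to the plane `v 1 = 0` on a bounded set below the facet. -/
theorem exists_coneCoord_neg (hs : 0 < s) (hτ : 0 < τ) (hτ1 : τ < 1) {R ω : ℝ}
    (hω : τ * ((1 + s) * (3 + 2 * R) + s) < ω) {v : Fin 3 → ℝ} (h1 : ω ≤ |v 1|)
    (h2 : |v 2| ≤ R) : ∃ k, coneCoord s τ v k < 0 := by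
  by_contra! hc
  have hR0 : 0 ≤ R := (abs_nonneg _).trans h2
  have hsum := sum_coneCoord (τ := τ) hs v
  have hw : τ * (τ - v 2 / τ) ≤ 1 + R := by
    rw [mul_sub, mul_div_cancel₀ _ hτ.ne']
    have := (abs_le.1 h2).1
    nlinarith
  have c0 := hc 0
  have c1 := hc 1
  have c2 := hc 2
  have hV2 : (1 + s) * (coneCoord s τ v 2 - (τ - v 2 / τ)) = s + v 1 / τ ^ 2 := by
    simp only [coneCoord, Matrix.cons_val]
    field_simp
    ring
  have hτp : 0 < τ ^ 2 := by positivity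
  have hy : v 1 = τ ^ 2 * ((1 + s) * (coneCoord s τ v 2 - (τ - v 2 / τ)) - s) := by
    rw [hV2]; field_simp; ring
  set w := τ - v 2 / τ
  generalize coneCoord s τ v = V at *
  have hlow : -(τ * (1 + R)) ≤ τ ^ 2 * (V 2 - w) := by nlinarith
  have hup : τ ^ 2 * (V 2 - w) ≤ τ * (3 + 2 * R) := by
    -- The other two coordinates are nonnegative, so V 2 is at most the sum 1 + 3w.
    have : τ ^ 2 * (V 2 - w) ≤ τ ^ 2 * (1 + 2 * w) := mul_le_mul_of_nonneg_left (by linarith) hτp.le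
    nlinarith
  have : |v 1| ≤ τ * ((1 + s) * (3 + 2 * R) + s) := by
    have e : v 1 = (1 + s) * (τ ^ 2 * (V 2 - w)) - s * τ ^ 2 := by rw [hy]; ring
    have m1 := mul_le_mul_of_nonneg_left hup (show 0 ≤ 1 + s by linarith)
    have m2 := mul_le_mul_of_nonneg_left hlow (show 0 ≤ 1 + s by linarith)
    have m3 : s * τ ^ 2 ≤ τ * s := by
      have : τ ^ 2 ≤ τ := by nlinarith
      linarith [mul_le_mul_of_nonneg_left this hs.le]
    have m4 : 0 ≤ s * τ ^ 2 := by positivity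
    have m5 : 0 ≤ (1 + s) * (τ * R) := by positivity
    have m6 : 0 ≤ (1 + s) * τ := by positivity
    rw [e, abs_le]
    constructor <;> nlinarith
  linarith

end Scaled

theorem IsCompact.exists_abs_le {K : Set (Fin 3 → ℝ)} (hK : IsCompact K) :
    ∃ R, ∀ v ∈ K, ∀ k, |v k| ≤ R := by
  obtain ⟨R, hR⟩ := isBounded_iff_forall_norm_le.1 hK.isBounded
  exact ⟨R, fun v hv k => (norm_le_pi_norm v k).trans (hR v hv)⟩

theorem continuous_ofConeCoord {s : ℝ} {V : ℝ → Fin 3 → ℝ} (hV : Continuous V) :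
    Continuous fun τ => ofConeCoord s τ (V τ) := by
  have h : ∀ k, Continuous fun τ => V τ k := fun k => (continuous_apply k).comp hV
  have h0 := h 0
  have h1 := h 1
  have h2 := h 2
  refine continuous_pi fun k => ?_
  fin_cases k
  · change Continuous fun τ => V τ 1 - V τ 0
    fun_prop
  · change Continuous fun τ : ℝ => τ ^ 2 * (1 - 2 * s) / 3 - τ ^ 2 * (1 + s) / 3 * (V τ 0 + V τ 1) +
      τ ^ 2 * (2 + 2 * s) / 3 * V τ 2
    fun_prop
  · change Continuous fun τ : ℝ => τ ^ 2 + τ / 3 - τ / 3 * (V τ 0 + V τ 1 + V τ 2)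
    fun_prop

theorem continuous_cyc {i : Fin 3} {x y z : ℝ → ℝ} (hx : Continuous x) (hy : Continuous y)
    (hz : Continuous z) : Continuous fun τ => cyc i (x τ) (y τ) (z τ) := by
  refine continuous_pi fun k => ?_
  unfold cyc
  split_ifs <;> assumption

section

variable {p₀ : E3} {e : Module.Basis (Fin 3) ℝ E3}

theorem axis_mem {W : Set E3} (hW : Convex ℝ W) {c : ℝ} (hc : 0 < c)
    (h1 : p₀ + c • e 0 ∈ W) (h2 : p₀ - c • e 0 ∈ W) {v : Fin 3 → ℝ} (hv0 : |v 0| ≤ c)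
    (hv1 : v 1 = 0) (hv2 : v 2 = 0) : framePt p₀ e v ∈ W := by
  obtain ⟨ha, hb⟩ := abs_le.1 hv0
  have := hW h1 h2 (a := (1 + v 0 / c) / 2) (b := (1 - v 0 / c) / 2)
    (by have : -1 ≤ v 0 / c := by rw [le_div_iff₀ hc]; linarith
        linarith)
    (by have : v 0 / c ≤ 1 := by rw [div_le_one hc]; linarith
        linarith) (by ring)
  convert this using 1
  simp only [framePt, Fin.sum_univ_three, hv1, hv2, zero_smul, add_zero]
  match_scalars <;> field_simp <;> ring

/-- At τ = 0 only the axis coordinate V 1 - V 0 survives, so the point tends to the axis segment,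
which lies in the convex open set W. -/
theorem eventually_ofConeCoord_mem {W : Set E3} (hWo : IsOpen W) (hWc : Convex ℝ W) {s : ℝ}
    (hs : 0 < s) (h1 : p₀ + (1 + 3 * s) • e 0 ∈ W) (h2 : p₀ - (1 + 3 * s) • e 0 ∈ W)
    {V : ℝ → Fin 3 → ℝ} (hV : Continuous V) (hV0 : |V 0 1 - V 0 0| ≤ 1 + 3 * s) :
    ∀ᶠ τ in 𝓝[>] (0 : ℝ), framePt p₀ e (ofConeCoord s τ (V τ)) ∈ W := by
  have hc := (continuous_framePt p₀ e).comp (continuous_ofConeCoord (s := s) hV)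
  refine (hc.continuousAt.eventually_mem (hWo.mem_nhds ?_)).filter_mono nhdsWithin_le_nhds
  exact axis_mem hWc (by linarith) h1 h2 (by simpa [ofConeCoord] using hV0)
    (by simp [ofConeCoord]) (by simp [ofConeCoord])

/-- Off the axis direction nothing diverges because v 1 = 0, whereas -v 2 / τ tends to infinity. -/
theorem eventually_coneCoord_pos {s : ℝ} {v : Fin 3 → ℝ} (h1 : v 1 = 0)
    (h2 : v 2 < 0) : ∀ᶠ τ in 𝓝[>] (0 : ℝ), ∀ k, 0 < coneCoord s τ v k := by
  have key : ∀ u : ℝ, ∀ᶠ τ in 𝓝[>] (0 : ℝ), 0 < u + τ - v 2 / τ := by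
    intro u
    have hc := eventually_pos_of_continuousAt (g := fun τ : ℝ => τ * u + τ ^ 2 - v 2)
      (by fun_prop) (by simpa using h2)
    filter_upwards [hc, self_mem_nhdsWithin] with τ hτ hτ0
    have hτ0 : 0 < τ := hτ0
    have : u + τ - v 2 / τ = (τ * u + τ ^ 2 - v 2) / τ := by field_simp
    rw [this]
    positivity
  rw [eventually_all]
  intro k
  fin_cases k
  · simpa [coneCoord, h1] using key (((1 - 0) / (1 + s) - v 0) / 2)
  · simpa [coneCoord, h1] using key (((1 - 0) / (1 + s) + v 0) / 2)
  · simpa [coneCoord, h1] using key ((s + 0) / (1 + s))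

/-- The vector is the point at height τ² of the line through the axis point x and v. It tends to the
axis point x, and the skylight cuts v 1 = 0 in the segment |v 0| ≤ 1/(1 + s). -/
theorem eventually_coneCoord_line_pos {s : ℝ} (hs : 0 < s) {x : ℝ} (hx : |x| * (1 + s) < 1)
    {v : Fin 3 → ℝ} : ∀ᶠ τ in 𝓝[>] (0 : ℝ), ∀ k,
      0 < coneCoord s τ ![x + τ ^ 2 / (-v 2) * (x - v 0), 0, τ ^ 2] k := by
  have hx1 : |x| < 1 / (1 + s) := by rw [lt_div_iff₀ (by linarith)]; exact hx
  obtain ⟨ha, hb⟩ := abs_lt.1 hx1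
  rw [eventually_all]
  have hz : ∀ τ : ℝ, 0 < τ → τ - τ ^ 2 / τ = 0 := fun τ hτ => by field_simp; ring
  intro k
  fin_cases k
  · have hc := eventually_pos_of_continuousAt
      (g := fun τ : ℝ => (1 / (1 + s) - (x + τ ^ 2 / (-v 2) * (x - v 0))) / 2)
      (by fun_prop) (by simp at hb ⊢; exact hb)
    filter_upwards [hc, self_mem_nhdsWithin] with τ hτ hτ0
    have := hz τ hτ0
    simp [coneCoord] at hτ ⊢
    linarith
  · have hc := eventually_pos_of_continuousAt
      (g := fun τ : ℝ => (1 / (1 + s) + (x + τ ^ 2 / (-v 2) * (x - v 0))) / 2)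
      (by fun_prop) (by simp at ha ⊢; linarith)
    filter_upwards [hc, self_mem_nhdsWithin] with τ hτ hτ0
    have := hz τ hτ0
    simp [coneCoord] at hτ ⊢
    linarith
  · filter_upwards [self_mem_nhdsWithin] with τ hτ0
    have := hz τ hτ0
    have h3 : 0 < s / (1 + s) := by positivity
    simp [coneCoord]
    linarith

/-- Cupolas with prescribed visibility cone properties, close to the segment with the end points
`p₀ ± (1 + 3 * s) • e 0` in the plane with third coordinate zero. -/
theorem exists_flat_cupola {m : ℕ} (hm : 1 ≤ m) (p₀ : E3) (e : Module.Basis (Fin 3) ℝ E3) {s : ℝ}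
    (hs : 0 < s) {W : Set E3} (hWo : IsOpen W) (hWc : Convex ℝ W)
    (h1 : p₀ + (1 + 3 * s) • e 0 ∈ W) (h2 : p₀ - (1 + 3 * s) • e 0 ∈ W)
    {K N : Set (Fin 3 → ℝ)} {S N' : Set (Fin 3 → ℝ)} {D : Set (ℝ × (Fin 3 → ℝ))}
    (hK : IsCompact K) (hK0 : ∀ v ∈ K, v 2 ≤ 0)
    (hN : IsCompact N) (hN0 : ∀ v ∈ N, v 1 ≠ 0)
    (hN' : ∀ v ∈ N', v 1 = 0 ∧ v 2 = 0 ∧ 1 + 3 * s ≤ |v 0|)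
    (hS : S.Finite) (hS0 : ∀ v ∈ S, v 1 = 0 ∧ v 2 < 0)
    (hD : D.Finite) (hD0 : ∀ d ∈ D, |d.1| * (1 + s) < 1 ∧ d.2 1 = 0 ∧ d.2 2 < 0) :
    ∃ C : Cupola m, (∀ x ∈ C.body, x ∈ W ∧ 0 < e.repr (x - p₀) 2) ∧
      (∀ v ∈ K, framePt p₀ e v ∈ beyond C.body C.bottom) ∧
      IsTriangularCone C.cone ∧ (∀ v ∈ S, framePt p₀ e v ∈ interior C.cone) ∧
      (∀ v ∈ N, framePt p₀ e v ∉ C.cone) ∧ (∀ v ∈ N', framePt p₀ e v ∉ C.cone) ∧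
      C.body.extremePoints ℝ ∩ C.cone = Set.range C.B ∧
      (∀ d ∈ D, ∀ g : AffineSubspace ℝ E3, p₀ + d.1 • e 0 ∈ g → framePt p₀ e d.2 ∈ g →
        Pierces g C.skylight) := by
  obtain ⟨R₁, hR₁⟩ := hK.exists_abs_le
  obtain ⟨R₂, hR₂⟩ := hN.exists_abs_le
  obtain ⟨ω, hω0, hω⟩ : ∃ ω > 0, ∀ v ∈ N, ω ≤ |v 1| :=
    hN.exists_forall_le' (f := fun v : Fin 3 → ℝ => |v 1|)
      (by fun_prop) (fun v hv => abs_pos.2 (hN0 v hv))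
  have ev : ∀ᶠ τ in 𝓝[>] (0 : ℝ), 0 < τ ∧ τ < 1 ∧ τ * (R₁ * (3 * s + 4)) < s ^ 2 ∧
      τ * ((1 + s) * (3 + 2 * R₂) + s) < ω ∧ τ < 3 * s / 2 ∧
      (∀ i, framePt p₀ e (ofConeCoord s τ (cyc i (1 + s + 3 * τ ^ 4) 0 (-s))) ∈ W) ∧
      (∀ i, framePt p₀ e (ofConeCoord s τ (cyc i 1 0 0)) ∈ W) ∧
      (∀ v ∈ S, ∀ k, 0 < coneCoord s τ v k) ∧
      (∀ d ∈ D, ∀ k, 0 < coneCoord s τ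
        ![d.1 + τ ^ 2 / (-d.2 2) * (d.1 - d.2 0), 0, τ ^ 2] k) := by
    have small : ∀ {A B : ℝ}, 0 < B → ∀ᶠ τ in 𝓝[>] (0 : ℝ), τ * A < B := fun {A B} hB =>
      (eventually_pos_of_continuousAt (g := fun τ : ℝ => B - τ * A) (by fun_prop)
        (by simpa using hB)).mono fun τ hτ => by linarith
    have small' : ∀ {B : ℝ}, 0 < B → ∀ᶠ τ in 𝓝[>] (0 : ℝ), τ < B := fun hB =>
      (small (A := 1) hB).mono fun τ hτ => by linarith
    rw [eventually_and]
    refine ⟨self_mem_nhdsWithin, ?_⟩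
    simp only [eventually_and]
    refine ⟨small' one_pos, small (by positivity), small hω0, small' (by positivity), ?_, ?_, ?_, ?_⟩
    · rw [eventually_all]
      intro i
      refine eventually_ofConeCoord_mem hWo hWc hs h1 h2
        (V := fun τ => cyc i (1 + s + 3 * τ ^ 4) 0 (-s))
        (continuous_cyc (by fun_prop) (by fun_prop) (by fun_prop)) ?_
      fin_cases i <;> simp [cyc] <;> rw [abs_le] <;> constructor <;> linarith
    · rw [eventually_all]
      intro i
      refine eventually_ofConeCoord_mem hWo hWc hs h1 h2 (V := fun τ => cyc i 1 0 0)
        continuous_const ?_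
      fin_cases i <;> simp [cyc] <;> linarith
    · rw [eventually_all_finite hS]
      exact fun v hv => eventually_coneCoord_pos (hS0 v hv).1 (hS0 v hv).2
    · rw [eventually_all_finite hD]
      exact fun d hd => eventually_coneCoord_line_pos hs (hD0 d hd).1
  obtain ⟨τ, hτ, hτ1, hτR, hτω, hτs, hA, hB, hSτ, hDτ⟩ := ev.exists
  set r := coneApex p₀ e s τ with hr
  set bs := coneBasis e hs hτ with hbs
  have hτ4 : τ ^ 4 < τ := by
    have := pow_lt_pow_right_of_lt_one₀ hτ hτ1 (show 1 < 4 by norm_num)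
    simpa using this
  have hcoord : ∀ v, framePt p₀ e v = framePt r bs (coneCoord s τ v) := fun v =>
    (framePt_coneCoord p₀ e hs hτ v).symm
  -- Adding the open half-space above the facet plane to W makes the model construction also deliver
  -- positive height.
  let W' : Set E3 := W ∩ {x | frameLin e ![0, 0, 1] p₀ < frameLin e ![0, 0, 1] x}
  have hW'o : IsOpen W' := hWo.inter (isOpen_lt continuous_const (frameLin e _).continuous)
  have hW'c : Convex ℝ W' := hWc.inter (convex_halfSpace_gt (frameLin e _).isLinear _)
  have hW'mem : ∀ V, framePt p₀ e (ofConeCoord s τ V) ∈ W → V 0 + V 1 + V 2 < 1 + 3 * τ →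
      V ∈ framePt r bs ⁻¹' W' := by
    intro V hV hsum
    rw [Set.mem_preimage, framePt_cone]
    refine ⟨hV, ?_⟩
    rw [Set.mem_ofPred_eq, frameLin_framePt]
    simp [ofConeCoord, dotProduct, Fin.sum_univ_three]
    have := mul_pos hτ (sub_pos.2 hsum)
    linarith
  -- Since a - b = 1 + 3τ⁴, the bottom lies at height τ² - τ⁵.
  obtain ⟨M, hMa, hMb, hMN, hMK⟩ := exists_cupolaModel (m := m) hm (a := 1 + s + 3 * τ ^ 4) (b := s)
    hs (by have : 0 < τ ^ 4 := by positivity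
           linarith)
    (hK.image (continuous_coneCoord s τ)) (hW'o.preimage (continuous_framePt r bs))
    (convex_preimage_framePt r bs hW'c)
    (fun i => hW'mem _ (hA i) (by fin_cases i <;> simp [cyc] <;> linarith))
    (fun i => hW'mem _ (hB i) (by fin_cases i <;> simp [cyc] <;> linarith))
    (by rintro _ ⟨v, hv, rfl⟩
        exact (coneCoord_facet hs hτ hτ1 hτR (hR₁ v hv 0) (hR₁ v hv 1) (hK0 v hv)).1)
    (by rintro _ ⟨v, hv, rfl⟩
        exact (coneCoord_facet hs hτ hτ1 hτR (hR₁ v hv 0) (hR₁ v hv 1) (hK0 v hv)).2.1)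
    (by rintro _ ⟨v, hv, rfl⟩
        exact (coneCoord_facet hs hτ hτ1 hτR (hR₁ v hv 0) (hR₁ v hv 1) (hK0 v hv)).2.2)
  have hcone := M.cone_toCupola r bs
  have hnot : ∀ v, (∃ k, coneCoord s τ v k < 0) → framePt p₀ e v ∉ (M.toCupola r bs).cone := by
    rintro v ⟨k, hk⟩ hmem
    rw [hcone, hcoord] at hmem
    have := hmem k
    rw [congrFun (repr_framePt_sub r bs _) k] at this
    linarith
  refine ⟨M.toCupola r bs, ?_, ?_, ?_, ?_, ?_, ?_, ?_, ?_⟩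
  · intro x hx
    have hsub : (M.toCupola r bs).body ⊆ W' := by
      refine convexHull_min ?_ hW'c
      rintro _ ⟨y, rfl⟩
      exact hMN y
    obtain ⟨hxW, hxz⟩ := hsub hx
    refine ⟨hxW, ?_⟩
    have h3 : 0 < frameLin e ![0, 0, 1] (x - p₀) := by
      rw [map_sub]; exact sub_pos.2 hxz
    rw [frameLin_apply] at h3
    simpa [dotProduct, Fin.sum_univ_three] using h3
  · intro v hv
    rw [hcoord]
    obtain ⟨h3, h4⟩ := hMK _ ⟨v, hv, rfl⟩
    exact M.mem_beyond_bottom r bs h3 h4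
  · rw [hcone]; exact isTriangularCone_frame r bs
  · intro v hv
    rw [hcone]
    refine subset_interior_frame r bs fun k => ?_
    rw [hcoord, congrFun (repr_framePt_sub r bs _) k]
    exact hSτ v hv k
  · intro v hv
    exact hnot v (exists_coneCoord_neg hs hτ hτ1 hτω (hω v hv) (hR₂ v hv 2))
  · intro v hv
    obtain ⟨v1, v2, v0⟩ := hN' v hv
    refine hnot v ?_
    -- On the axis the cone ends at |v 0| = 1/(1 + s) + 2τ, which is less than 1 + 3s because τ <
    -- 3s/2.
    have h3 : 1 / (1 + s) < 1 := by rw [div_lt_one (by linarith)]; linarith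
    rcases le_abs.1 v0 with h | h
    · refine ⟨0, ?_⟩
      simp [coneCoord, v1, v2] at h3 ⊢
      linarith
    · refine ⟨1, ?_⟩
      simp [coneCoord, v1, v2] at h3 ⊢
      linarith
  · rw [M.body_toCupola, M.extremePoints_eq]
    exact M.range_inter_cone r bs
  · rintro ⟨x, v⟩ hd g hg1 hg2
    obtain ⟨-, v1, v2⟩ := hD0 _ hd
    have hpos := hDτ _ hd
    simp only at hpos v1 v2 hg1 hg2
    set y : Fin 3 → ℝ := ![x + τ ^ 2 / (-v 2) * (x - v 0), 0, τ ^ 2] with hy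
    have hsumy : ∑ k, coneCoord s τ y k = 1 := by
      rw [Fin.sum_univ_three, sum_coneCoord hs]
      have : y 2 = τ ^ 2 := rfl
      rw [this]
      field_simp
      ring
    constructor
    · refine ⟨framePt p₀ e y, ?_, ?_⟩
      · have h3 := AffineMap.lineMap_mem (1 + τ ^ 2 / (-v 2)) hg2 hg1
        have v2' : v 2 ≠ 0 := v2.ne
        suffices h4 : framePt p₀ e y = AffineMap.lineMap (framePt p₀ e v) (p₀ + x • e 0)
            (1 + τ ^ 2 / (-v 2)) by
          rw [h4]; exact h3
        rw [AffineMap.lineMap_apply]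
        simp only [framePt, Fin.sum_univ_three, hy, v1, vsub_eq_sub, vadd_eq_add,
          Matrix.cons_val_zero, Matrix.cons_val_one, Matrix.cons_val]
        match_scalars <;> field_simp <;> ring
      · rw [hcoord]
        exact framePt_mem_intrinsicInterior r bs hpos hsumy
    · intro hle
      have h3 := sum_repr_of_mem_affineSpan r bs (hle hg2)
      rw [hcoord, repr_framePt_sub, Fin.sum_univ_three, sum_coneCoord hs] at h3
      have : v 2 / τ < 0 := div_neg_of_neg_of_pos v2 hτ
      linarith

end

/-! ### Frames adapted to a facet and a plane -/

theorem exists_apply_eq_one {f : E3 →L[ℝ] ℝ} {D : Submodule ℝ E3}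
    (hD : ¬ D ≤ LinearMap.ker (f : E3 →ₗ[ℝ] ℝ)) : ∃ u ∈ D, f u = 1 := by
  obtain ⟨u, hu, hfu⟩ := SetLike.not_le_iff_exists.1 hD
  have hfu : f u ≠ 0 := hfu
  exact ⟨(f u)⁻¹ • u, D.smul_mem _ hu, by simp [hfu]⟩

theorem exists_basis_of_linearIndependent {a₀ a₁ a₂ : E3} (h : LinearIndependent ℝ ![a₀, a₁, a₂]) :
    ∃ e : Module.Basis (Fin 3) ℝ E3, e 0 = a₀ ∧ e 1 = a₁ ∧ e 2 = a₂ := by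
  refine ⟨basisOfLinearIndependentOfCardEqFinrank h (by simp), ?_⟩
  rw [coe_basisOfLinearIndependentOfCardEqFinrank]
  exact ⟨rfl, rfl, rfl⟩

theorem repr_expand (e : Module.Basis (Fin 3) ℝ E3) (x : E3) :
    x = e.repr x 0 • e 0 + e.repr x 1 • e 1 + e.repr x 2 • e 2 := by
  conv_lhs => rw [← e.sum_repr x, Fin.sum_univ_three]

theorem repr_of_expand (e : Module.Basis (Fin 3) ℝ E3) {x : E3} {a b c : ℝ}
    (h : x = a • e 0 + b • e 1 + c • e 2) :
    e.repr x 0 = a ∧ e.repr x 1 = b ∧ e.repr x 2 = c := by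
  have h1 : x = ∑ k, (![a, b, c] : Fin 3 → ℝ) k • e k := by
    rw [h, Fin.sum_univ_three]; rfl
  have h2 : ⇑(e.repr x) = ![a, b, c] := by rw [h1]; exact e.repr_sum_self _
  rw [h2]
  exact ⟨rfl, rfl, rfl⟩

/-- A frame adapted to a plane `H` through `p₀` that is transversal to the level sets of `f`. -/
theorem exists_frame_of_transversal {f : E3 →L[ℝ] ℝ} (hf : f ≠ 0) {H : AffineSubspace ℝ E3}
    (hH : IsPlane H) {p₀ : E3} (hp₀ : p₀ ∈ H)
    (hHf : ¬ H.direction ≤ LinearMap.ker (f : E3 →ₗ[ℝ] ℝ)) :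
    ∃ e : Module.Basis (Fin 3) ℝ E3, f (e 0) = 0 ∧ f (e 1) = 0 ∧ f (e 2) = 1 ∧
      ∀ p, e.repr (p - p₀) 1 = 0 ↔ p ∈ H := by
  set D := H.direction with hD
  set N := LinearMap.ker (f : E3 →ₗ[ℝ] ℝ) with hN
  have hNr : Module.finrank ℝ N = 2 := finrank_ker_two hf
  have hDr : Module.finrank ℝ D = 2 := hH.2
  obtain ⟨a₂, ha₂, hfa₂⟩ := exists_apply_eq_one hHf
  have hND : ¬ N ≤ D := fun hle => hHf (Submodule.eq_of_le_of_finrank_eq hle (hNr.trans hDr.symm)).ge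
  obtain ⟨a₁, ha₁, ha₁'⟩ := SetLike.not_le_iff_exists.1 hND
  -- Two planes through the origin of a three-dimensional space share a line.
  obtain ⟨a₀, ha₀, ha₀'⟩ : ∃ a₀ ∈ D ⊓ N, a₀ ≠ 0 := by
    by_contra! hc
    have hbot : D ⊓ N = ⊥ := (Submodule.eq_bot_iff _).2 hc
    have h1 := Submodule.finrank_sup_add_finrank_inf_eq D N
    rw [hbot, finrank_bot, hNr, hDr] at h1
    have h2 : Module.finrank ℝ (D ⊔ N : Submodule ℝ E3) ≤ 3 := (Submodule.finrank_le _).trans_eq finrank_E3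
    omega
  have hfa₀ : f a₀ = 0 := ha₀.2
  have hfa₁ : f a₁ = 0 := ha₁
  have hcoef : ∀ {x y z : ℝ}, x • a₀ + y • a₁ + z • a₂ ∈ D → y = 0 := by
    intro x y z h
    have h1 : y • a₁ ∈ D := by
      have := D.sub_mem h (D.add_mem (D.smul_mem x ha₀.1) (D.smul_mem z ha₂))
      convert this using 1
      module
    by_contra hy
    exact ha₁' ((D.smul_mem_iff hy).1 h1)
  have hli : LinearIndependent ℝ ![a₀, a₁, a₂] := by
    rw [Fintype.linearIndependent_iff]
    intro g hg
    simp only [Fin.sum_univ_three, Matrix.cons_val_zero, Matrix.cons_val_one,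
      Matrix.cons_val] at hg
    have g1 : g 1 = 0 := hcoef (hg ▸ D.zero_mem)
    have g2 : g 2 = 0 := by
      have := congrArg f hg
      simpa [hfa₀, hfa₁, hfa₂] using this
    have g0 : g 0 = 0 := by
      rw [g1, g2] at hg
      simpa [ha₀'] using hg
    intro i; fin_cases i <;> assumption
  obtain ⟨e, rfl, rfl, rfl⟩ := exists_basis_of_linearIndependent hli
  refine ⟨e, hfa₀, hfa₁, hfa₂, fun p => ?_⟩
  have hx := repr_expand e (p - p₀)
  have hmem : p ∈ H ↔ p - p₀ ∈ D := by
    rw [hD, ← vsub_eq_sub, AffineSubspace.vsub_right_mem_direction_iff_mem hp₀]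
  rw [hmem]
  constructor
  · intro h
    rw [hx, h]
    exact D.add_mem (D.add_mem (D.smul_mem _ ha₀.1) (by simp)) (D.smul_mem _ ha₂)
  · intro h
    rw [hx] at h
    exact hcoef h

/-- A frame whose second coordinate does not vanish on a compact set strictly below the facet. -/
theorem exists_frame_of_compact {f : E3 →L[ℝ] ℝ} (hf : f ≠ 0) (p₀ : E3) {N : Set E3}
    (hN : IsCompact N) (hNf : ∀ p ∈ N, f p < f p₀) :
    ∃ e : Module.Basis (Fin 3) ℝ E3, f (e 0) = 0 ∧ f (e 1) = 0 ∧ f (e 2) = 1 ∧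
      ∀ p ∈ N, e.repr (p - p₀) 1 ≠ 0 := by
  obtain ⟨a₂, -, hfa₂⟩ := exists_apply_eq_one (f := f) (D := ⊤) (fun h => hf (by
    ext x
    exact h (Submodule.mem_top (x := x))))
  let b := Module.finBasisOfFinrankEq ℝ (LinearMap.ker (f : E3 →ₗ[ℝ] ℝ)) (finrank_ker_two hf)
  have hb : ∀ i, f (b i : E3) = 0 := fun i => (b i).2
  have hli : ∀ t : ℝ, LinearIndependent ℝ ![(b 0 : E3), (b 1 : E3), a₂ + t • (b 1 : E3)] := by
    intro t
    rw [Fintype.linearIndependent_iff]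
    intro g hg
    simp only [Fin.sum_univ_three, Matrix.cons_val_zero, Matrix.cons_val_one,
      Matrix.cons_val] at hg
    have g2 : g 2 = 0 := by
      have := congrArg f hg
      simpa [hb, hfa₂] using this
    rw [g2, zero_smul, add_zero] at hg
    have h2 : ∑ i, (![g 0, g 1] : Fin 2 → ℝ) i • b i = 0 := by
      apply Subtype.ext
      simpa [Fin.sum_univ_two] using hg
    have h3 := Fintype.linearIndependent_iff.1 b.linearIndependent _ h2
    have g0 : g 0 = 0 := h3 0
    have g1 : g 1 = 0 := h3 1
    intro i; fin_cases i <;> assumption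
  obtain ⟨e, he0, he1, he2⟩ := exists_basis_of_linearIndependent (hli 0)
  have hYc : Continuous fun p : E3 => e.repr (p - p₀) 1 :=
    (continuous_apply 1).comp (continuous_frame_repr p₀ e)
  obtain ⟨R, hR⟩ := (hN.image hYc).isBounded.exists_norm_le
  obtain ⟨ζ, hζ0, hζ⟩ := hN.exists_forall_le' (f := fun p => f p₀ - f p) (a := 0)
    (by fun_prop) (fun p hp => by linarith [hNf p hp])
  -- The shear by t changes coordinate 1 from y to y - t z. On N the height satisfies z ≤ -ζ, so the
  -- added term exceeds |y|.
  set t := (|R| + 1) / ζ with ht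
  obtain ⟨e', he0', he1', he2'⟩ := exists_basis_of_linearIndependent (hli t)
  refine ⟨e', by rw [he0', hb], by rw [he1', hb], by simp [he2', hb, hfa₂], fun p hp => ?_⟩
  have hx := repr_expand e (p - p₀)
  set x := e.repr (p - p₀) 0
  set y := e.repr (p - p₀) 1 with hy
  set z := e.repr (p - p₀) 2
  have hfz : f p - f p₀ = z := by
    have := congrArg f hx
    simpa [he0, he1, he2, hb, hfa₂] using this
  have hx' : p - p₀ = x • e' 0 + (y - t * z) • e' 1 + z • e' 2 := by
    rw [hx, he0, he1, he2, he0', he1', he2']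
    module
  rw [(repr_of_expand e' hx').2.1]
  have h1 : |y| ≤ |R| := (hR _ ⟨p, hp, rfl⟩).trans (le_abs_self R)
  have h2 := hζ p hp
  have h3 : t * ζ = |R| + 1 := div_mul_cancel₀ _ hζ0.ne'
  have h4 : 0 ≤ t := by positivity
  have h5 : t * ζ ≤ t * (-z) := mul_le_mul_of_nonneg_left (by linarith) h4
  have h6 := (abs_le.1 h1).1
  intro h7
  nlinarith

/-- The frame used to attach a cupola to the facet `F` at the plane `H`. -/
theorem exists_frame {P F : Set E3} {f : E3 →L[ℝ] ℝ} {c : ℝ} (hfull : vectorSpan ℝ P = ⊤)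
    (hF : IsFacetIneq P F f c) {H : AffineSubspace ℝ E3} (hH : IsPlane H)
    (hHF : ((H : Set E3) ∩ intrinsicInterior ℝ F).Nonempty) {N : Set E3} (hN : IsCompact N)
    (hNf : ∀ p ∈ N, f p ≤ c) (hNH : ∀ p ∈ N, f p = c → p ∉ H) :
    ∃ (p₀ : E3) (e : Module.Basis (Fin 3) ℝ E3), p₀ ∈ intrinsicInterior ℝ F ∧
      f (e 0) = 0 ∧ f (e 1) = 0 ∧ f (e 2) = 1 ∧ (∀ p ∈ N, e.repr (p - p₀) 1 = 0 → p ∈ H) ∧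
      ((∀ p ∈ H, e.repr (p - p₀) 1 = 0) ∨ ∀ p ∈ H, f p = c) := by
  obtain ⟨p₀, hp₀H, hp₀⟩ := hHF
  have hf := hF.ne_zero hfull
  have hfp₀ : f p₀ = c := by
    have := intrinsicInterior_subset hp₀
    rw [hF.2.1] at this
    exact this.2
  -- If H is the plane of F itself, no vertex off F lies in H and nothing has to be seen; a frame
  -- whose coordinate 1 vanishes nowhere on N then suffices.
  by_cases hdeg : H.direction ≤ LinearMap.ker (f : E3 →ₗ[ℝ] ℝ)
  · have hHc : ∀ p, p ∈ H ↔ f p = c := by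
      have heq := Submodule.eq_of_le_of_finrank_eq hdeg (hH.2.trans (finrank_ker_two hf).symm)
      intro p
      rw [← AffineSubspace.vsub_right_mem_direction_iff_mem hp₀H, heq, LinearMap.mem_ker,
        vsub_eq_sub, ContinuousLinearMap.coe_coe, map_sub, hfp₀, sub_eq_zero]
    have hlt : ∀ p ∈ N, f p < f p₀ := fun p hp => by
      rw [hfp₀]
      exact (hNf p hp).lt_of_ne fun h => hNH p hp h ((hHc p).2 h)
    obtain ⟨e, h0, h1, h2, h3⟩ := exists_frame_of_compact hf p₀ hN hlt
    exact ⟨p₀, e, hp₀, h0, h1, h2, fun p hp h => absurd h (h3 p hp), Or.inr fun p => (hHc p).1⟩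
  · obtain ⟨e, h0, h1, h2, h3⟩ := exists_frame_of_transversal hf hH hp₀H hdeg
    exact ⟨p₀, e, hp₀, h0, h1, h2, fun p _ => (h3 p).1, Or.inl fun p => (h3 p).2⟩

/-- Finitely many relative interior points on an axis lie strictly between two others. -/
theorem exists_axis_interval {F : Set E3} {p₀ u : E3} (hu : u ∈ vectorSpan ℝ F) {X : Set ℝ}
    (hX : X.Finite) (hXF : ∀ x ∈ X, p₀ + x • u ∈ intrinsicInterior ℝ F)
    (hp₀ : p₀ ∈ intrinsicInterior ℝ F) :
    ∃ a b : ℝ, a < b ∧ (∀ x ∈ X, a < x ∧ x < b) ∧ p₀ + a • u ∈ intrinsicInterior ℝ F ∧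
      p₀ + b • u ∈ intrinsicInterior ℝ F := by
  -- Inserting 0, the position of p₀, also covers the case without prescribed lines.
  have hX' := hX.insert 0
  have hXF' : ∀ x ∈ insert 0 X, p₀ + x • u ∈ intrinsicInterior ℝ F := by
    rintro x (rfl | hx)
    · simpa using hp₀
    · exact hXF x hx
  have hne : (insert 0 X).Nonempty := ⟨0, Set.mem_insert _ _⟩
  obtain ⟨x₁, hx₁, hmin⟩ := Set.exists_min_image _ id hX' hne
  obtain ⟨x₂, hx₂, hmax⟩ := Set.exists_max_image _ id hX' hne
  have pos : ∃ᶠ t : ℝ in 𝓝 0, 0 < t :=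
    (eventually_mem_nhdsWithin (s := Set.Ioi (0 : ℝ))).frequently.filter_mono nhdsWithin_le_nhds
  have step : ∀ v ∈ vectorSpan ℝ F, ∀ x ∈ insert 0 X, ∃ t : ℝ, 0 < t ∧
      p₀ + x • u + t • v ∈ intrinsicInterior ℝ F := fun v hv x hx =>
    (pos.and_eventually (eventually_add_smul_mem_intrinsicInterior (hXF' x hx) hv)).exists
  obtain ⟨t₁, ht₁, h₁⟩ := step (-u) (Submodule.neg_mem _ hu) x₁ hx₁
  obtain ⟨t₂, ht₂, h₂⟩ := step u hu x₂ hx₂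
  refine ⟨x₁ - t₁, x₂ + t₂, ?_, fun x hx => ?_, ?_, ?_⟩
  · have := hmin x₂ hx₂
    simp only [id] at this
    linarith
  · have h3 := hmin x (Set.mem_insert_of_mem _ hx)
    have h4 := hmax x (Set.mem_insert_of_mem _ hx)
    simp only [id] at h3 h4
    constructor <;> linarith
  · convert h₁ using 1; module
  · convert h₂ using 1; module

/-- A cupola attached to one facet. -/
theorem exists_local_cupola {P F : Set E3} {f : E3 →L[ℝ] ℝ} {c : ℝ} (hP : IsPolytope3 P)
    (hF : IsFacetIneq P F f c) {H : AffineSubspace ℝ E3} {p₀ : E3}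
    {e : Module.Basis (Fin 3) ℝ E3} (hp₀ : p₀ ∈ intrinsicInterior ℝ F)
    (hf0 : f (e 0) = 0) (hf1 : f (e 1) = 0) (hf2 : f (e 2) = 1)
    (hYv : ∀ v ∈ P.extremePoints ℝ, v ∉ F → e.repr (v - p₀) 1 = 0 → v ∈ H)
    (hYH : (∀ p ∈ H, e.repr (p - p₀) 1 = 0) ∨ ∀ p ∈ H, f p = c)
    {L : Set (AffineSubspace ℝ E3)} (hLfin : L.Finite)
    (hL : ∀ g ∈ L, IsLine g ∧ g ≤ H ∧ Pierces g F ∧ ∃ v ∈ verticesOff P F H, v ∈ g)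
    {m : ℕ} (hm : 1 ≤ m) {W K N : Set E3} (hWo : IsOpen W) (hWc : Convex ℝ W)
    (hWF : intrinsicInterior ℝ F ⊆ W) (hK : IsCompact K) (hKf : ∀ p ∈ K, f p ≤ c)
    (hN : IsCompact N) (hNY : ∀ p ∈ N, e.repr (p - p₀) 1 ≠ 0) :
    ∃ C : Cupola m, (∀ x ∈ C.body, x ∈ W ∧ c < f x) ∧ K ⊆ beyond C.body C.bottom ∧
      IsTriangularCone C.cone ∧ verticesOff P F H ⊆ interior C.cone ∧
      (∀ p ∈ N, p ∉ C.cone) ∧ (∀ p ∈ P.extremePoints ℝ, p ∈ C.cone → p ∈ verticesOff P F H) ∧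
      C.body.extremePoints ℝ ∩ C.cone = Set.range C.B ∧ ∀ g ∈ L, Pierces g C.skylight := by
  have hfull := vectorSpan_eq_top_of_interior hP.2
  have hfF : ∀ x ∈ F, f x = c := fun x hx => by rw [hF.2.1] at hx; exact hx.2
  have hfP : ∀ x ∈ P, f x = c → x ∈ F := fun x hx h => by rw [hF.2.1]; exact ⟨hx, h⟩
  have hFP : F ⊆ P := fun x hx => by rw [hF.2.1] at hx; exact hx.1
  have hvfin : (P.extremePoints ℝ).Finite := by
    obtain ⟨⟨s, hs, rfl⟩, -⟩ := hP
    exact hs.subset extremePoints_convexHull_subset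
  have hfp₀ : f p₀ = c := hfF _ (intrinsicInterior_subset hp₀)
  have hoffY : ∀ v ∈ verticesOff P F H, e.repr (v - p₀) 1 = 0 ∧ f v < c := by
    rintro v ⟨⟨hv, hvH⟩, hvF⟩
    have hvP := extremePoints_subset hv
    have hlt : f v < c := (hF.1 v hvP).lt_of_ne fun h => hvF (hfP v hvP h)
    refine ⟨?_, hlt⟩
    rcases hYH with h | h
    · exact h v hvH
    · exact absurd (h v hvH) hlt.ne
  have hu : e 0 ∈ vectorSpan ℝ F := by
    rw [vectorSpan_eq_ker (hF.ne_zero hfull) hfF hF.2.2]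
    exact hf0
  have hlines : ∀ g ∈ L, ∃ (x : ℝ) (v : E3), v ∈ verticesOff P F H ∧ v ∈ g ∧
      p₀ + x • e 0 ∈ g ∧ p₀ + x • e 0 ∈ intrinsicInterior ℝ F := by
    intro g hg
    obtain ⟨-, hgH, ⟨⟨q, hqg, hqF⟩, -⟩, v, hv, hvg⟩ := hL g hg
    have hY0 : ∀ p ∈ H, e.repr (p - p₀) 1 = 0 := by
      rcases hYH with h | h
      · exact h
      · exact absurd (h v hv.1.2) (hoffY v hv).2.ne
    have hx := repr_expand e (q - p₀)
    have hq2 : e.repr (q - p₀) 2 = 0 := by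
      have := congrArg f hx
      have hfq := hfF q (intrinsicInterior_subset hqF)
      simpa [hf0, hf1, hf2, hfq, hfp₀] using this.symm
    rw [hY0 q (hgH hqg), hq2, zero_smul, zero_smul, add_zero, add_zero] at hx
    generalize e.repr (q - p₀) 0 = x at hx
    obtain rfl : p₀ + x • e 0 = q := by rw [← hx]; abel
    exact ⟨x, v, hv, hvg, hqg, hqF⟩
  choose! xg vg hvg hvgg hxgg hxgF using hlines
  obtain ⟨a, b, hab, hXab, haF, hbF⟩ := exists_axis_interval hu (hLfin.image xg)
    (by rintro _ ⟨g, hg, rfl⟩; exact hxgF g hg) hp₀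
  set t := (a + b) / 2 with ht
  set ℓ := (b - a) / 2 with hℓ
  have hℓ0 : 0 < ℓ := by rw [hℓ]; linarith
  -- The interval is rescaled to half-length 1 + 3s, and the piercing points must then lie within
  -- 1/(1 + s) of the centre; both factors tend to 1 with s.
  obtain ⟨s, hs, hsg⟩ : ∃ s : ℝ, 0 < s ∧ ∀ g ∈ L, |xg g - t| * ((1 + s) * (1 + 3 * s)) < ℓ := by
    have hev : ∀ᶠ s in 𝓝[>] (0 : ℝ), ∀ g ∈ L, |xg g - t| * ((1 + s) * (1 + 3 * s)) < ℓ := by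
      rw [eventually_all_finite hLfin]
      intro g hg
      have hx := hXab _ ⟨g, hg, rfl⟩
      have hlt : |xg g - t| < ℓ := by rw [abs_lt]; constructor <;> linarith
      exact (eventually_pos_of_continuousAt
        (g := fun s : ℝ => ℓ - |xg g - t| * ((1 + s) * (1 + 3 * s))) (by fun_prop)
        (by simpa using hlt)).mono fun s hs => by linarith
    obtain ⟨s, hs, h⟩ := (hev.and self_mem_nhdsWithin).exists
    exact ⟨s, h, hs⟩
  set lam := ℓ / (1 + 3 * s) with hlam
  have hlam0 : 0 < lam := by positivity
  have hlame : (1 + 3 * s) * lam = ℓ := by rw [hlam]; field_simp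
  obtain ⟨e', he0, he1, he2⟩ := exists_basis_of_linearIndependent
    (a₀ := lam • e 0) (a₁ := e 1) (a₂ := e 2) (by
      rw [Fintype.linearIndependent_iff]
      intro g hg
      simp only [Fin.sum_univ_three, Matrix.cons_val_zero, Matrix.cons_val_one,
        Matrix.cons_val] at hg
      have h2 : ∑ k, (![g 0 * lam, g 1, g 2] : Fin 3 → ℝ) k • e k = 0 := by
        rw [← hg, Fin.sum_univ_three]
        simp [mul_smul]
      have h3 := Fintype.linearIndependent_iff.1 e.linearIndependent _ h2
      have g0 : g 0 = 0 := (mul_eq_zero.1 (h3 0)).resolve_right hlam0.ne'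
      have g1 : g 1 = 0 := h3 1
      have g2 : g 2 = 0 := h3 2
      intro i; fin_cases i <;> assumption)
  set p₁ := p₀ + t • e 0 with hp₁
  have hcoord : ∀ p, e'.repr (p - p₁) 0 = (e.repr (p - p₀) 0 - t) / lam ∧
      e'.repr (p - p₁) 1 = e.repr (p - p₀) 1 ∧ e'.repr (p - p₁) 2 = f p - c := by
    intro p
    have hx := repr_expand e (p - p₀)
    have hz : e.repr (p - p₀) 2 = f p - c := by
      have := congrArg f hx
      simpa [hf0, hf1, hf2, hfp₀] using this.symm
    rw [← hz]
    refine repr_of_expand e' ?_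
    rw [he0, he1, he2, hp₁, ← sub_sub, smul_smul, div_mul_cancel₀ _ hlam0.ne']
    conv_lhs => rw [hx]
    module
  have hend1 : p₁ + (1 + 3 * s) • e' 0 = p₀ + b • e 0 := by
    rw [he0, smul_smul, hlame, hp₁, ht, hℓ]; module
  have hend2 : p₁ - (1 + 3 * s) • e' 0 = p₀ + a • e 0 := by
    rw [he0, smul_smul, hlame, hp₁, ht, hℓ]; module
  let crd : E3 → Fin 3 → ℝ := fun p => e'.repr (p - p₁)
  have hcrd : Continuous crd := continuous_frame_repr p₁ e'
  have hback : ∀ p, framePt p₁ e' (crd p) = p := framePt_repr p₁ e'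
  -- The vertices of P are sorted into those with nonzero coordinate 1 (part of N), those of F on
  -- the axis (N'), and those to be seen (S).
  obtain ⟨C, h1, h2, h3, h4, h5, h6, h7, h8⟩ := exists_flat_cupola hm p₁ e' hs hWo hWc
    (by rw [hend1]; exact hWF hbF) (by rw [hend2]; exact hWF haF)
    (K := crd '' K) (N := crd '' (N ∪ {p ∈ P.extremePoints ℝ | e.repr (p - p₀) 1 ≠ 0}))
    (S := crd '' verticesOff P F H)
    (N' := crd '' {p ∈ P.extremePoints ℝ | p ∈ F ∧ e.repr (p - p₀) 1 = 0})
    (D := (fun g => ((xg g - t) / lam, crd (vg g))) '' L)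
    (hK.image hcrd)
    (by rintro _ ⟨p, hp, rfl⟩
        change e'.repr (p - p₁) 2 ≤ 0
        rw [(hcoord p).2.2]
        linarith [hKf p hp])
    ((hN.union (hvfin.subset (Set.sep_subset _ _)).isCompact).image hcrd)
    (by rintro _ ⟨p, hp, rfl⟩
        change e'.repr (p - p₁) 1 ≠ 0
        rw [(hcoord p).2.1]
        rcases hp with hp | hp
        · exact hNY p hp
        · exact hp.2)
    (by rintro _ ⟨p, ⟨hpe, hpF, hpY⟩, rfl⟩
        have c1 : crd p 1 = 0 := ((hcoord p).2.1).trans hpY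
        have c2 : crd p 2 = 0 := ((hcoord p).2.2).trans (by rw [hfF p hpF, sub_self])
        refine ⟨c1, c2, ?_⟩
        -- A vertex of P strictly between the two end points would be an inner point of a segment in
        -- P.
        by_contra! hlt
        obtain ⟨hl, hr⟩ := abs_lt.1 hlt
        have hmem := (mem_extremePoints.1 hpe).2 _ (hFP (intrinsicInterior_subset haF)) _
          (hFP (intrinsicInterior_subset hbF)) ?_
        · have hab' := add_left_cancel (hmem.1.trans hmem.2.symm)
          exact hab.ne (smul_left_injective ℝ (e.ne_zero 0) hab')
        · have hp1 : p = p₁ + crd p 0 • e' 0 := by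
            have := repr_expand e' (p - p₁)
            rw [show e'.repr (p - p₁) 1 = 0 from c1, show e'.repr (p - p₁) 2 = 0 from c2,
              zero_smul, zero_smul, add_zero, add_zero] at this
            rw [← sub_eq_iff_eq_add', this]
          refine ⟨(1 + 3 * s - crd p 0) / (2 * (1 + 3 * s)), (1 + 3 * s + crd p 0) / (2 * (1 + 3 * s)),
            div_pos (by linarith) (by positivity), div_pos (by linarith) (by positivity),
            by field_simp; ring, ?_⟩
          rw [← hend1, ← hend2]
          nth_rw 3 [hp1]
          match_scalars <;> field_simp <;> ring)
    ((hvfin.subset fun v hv => hv.1.1).image _)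
    (by rintro _ ⟨v, hv, rfl⟩
        obtain ⟨h1, h2⟩ := hoffY v hv
        exact ⟨((hcoord v).2.1).trans h1, ((hcoord v).2.2).trans_lt (by linarith)⟩)
    (hLfin.image _)
    (by rintro _ ⟨g, hg, rfl⟩
        obtain ⟨h1, h2⟩ := hoffY _ (hvg g hg)
        refine ⟨?_, ((hcoord _).2.1).trans h1, ((hcoord _).2.2).trans_lt (by linarith)⟩
        have h3 := hsg g hg
        rw [← hlame] at h3
        have h4 : |xg g - t| * (1 + s) < lam := by
          refine lt_of_mul_lt_mul_left ?_ (show (0 : ℝ) ≤ 1 + 3 * s by positivity)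
          linarith
        change |(xg g - t) / lam| * (1 + s) < 1
        rw [abs_div, abs_of_pos hlam0, div_mul_eq_mul_div, div_lt_one hlam0]
        exact h4)
  have hback' : ∀ {T : Set E3} {p : E3}, (∀ v ∈ crd '' T, framePt p₁ e' v ∉ C.cone) → p ∈ T →
      p ∉ C.cone := fun {T p} h hp => by
    rw [← hback p]
    exact h _ ⟨p, hp, rfl⟩
  refine ⟨C, fun x hx => ⟨(h1 x hx).1, ?_⟩, fun p hp => ?_, h3, fun p hp => ?_,
    fun p hp => hback' h5 (Or.inl hp), fun p hp hpC => ?_, h7, fun g hg => ?_⟩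
  · have := (h1 x hx).2
    rw [(hcoord x).2.2] at this
    linarith
  · rw [← hback p]
    exact h2 _ ⟨p, hp, rfl⟩
  · rw [← hback p]
    exact h4 _ ⟨p, hp, rfl⟩
  · have hY : e.repr (p - p₀) 1 = 0 := by
      by_contra hY
      exact hback' h5 (Or.inr ⟨hp, hY⟩) hpC
    have hpF : p ∉ F := fun hpF => hback' h6 ⟨hp, hpF, hY⟩ hpC
    exact ⟨⟨hp, hYv p hp hpF hY⟩, hpF⟩
  · refine h8 _ ⟨g, hg, rfl⟩ g ?_ ?_
    · have : p₁ + ((xg g - t) / lam) • e' 0 = p₀ + xg g • e 0 := by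
        rw [he0, smul_smul, div_mul_cancel₀ _ hlam0.ne', hp₁]
        module
      change p₁ + ((xg g - t) / lam) • e' 0 ∈ g
      rw [this]
      exact hxgg g hg
    · change framePt p₁ e' (crd (vg g)) ∈ g
      rw [hback]
      exact hvgg g hg

/-! ### Attaching polytopes -/

section attach

variable {P F : Set E3} {n : ℕ} {K : Fin n → Set E3} {J : Set (Fin n)}

theorem attach_congr {K' : Fin n → Set E3} (h : ∀ j ∈ J, K j = K' j) :
    attach P K J = attach P K' J := by
  unfold attach
  rw [Set.iUnion₂_congr h]

theorem attach_subset {T : Set E3} (hT : Convex ℝ T) (hP : P ⊆ T) (hK : ∀ j ∈ J, K j ⊆ T) :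
    attach P K J ⊆ T :=
  convexHull_min (Set.union_subset hP (Set.iUnion₂_subset hK)) hT

theorem attach_mono {J' : Set (Fin n)} (h : J ⊆ J') : attach P K J ⊆ attach P K J' :=
  convexHull_mono (Set.union_subset_union_right _ (Set.biUnion_subset_biUnion_left h))

theorem isPolytope3_attach (hP : IsPolytope3 P)
    (hK : ∀ j, ∃ t : Set E3, t.Finite ∧ K j = convexHull ℝ t) : IsPolytope3 (attach P K J) := by
  obtain ⟨⟨s, hs, rfl⟩, hint⟩ := hP
  choose t ht hKt using hK
  refine ⟨⟨s ∪ ⋃ j ∈ J, t j, hs.union (J.toFinite.biUnion fun j _ => ht j), ?_⟩,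
    hint.mono (interior_mono (Set.subset_union_left.trans (subset_convexHull ℝ _)))⟩
  apply Set.Subset.antisymm
  · refine attach_subset (convex_convexHull ℝ _) (convexHull_mono Set.subset_union_left) ?_
    intro j hj
    rw [hKt]
    exact convexHull_mono (Set.subset_union_of_subset_right (Set.subset_biUnion_of_mem hj) _)
  · refine convexHull_mono (Set.union_subset_union (subset_convexHull ℝ s)
      (Set.iUnion₂_mono fun j _ => ?_))
    rw [hKt]
    exact subset_convexHull ℝ _

/-- A facet survives the attachment of sets strictly below it. -/
theorem IsFacetIneq.attach {f : E3 →L[ℝ] ℝ} {c : ℝ} (h : IsFacetIneq P F f c)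
    (hP : Convex ℝ P) (hK : ∀ j ∈ J, ∀ x ∈ K j, f x < c) :
    IsFacetIneq (attach P K J) F f c := by
  have hle : ∀ x ∈ P ∪ ⋃ j ∈ J, K j, f x ≤ c := by
    rintro x (hx | hx)
    · exact h.1 x hx
    · obtain ⟨j, hj, hx⟩ := Set.mem_iUnion₂.1 hx
      exact (hK j hj x hx).le
  refine ⟨fun x => le_of_mem_convexHull hle, ?_, h.2.2⟩
  have hset : (P ∪ ⋃ j ∈ J, K j) ∩ {y | f y = c} = F := by
    rw [h.2.1]
    ext x
    constructor
    · rintro ⟨hx | hx, hfx⟩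
      · exact ⟨hx, hfx⟩
      · obtain ⟨j, hj, hx⟩ := Set.mem_iUnion₂.1 hx
        exact absurd hfx (hK j hj x hx).ne
    · exact fun hx => ⟨Or.inl hx.1, hx.2⟩
  have hconv : Convex ℝ F := by
    rw [h.2.1]
    exact hP.inter (convex_hyperplane f.isLinear c)
  unfold _root_.attach
  rw [face_convexHull hle, hset, hconv.convexHull_eq]

end attach

/-- Extreme points of a convex set that contains an exposed face of a hull and lies in it. -/
theorem mem_extremePoints_of_face {S B : Set E3} {f : E3 →L[ℝ] ℝ} {c : ℝ} (hB : Convex ℝ B)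
    (hBS : B ⊆ S) (hS : ∀ x ∈ S, f x ≤ c) (hface : ∀ x ∈ S, f x = c → x ∈ B) {v : E3}
    (hv : v ∈ B.extremePoints ℝ) (hfv : f v = c) : v ∈ (convexHull ℝ S).extremePoints ℝ := by
  have hmem : ∀ x ∈ convexHull ℝ S, f x = c → x ∈ B := fun x hx hfx => by
    have : x ∈ {x ∈ convexHull ℝ S | f x = c} := ⟨hx, hfx⟩
    rw [face_convexHull hS] at this
    exact convexHull_min (fun y hy => hface y hy.1 hy.2) hB this
  refine mem_extremePoints.2 ⟨subset_convexHull ℝ _ (hBS (extremePoints_subset hv)), ?_⟩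
  intro x hx y hy hvxy
  have hx' := le_of_mem_convexHull hS hx
  have hy' := le_of_mem_convexHull hS hy
  obtain ⟨a, b, ha, hb, hab, hvx⟩ := hvxy
  have hsum : a * f x + b * f y = c := by rw [← hfv, ← hvx]; simp
  have hb' : b = 1 - a := by linarith
  subst hb'
  have hxc : f x = c := by nlinarith
  have hyc : f y = c := by nlinarith
  exact (mem_extremePoints.1 hv).2 x (hmem x hx hxc) y (hmem y hy hyc) ⟨a, _, ha, hb, hab, hvx⟩

/-- Otherwise the vertex A_0 of the cupola would be extreme in the skylight and so equal to some
B_k. -/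
theorem Cupola.not_bottom_subset_skylight {m : ℕ} (C : Cupola m) : ¬ C.bottom ⊆ C.skylight := by
  intro h
  have hA : C.A 0 ∈ C.body.extremePoints ℝ := by
    unfold Cupola.body
    rw [C.vertices_eq]
    exact ⟨(0, 0), C.q_zero 0⟩
  have hsub : C.skylight ⊆ C.body := by
    refine convexHull_mono ?_
    rintro _ ⟨k, rfl⟩
    refine ⟨(k + 2, Fin.last _), ?_⟩
    change C.q (k + 2) (Fin.last _) = C.B k
    rw [C.q_last, add_assoc]
    congr 1
    fin_cases k <;> rfl
  have hA' : C.A 0 ∈ C.skylight := h (subset_convexHull ℝ _ ⟨0, rfl⟩)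
  obtain ⟨k, hk⟩ := extremePoints_convexHull_subset
    (inter_extremePoints_subset_extremePoints_of_subset hsub ⟨hA', hA⟩)
  exact Sum.inr_ne_inl (C.schonhardt.1 (a₁ := Sum.inr k) (a₂ := Sum.inl 0) hk)

/-- Vertices of the skylight stay extreme when sets beyond the bottom are added. -/
theorem Cupola.mem_extremePoints_of_mem_skylight {m : ℕ} (C : Cupola m) {S : Set E3}
    (hCS : C.body ⊆ S) (hS : ∀ x ∈ S, x ∉ C.body → x ∈ beyond C.body C.bottom) {v : E3}
    (hv : v ∈ C.body.extremePoints ℝ) (hvB : v ∈ C.skylight) :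
    v ∈ (convexHull ℝ S).extremePoints ℝ := by
  obtain ⟨f, c, hf⟩ : IsFacet C.body C.skylight := (C.facet_iff _).2 (Or.inr (Or.inl rfl))
  have hlt : ∀ x ∈ S, x ∉ C.body → f x < c := fun x hx hxC =>
    (hS x hx hxC _ f c hf).2 C.not_bottom_subset_skylight
  refine mem_extremePoints_of_face (convex_convexHull ℝ _) hCS (f := f) (c := c) ?_ ?_ hv ?_
  · intro x hx
    by_cases hxC : x ∈ C.body
    · exact hf.1 x hxC
    · exact (hlt x hx hxC).le
  · intro x hx hfx
    by_contra hxC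
    exact (hlt x hx hxC).ne hfx
  · rw [hf.2.1] at hvB
    exact hvB.2

/-! ### Choosing all cupolas -/

/-- Cupolas over one facet whose cones avoid a fixed neighbourhood of a compact set off `H`. -/
theorem exists_separated_cupola {P F : Set E3} {f : E3 →L[ℝ] ℝ} {c : ℝ} (hP : IsPolytope3 P)
    (hF : IsFacetIneq P F f c) {H : AffineSubspace ℝ E3} (hH : IsPlane H)
    (hHF : ((H : Set E3) ∩ intrinsicInterior ℝ F).Nonempty)
    {L : Set (AffineSubspace ℝ E3)} (hLfin : L.Finite)
    (hL : ∀ g ∈ L, IsLine g ∧ g ≤ H ∧ Pierces g F ∧ ∃ v ∈ verticesOff P F H, v ∈ g)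
    {N : Set E3} (hN : IsCompact N) (hNP : N ⊆ P) (hNH : ∀ p ∈ N, p ∉ H) :
    ∃ δ > 0, ∀ m : ℕ, 1 ≤ m → ∀ W K : Set E3, IsOpen W → Convex ℝ W →
      intrinsicInterior ℝ F ⊆ W → IsCompact K → (∀ p ∈ K, f p ≤ c) →
      ∃ C : Cupola m, (∀ x ∈ C.body, x ∈ W ∧ c < f x) ∧ K ⊆ beyond C.body C.bottom ∧
      IsTriangularCone C.cone ∧ verticesOff P F H ⊆ interior C.cone ∧
      (∀ p ∈ Metric.cthickening δ N, p ∉ C.cone) ∧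
      (∀ p ∈ P.extremePoints ℝ, p ∈ C.cone → p ∈ verticesOff P F H) ∧
      C.body.extremePoints ℝ ∩ C.cone = Set.range C.B ∧ ∀ g ∈ L, Pierces g C.skylight := by
  have hfull := vectorSpan_eq_top_of_interior hP.2
  have hvfin : (P.extremePoints ℝ \ F).Finite := by
    obtain ⟨⟨s, hs, rfl⟩, -⟩ := hP
    exact (hs.subset extremePoints_convexHull_subset).subset Set.sdiff_subset
  obtain ⟨p₀, e, hp₀, h0, h1, h2, hNY, hYH⟩ := exists_frame hfull hF hH hHF
    (N := N ∪ P.extremePoints ℝ \ F) (hN.union hvfin.isCompact)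
    (by rintro p (hp | hp)
        · exact hF.1 p (hNP hp)
        · exact hF.1 p (extremePoints_subset hp.1))
    (by rintro p (hp | hp) hfp
        · exact hNH p hp
        · refine absurd ?_ hp.2
          rw [hF.2.1]
          exact ⟨extremePoints_subset hp.1, hfp⟩)
  have hYc : Continuous fun p : E3 => e.repr (p - p₀) 1 :=
    (continuous_apply 1).comp (continuous_frame_repr p₀ e)
  -- The radius depends on the frame alone, so it is available before the cupolas over the other
  -- facets are placed.
  obtain ⟨δ, hδ, hδN⟩ := hN.exists_cthickening_subset_open
    (t := {p : E3 | e.repr (p - p₀) 1 ≠ 0}) (isOpen_ne_fun hYc continuous_const)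
    (fun p hp h => hNH p hp (hNY p (Or.inl hp) h))
  refine ⟨δ, hδ, fun m hm W K hWo hWc hWF hK hKf => ?_⟩
  exact exists_local_cupola hP hF hp₀ h0 h1 h2 (fun v hv hvF => hNY v (Or.inr ⟨hv, hvF⟩)) hYH
    hLfin hL hm hWo hWc hWF hK hKf hN.cthickening hδN

/-- Successive choice of the entries of a finite dependent sequence. -/
theorem exists_forall_of_forall_update {n : ℕ} {α : Fin n → Type*} (R : Fin n → (∀ j, α j) → Prop)
    (hcongr : ∀ i a b, (∀ j ≤ i, a j = b j) → R i a → R i b) (a₀ : ∀ j, α j)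
    (hstep : ∀ i a, (∀ j < i, R j a) → ∃ x, R i (Function.update a i x)) :
    ∃ a, ∀ i, R i a := by
  have key : ∀ k : ℕ, ∃ a, ∀ i : Fin n, i.1 < k → R i a := by
    intro k
    induction k with
    | zero => exact ⟨a₀, fun i hi => absurd hi (Nat.not_lt_zero _)⟩
    | succ k ih =>
      obtain ⟨a, ha⟩ := ih
      by_cases hk : k < n
      · obtain ⟨x, hx⟩ := hstep ⟨k, hk⟩ a fun j hj => ha j hj
        refine ⟨Function.update a ⟨k, hk⟩ x, fun i hi => ?_⟩
        rcases Nat.lt_succ_iff_lt_or_eq.1 hi with h | rfl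
        · refine hcongr i a _ (fun j hj => ?_) (ha i h)
          rw [Function.update_of_ne]
          rintro rfl
          exact absurd h (not_lt.2 hj)
        · exact hx
      · exact ⟨a, fun i _ => ha i (i.2.trans_le (not_lt.1 hk))⟩
  obtain ⟨a, ha⟩ := key n
  exact ⟨a, fun i => ha i i.2⟩

/-! ### The simultaneous choice and the vertices seen in the final polytope -/

theorem mainTheorem7
    (P : Set E3) (hP : IsPolytope3 P) (n : ℕ)
    (F : Fin n → Set E3) (hF : ∀ i, IsFacet P (F i))
    (H : Fin n → AffineSubspace ℝ E3) (hH : ∀ i, IsPlane (H i))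
    (hHF : ∀ i, ((H i : Set E3) ∩ intrinsicInterior ℝ (F i)).Nonempty)
    (hdisj : ∀ i j, i ≠ j → F i ∩ (H j : Set E3) = ∅)
    (L : Fin n → Set (AffineSubspace ℝ E3)) (hLfin : ∀ i, (L i).Finite)
    (hL : ∀ i, ∀ g ∈ L i, IsLine g ∧ g ≤ H i ∧ Pierces g (F i) ∧
      ∃ v ∈ verticesOff P (F i) (H i), v ∈ g)
    (m : Fin n → ℕ) (hm : ∀ i, 1 ≤ m i) :
    ∃ C : (i : Fin n) → Cupola (m i),
      -- the cupola `C i` is beyond the facet `F i` of `P`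
      (∀ i, (C i).body ⊆ beyond P (F i)) ∧
      -- step `i` of the sequential construction attaches `C i` beyond the facet `F i` of the
      -- polytope built so far, and that polytope is beyond the bottom of `C i`
      (∀ i, IsFacet (attach P (fun j => (C j).body) {j | j < i}) (F i) ∧
        (C i).body ⊆ beyond (attach P (fun j => (C j).body) {j | j < i}) (F i) ∧
        attach P (fun j => (C j).body) {j | j < i} ⊆ beyond (C i).body (C i).bottom) ∧
      -- in the end, `P` and all the other cupolas are beyond the bottom of `C i`
      (∀ i, attach P (fun j => (C j).body) {j | j ≠ i} ⊆ beyond (C i).body (C i).bottom) ∧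
      -- the visibility cones contain exactly the prescribed vertices of the resulting polytope,
      -- apart from the vertices of the skylight that spans the cone
      (∀ i, IsTriangularCone (C i).cone ∧
        verticesOff P (F i) (H i) ⊆ interior (C i).cone ∧
        (attach P (fun j => (C j).body) Set.univ).extremePoints ℝ ∩ (C i).cone =
          verticesOff P (F i) (H i) ∪ Set.range (C i).B) ∧
      -- the prescribed lines pierce the skylights
      (∀ i, ∀ g ∈ L i, Pierces g (C i).skylight) := by
  have hfull := vectorSpan_eq_top_of_interior hP.2
  choose f c hfc using hF
  obtain ⟨hPc, hPk, hvfin⟩ : Convex ℝ P ∧ IsCompact P ∧ (P.extremePoints ℝ).Finite := by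
    obtain ⟨⟨s, hs, rfl⟩, -⟩ := hP
    exact ⟨convex_convexHull ℝ _, hs.isCompact_convexHull ℝ, hs.subset extremePoints_convexHull_subset⟩
  have hFP : ∀ i, F i ⊆ P := fun i x hx => by rw [(hfc i).2.1] at hx; exact hx.1
  have hFeq : ∀ i, F i = P ∩ {x | f i x = c i} := fun i => (hfc i).2.1
  have hFk : ∀ i, IsCompact (F i) := fun i => by
    rw [hFeq i]
    exact hPk.inter_right (isClosed_eq (f i).continuous continuous_const)
  have hFc : ∀ i, Convex ℝ (F i) := fun i => by
    rw [hFeq i]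
    exact hPc.inter (convex_hyperplane (f i).isLinear (c i))
  have hFF : ∀ i j, j ≠ i → ¬ F j ⊆ F i := by
    intro i j hji hsub
    have heq := (hfc j).eq_of_subset hfull (hfc i) hsub
    obtain ⟨x, hxH, hx⟩ := hHF i
    have : x ∈ F j ∩ (H i : Set E3) := ⟨heq ▸ intrinsicInterior_subset hx, hxH⟩
    rw [hdisj j i hji] at this
    exact this
  -- separation of the cones from the other facets
  let N : Fin n → Set E3 := fun i => ⋃ j ∈ {j | j ≠ i}, F j
  have hFN : ∀ i j, j ≠ i → F j ⊆ N i := fun i j hji =>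
    Set.subset_biUnion_of_mem (u := F) (show j ∈ {j | j ≠ i} from hji)
  have hcup := fun i => exists_separated_cupola hP (hfc i) (hH i) (hHF i) (hLfin i) (hL i)
    (N := N i) ((Set.toFinite _).isCompact_biUnion fun j _ => hFk j)
    (Set.iUnion₂_subset fun j _ => hFP j)
    (fun p hp hpH => by
      obtain ⟨j, hj, hpj⟩ := Set.mem_iUnion₂.1 hp
      have : p ∈ F j ∩ (H i : Set E3) := ⟨hpj, hpH⟩
      rw [hdisj j i hj] at this
      exact this)
  choose δ hδ hcup using hcup
  have hexp : ∀ v : P.extremePoints ℝ, ∃ g : E3 →L[ℝ] ℝ, ∀ x ∈ P, x ≠ v → g x < g v := by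
    rintro ⟨v, hv⟩
    obtain ⟨⟨s, hs, rfl⟩, -⟩ := hP
    exact exists_exposing hs hv
  choose g hg using hexp
  have : Finite (P.extremePoints ℝ) := hvfin
  -- the regions in which the cupolas are built
  let W : Fin n → Set E3 := fun i => facetRegion P (F i) ∩ Metric.thickening 1 P ∩
    -- The roles are exchanged here: a cupola over `F i` stays within δ j of `F i`, a neighbourhood
    -- that the cone over `F j` avoids.
    (⋂ j ∈ {j | j ≠ i}, Metric.thickening (δ j) (F i)) ∩
    -- These half-spaces keep every vertex of P outside `F i` exposed after the cupola is attached.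
    ⋂ v ∈ {v : P.extremePoints ℝ | (v : E3) ∉ F i}, {x | g v x < g v v}
  have hWo : ∀ i, IsOpen (W i) := fun i =>
    (((isOpen_facetRegion hP _).inter Metric.isOpen_thickening).inter
      ((Set.toFinite _).isOpen_biInter fun j _ => Metric.isOpen_thickening)).inter
      ((Set.toFinite _).isOpen_biInter fun v _ => isOpen_lt (g v).continuous continuous_const)
  have hWc : ∀ i, Convex ℝ (W i) := fun i =>
    (((convex_facetRegion _ _).inter (hPc.thickening _)).inter
      (convex_iInter₂ fun j _ => (hFc i).thickening _)).inter
      (convex_iInter₂ fun v _ => convex_halfSpace_lt (g v).isLinear _)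
  have hWF : ∀ i, intrinsicInterior ℝ (F i) ⊆ W i := by
    intro i x hx
    have hxF := intrinsicInterior_subset hx
    refine ⟨⟨⟨intrinsicInterior_subset_facetRegion (hFP i) hx,
      Metric.self_subset_thickening one_pos _ (hFP i hxF)⟩, ?_⟩, ?_⟩
    · exact Set.mem_iInter₂.2 fun j _ => Metric.self_subset_thickening (hδ j) _ hxF
    · exact Set.mem_iInter₂.2 fun v hv => hg v x (hFP i hxF) fun h => hv (h ▸ hxF)
  obtain ⟨R, hR⟩ := (hPk.isBounded.thickening (δ := 1)).subset_closedBall (0 : E3)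
  -- A compact set fixed in advance that contains P and every later cupola over another facet: all
  -- of them lie in the unit neighbourhood of P and satisfy the inequality of `F i`.
  let K : Fin n → Set E3 := fun i => Metric.closedBall 0 R ∩ {x | f i x ≤ c i}
  have hKk : ∀ i, IsCompact (K i) := fun i =>
    (isCompact_closedBall _ _).inter_right (isClosed_le (f i).continuous continuous_const)
  have hPK : ∀ i, P ⊆ K i := fun i x hx =>
    ⟨hR (Metric.self_subset_thickening one_pos _ hx), (hfc i).1 x hx⟩
  let Good : ∀ i, Cupola (m i) → Prop := fun i C =>
    (∀ x ∈ C.body, x ∈ W i ∧ c i < f i x) ∧ K i ⊆ beyond C.body C.bottom ∧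
      IsTriangularCone C.cone ∧ verticesOff P (F i) (H i) ⊆ interior C.cone ∧
      (∀ p ∈ Metric.cthickening (δ i) (N i), p ∉ C.cone) ∧
      (∀ p ∈ P.extremePoints ℝ, p ∈ C.cone → p ∈ verticesOff P (F i) (H i)) ∧
      C.body.extremePoints ℝ ∩ C.cone = Set.range C.B ∧ ∀ g ∈ L i, Pierces g C.skylight
  have hgood : ∀ i (U : Set E3), IsOpen U → Convex ℝ U → intrinsicInterior ℝ (F i) ⊆ U →
      ∃ C, Good i C ∧ C.body ⊆ U := by
    intro i U hUo hUc hUF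
    obtain ⟨C, h1, h2⟩ := hcup i (m i) (hm i) (W i ∩ U) (K i) ((hWo i).inter hUo)
      ((hWc i).inter hUc) (Set.subset_inter (hWF i) hUF) (hKk i) fun p hp => hp.2
    exact ⟨C, ⟨fun x hx => ⟨(h1 x hx).1.1, (h1 x hx).2⟩, h2⟩, fun x hx => (h1 x hx).1.2⟩
  have hlt : ∀ i j, j ≠ i → ∀ C, Good j C → ∀ x ∈ C.body, f i x < c i :=
    fun i j hji C hC x hx => (hC.1 x hx).1.1.1.1 _ _ _ (hfc i) (hFF i j hji)
  -- Only the sequential condition refers to other cupolas, and only to earlier ones, so a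
  -- successive choice works.
  obtain ⟨C, hC⟩ := exists_forall_of_forall_update
    (fun i (C : ∀ j, Cupola (m j)) => Good i (C i) ∧
      (C i).body ⊆ beyond (attach P (fun j => (C j).body) {j | j < i}) (F i))
    (by
      rintro i a b hab ⟨h1, h2⟩
      rw [hab i le_rfl] at h1 h2
      refine ⟨h1, ?_⟩
      rwa [attach_congr (J := {j | j < i}) (K' := fun j => (b j).body)
        fun j (hj : j < i) => congrArg Cupola.body (hab j hj.le)] at h2)
    (fun i => (hgood i Set.univ isOpen_univ convex_univ (Set.subset_univ _)).choose)
    (by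
      intro i a ha
      have hP' : IsPolytope3 (attach P (fun j => (a j).body) {j | j < i}) :=
        isPolytope3_attach hP fun j => ⟨_, Set.finite_range _, rfl⟩
      -- The earlier cupolas lie strictly below the plane of `F i`, so `F i` is still a facet and
      -- its region is again open, convex and contains its relative interior.
      have hF' : IsFacetIneq (attach P (fun j => (a j).body) {j | j < i}) (F i) (f i) (c i) :=
        (hfc i).attach hPc fun j (hj : j < i) => hlt i j hj.ne _ (ha j hj).1
      obtain ⟨x, hx, hxU⟩ := hgood i _ (isOpen_facetRegion hP' (F i)) (convex_facetRegion _ _)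
        (intrinsicInterior_subset_facetRegion fun y hy => by
          rw [hF'.2.1] at hy; exact hy.1)
      refine ⟨x, by rwa [Function.update_self], ?_⟩
      rw [Function.update_self, attach_congr (J := {j | j < i}) (K' := fun j => (a j).body)
        fun j (hj : j < i) => by rw [Function.update_of_ne hj.ne]]
      exact fun y hy => mem_beyond_of_mem_facetRegion (vectorSpan_eq_top_of_interior hP'.2) hF'
        (hxU hy) (hx.1 y hy).2)
  have hbK : ∀ i j, j ≠ i → (C j).body ⊆ K i := fun i j hji x hx =>
    ⟨hR ((hC j).1.1 x hx).1.1.1.2, (hlt i j hji _ (hC j).1 x hx).le⟩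
  have hbN : ∀ i j, j ≠ i → ∀ x ∈ (C j).body, x ∉ (C i).cone := fun i j hji x hx => by
    refine (hC i).1.2.2.2.2.1 x (Metric.cthickening_subset_of_subset _ (hFN i j hji)
      (Metric.thickening_subset_cthickening _ _ ?_))
    exact Set.mem_iInter₂.1 ((hC j).1.1 x hx).1.1.2 i hji.symm
  have hbottom : ∀ i, attach P (fun j => (C j).body) {j | j ≠ i} ⊆
      beyond (C i).body (C i).bottom := fun i =>
    (attach_subset ((convex_closedBall (0 : E3) R).inter (convex_halfSpace_le (f i).isLinear (c i)))
      (hPK i) fun j hj => hbK i j hj).trans (hC i).1.2.1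
  refine ⟨C, fun i x hx => ?_, fun i => ⟨⟨f i, c i, ?_⟩, (hC i).2, ?_⟩, hbottom, fun i =>
    ⟨(hC i).1.2.2.1, (hC i).1.2.2.2.1, ?_⟩, fun i => (hC i).1.2.2.2.2.2.2.2⟩
  · exact mem_beyond_of_mem_facetRegion hfull (hfc i) ((hC i).1.1 x hx).1.1.1.1
      ((hC i).1.1 x hx).2
  · exact (hfc i).attach hPc fun j (hj : j < i) => hlt i j hj.ne _ (hC j).1
  · exact (attach_mono fun j (hj : j < i) => hj.ne).trans (hbottom i)
  · obtain ⟨-, -, -, hint, hNc, hvc, hBc, -⟩ := (hC i).1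
    have hbS : ∀ j, (C j).body ⊆ P ∪ ⋃ j ∈ Set.univ, (C j).body := fun j =>
      Set.subset_union_of_subset_right
        (Set.subset_biUnion_of_mem (u := fun j => (C j).body) (Set.mem_univ j)) _
    apply Set.Subset.antisymm
    · rintro v ⟨hv, hvcone⟩
      have hsub : ∀ {T : Set E3}, T ⊆ P ∪ ⋃ j ∈ Set.univ, (C j).body → v ∈ T →
          v ∈ T.extremePoints ℝ := fun hT hvT =>
        inter_extremePoints_subset_extremePoints_of_subset
          (hT.trans (subset_convexHull ℝ _)) ⟨hvT, hv⟩
      rcases extremePoints_convexHull_subset hv with hvP | hvC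
      · exact Or.inl (hvc v (hsub Set.subset_union_left hvP) hvcone)
      · obtain ⟨j, -, hvj⟩ := Set.mem_iUnion₂.1 hvC
        by_cases hji : j = i
        · subst hji
          exact Or.inr (hBc ▸ ⟨hsub (hbS j) hvj, hvcone⟩)
        · exact absurd hvcone (hbN i j hji v hvj)
    · rintro v (hv | hv)
      · have hvcone := interior_subset (hint hv)
        refine ⟨mem_extremePoints_of_exposing (Or.inl (extremePoints_subset hv.1.1))
          (g := g ⟨v, hv.1.1⟩) ?_, hvcone⟩
        rintro y (hy | hy) hyv
        · exact hg ⟨v, hv.1.1⟩ y hy hyv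
        · obtain ⟨j, -, hyj⟩ := Set.mem_iUnion₂.1 hy
          refine Set.mem_iInter₂.1 ((hC j).1.1 y hyj).1.2 ⟨v, hv.1.1⟩ ?_
          -- A prescribed vertex cannot lie on the facet under any cupola: it is off `F i` by
          -- definition, and the cone containing it avoids the other facets.
          intro hvF
          by_cases hji : j = i
          · exact hv.2 (hji ▸ hvF)
          · exact hNc v (Metric.self_subset_cthickening _ (hFN i j hji hvF)) hvcone
      · rw [← hBc] at hv
        -- All points added to the cupola are beyond its bottom, hence strictly below the skylight
        -- plane, so the skylight remains a face.
        refine ⟨(C i).mem_extremePoints_of_mem_skylight (hbS i) ?_ hv.1 ?_, hv.2⟩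
        · rintro x (hx | hx) hxC
          · exact hbottom i (subset_convexHull ℝ _ (Or.inl hx))
          · obtain ⟨j, -, hxj⟩ := Set.mem_iUnion₂.1 hx
            have hji : j ≠ i := by rintro rfl; exact hxC hxj
            exact hbottom i (subset_convexHull ℝ _ (Or.inr (Set.mem_iUnion₂.2 ⟨j, hji, hxj⟩)))
        · rw [hBc] at hv
          exact subset_convexHull ℝ _ hv
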